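/- Let $\langle\cdot,\cdot\rangle_d$ and $\|\cdot\|_d$ denote the inner product and norm of $L^2[0,1]^d$, the space of real square integrable functions on $[0,1]^d$. Let $(X_i,Y_i)_{i\in\mathbb Z}$ be a sequence of pairs of (jointly measurable) real-valued stochastic processes $X_i(t)$, $Y_i(s)$, $t,s\in[0,1]$, with sample paths in $L^2[0,1]$, such that the following holds. (a) There are a measurable space $S$, a measurable function $g\colon S^\infty\to L^2[0,1]\times L^2[0,1]$ and independent and identically distributed $S$-valued innovations $(\epsilon_i)_{i\in\mathbb Z}$ with $(X_i,Y_i)=g(\epsilon_i,\epsilon_{i-1},\dots)$ almost surely for all $i$. (b) For some $p>4$ and some $\alpha,\beta>1$ we have $E\|X_0\|_1^p<\infty$, $E\|Y_0\|_1^p<\infty$ and, for every $i$, as $m$ ranges over the integers $m\ge1$, $$\big(E\|X_i-X_{i,m}\|_1^p\big)^{1/p}=O(m^{-\alpha}),\qquad \big(E\|Y_i-Y_{i,m}\|_1^p\big)^{1/p}=O(m^{-\beta}),$$ where $(X_{i,m},Y_{i,m})=g(\epsilon_i,\dots,\epsilon_{i-m+1},\epsilon^*_{i-m,m},\epsilon^*_{i-m-1,m},\dots)$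 and, for each $m\ge1$, the $\epsilon^*_{i,m}$, $i\in\mathbb Z$, are independent copies of $\epsilon_0$ and the sequence $(\epsilon^*_{i,m})_{i\in\mathbb Z}$ is independent of $(\epsilon_i)_{i\in\mathbb Z}$. Let $\mu_X(t)=EX_0(t)$, $\mu_Y(s)=EY_0(s)$ and let $$D(t,s,u,v)=\sum_{\ell=-\infty}^{\infty}\mathrm{cov}\Big((X_0(t)-\mu_X(t))(Y_0(s)-\mu_Y(s)),\,(X_\ell(u)-\mu_X(u))(Y_\ell(v)-\mu_Y(v))\Big)$$ be the long-run covariance kernel. For a sample of length $T$ put $\bar X=\frac1T\sum_{i=1}^T X_i$, $\bar Y=\frac1T\sum_{i=1}^TY_i$, $\bar X_j=X_j-\bar X$, $\bar Y_j=Y_j-\bar Y$, $\hat C(t,s)=\frac1T\sum_{i=1}^T\bar X_i(t)\bar Y_i(s)$ and $\hat\xi_j(t,s)=\bar X_j(t)\bar Y_j(s)-\hat C(t,s)$. Let $$\hat\gamma_\ell(t,s,u,v)=\frac1T\sum_{j=1}^{T-\ell}\hat\xi_j(t,s)\hat\xi_{j+\ell}(u,v)\quad(\ell\ge0),\qquad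 \hat\gamma_\ell(t,s,u,v)=\frac1T\sum_{j=1-\ell}^{T}\hat\xi_j(t,s)\hat\xi_{j+\ell}(u,v)\quad(\ell<0)$$ (empty sums are $0$), and $$\hat D_T(t,s,u,v)=\sum_{\ell=-\infty}^{\infty}W_b\Big(\frac{\ell}{h}\Big)\hat\gamma_\ell(t,s,u,v).$$ Here $W_b\colon\mathbb R\to\mathbb R$ is a symmetric continuous weight function with bounded support, of order $b>0$, that is, $\lim_{x\to0}(1-W_b(x))/|x|^b$ exists and is finite and nonzero (so $W_b(0)=1$), and the bandwidth $h=h(T)$ satisfies $h\to\infty$ and $h/T^{1/2}\to0$ as $T\to\infty$. Then $D$ is well defined almost everywhere on $[0,1]^4$ (for almost every argument the means and covariances exist and the series converges absolutely), $D\in L^2[0,1]^4$, and $\hat D_T$ is a consistent estimator of $D$: $$\|D-\hat D_T\|_4=o_P(1)\qquad(T\to\infty).$$ -/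

import Mathlib

open MeasureTheory ProbabilityTheory Filter Topology
open scoped unitInterval ENNReal

noncomputable section

namespace FTS

/-- The Hilbert space `L²[0,1]` (Lebesgue measure on the unit interval). -/
abbrev L2 : Type := Lp ℝ 2 (volume : Measure I)

/-- The `L²[0,1]` norm of a function, with value in `[0, ∞]`. -/
def norm1 (f : I → ℝ) : ℝ≥0∞ := eLpNorm f 2 volume

/-- A function of four variables, seen as a function on `[0,1]⁴`. -/
def uncurry4 (f : I → I → I → I → ℝ) (z : I × I × I × I) : ℝ :=
  f z.1 z.2.1 z.2.2.1 z.2.2.2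

/-- The `L²[0,1]⁴` norm of a function of four variables, with value in `[0, ∞]`. -/
def norm4 (f : I → I → I → I → ℝ) : ℝ≥0∞ := eLpNorm (uncurry4 f) 2 volume

section Model

variable {Ω S : Type*} [MeasurableSpace Ω] [MeasurableSpace S]

/-- The innovation sequence `(ε_i, ε_{i-1}, …)`. -/
def past (ε : ℤ → Ω → S) (i : ℤ) (ω : Ω) : ℕ → S := fun k => ε (i - k) ω

/-- The sequence `(ε_i, …, ε_{i-m+1}, ε*_{i-m,m}, ε*_{i-m-1,m}, …)`; here `εs m i` is
`ε*_{i,m}`. -/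
def coupledPast (ε : ℤ → Ω → S) (εs : ℕ → ℤ → Ω → S) (m : ℕ) (i : ℤ) (ω : Ω) : ℕ → S :=
  fun k => if k < m then ε (i - k) ω else εs m (i - k) ω

/-- Joint Bernoulli shift structure, moments of order `p > 4` and `Lᵖ`-`m`-approximability at the
polynomial rates `α, β > 1`.
`X i ω t` and `Y i ω s` are (jointly measurable) real-valued processes on `[0,1]` whose paths
represent the elements `g (ε_i, ε_{i-1}, …)` of `L²[0,1] × L²[0,1]`. -/
structure WeaklyDependent (P : Measure Ω) (X Y : ℤ → Ω → I → ℝ)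
    (ε : ℤ → Ω → S) (εs : ℕ → ℤ → Ω → S) (g : (ℕ → S) → L2 × L2) (p α β : ℝ) : Prop where
  measurable_X : ∀ i, Measurable (Function.uncurry (X i))
  measurable_Y : ∀ i, Measurable (Function.uncurry (Y i))
  measurable_g : Measurable[_, borel (L2 × L2)] g
  measurable_ε : ∀ i, Measurable (ε i)
  indep_ε : iIndepFun ε P
  identDistrib_ε : ∀ i, IdentDistrib (ε i) (ε 0) P P
  /-- the Bernoulli shift representation `(X_i, Y_i) = g (ε_i, ε_{i-1}, …)` -/
  X_eq : ∀ i, ∀ᵐ ω ∂P, X i ω =ᵐ[volume] (g (past ε i ω)).1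
  Y_eq : ∀ i, ∀ᵐ ω ∂P, Y i ω =ᵐ[volume] (g (past ε i ω)).2
  measurable_εs : ∀ m, 1 ≤ m → ∀ i, Measurable (εs m i)
  /-- for each `m`, the `ε*_{i,m}` are independent of each other and of all the `ε_i` -/
  indep_εs : ∀ m, 1 ≤ m → iIndepFun (fun k : ℤ ⊕ ℤ => Sum.elim ε (εs m) k) P
  identDistrib_εs : ∀ m, 1 ≤ m → ∀ i, IdentDistrib (εs m i) (ε 0) P P
  four_lt_p : 4 < p
  one_lt_α : 1 < α
  one_lt_β : 1 < β
  moment_X : ∫⁻ ω, norm1 (X 0 ω) ^ p ∂P < ∞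
  moment_Y : ∫⁻ ω, norm1 (Y 0 ω) ^ p ∂P < ∞
  /-- `(E ‖X_i - X_{i,m}‖ᵖ)^{1/p} = O(m^{-α})` -/
  approx_X : ∀ i, ∃ C : ℝ, ∀ m : ℕ, 1 ≤ m →
    (∫⁻ ω, norm1 (fun t => X i ω t - (g (coupledPast ε εs m i ω)).1 t) ^ p ∂P) ^ (1 / p)
      ≤ ENNReal.ofReal (C * (m : ℝ) ^ (-α))
  /-- `(E ‖Y_i - Y_{i,m}‖ᵖ)^{1/p} = O(m^{-β})` -/
  approx_Y : ∀ i, ∃ C : ℝ, ∀ m : ℕ, 1 ≤ m →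
    (∫⁻ ω, norm1 (fun t => Y i ω t - (g (coupledPast ε εs m i ω)).2 t) ^ p ∂P) ^ (1 / p)
      ≤ ENNReal.ofReal (C * (m : ℝ) ^ (-β))

/-- The mean function `t ↦ E X_0(t)`. -/
def meanFun (P : Measure Ω) (X : ℤ → Ω → I → ℝ) (t : I) : ℝ := ∫ ω, X 0 ω t ∂P

/-- The random function `(X_i(t) - μ_X(t)) (Y_i(s) - μ_Y(s))`. -/
def centeredProduct (P : Measure Ω) (X Y : ℤ → Ω → I → ℝ) (i : ℤ) (t s : I) (ω : Ω) : ℝ :=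
  (X i ω t - meanFun P X t) * (Y i ω s - meanFun P Y s)

/-- The lag-`ℓ` autocovariance kernel of the sequence of centered products. -/
def autocov (P : Measure Ω) (X Y : ℤ → Ω → I → ℝ) (ℓ : ℤ) (t s u v : I) : ℝ :=
  cov[centeredProduct P X Y 0 t s, centeredProduct P X Y ℓ u v; P]

/-- The long run covariance kernel `D(t,s,u,v)`. -/
def longRunCov (P : Measure Ω) (X Y : ℤ → Ω → I → ℝ) (t s u v : I) : ℝ :=
  ∑' ℓ : ℤ, autocov P X Y ℓ t s u v

/-- The sample mean function of `X_1, …, X_T`. -/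
def sampleMean (X : ℤ → Ω → I → ℝ) (T : ℕ) (ω : Ω) (t : I) : ℝ :=
  (1 / (T : ℝ)) * ∑ i ∈ Finset.Icc (1 : ℤ) T, X i ω t

/-- The full-sample cross-covariance estimator `Ĉ_XY(t,s,1)`. -/
def sampleCrossCov (X Y : ℤ → Ω → I → ℝ) (T : ℕ) (ω : Ω) (t s : I) : ℝ :=
  (1 / (T : ℝ)) * ∑ i ∈ Finset.Icc (1 : ℤ) T,
    (X i ω t - sampleMean X T ω t) * (Y i ω s - sampleMean Y T ω s)

/-- `X̄_j(t) Ȳ_j(s) - Ĉ_XY(t,s,1)`, where `X̄_j = X_j - X̄` and `Ȳ_j = Y_j - Ȳ`. -/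
def residual (X Y : ℤ → Ω → I → ℝ) (T : ℕ) (ω : Ω) (j : ℤ) (t s : I) : ℝ :=
  (X j ω t - sampleMean X T ω t) * (Y j ω s - sampleMean Y T ω s) - sampleCrossCov X Y T ω t s

/-- The empirical lag-`ℓ` autocovariance kernel. -/
def sampleAutocov (X Y : ℤ → Ω → I → ℝ) (T : ℕ) (ω : Ω) (ℓ : ℤ) (t s u v : I) : ℝ :=
  if 0 ≤ ℓ then
    (1 / (T : ℝ)) * ∑ j ∈ Finset.Icc (1 : ℤ) (T - ℓ),
      residual X Y T ω j t s * residual X Y T ω (j + ℓ) u v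
  else
    (1 / (T : ℝ)) * ∑ j ∈ Finset.Icc (1 - ℓ) (T : ℤ),
      residual X Y T ω j t s * residual X Y T ω (j + ℓ) u v

/-- The lag-window estimator with weight function `W` and bandwidth `h`. The sum has finitely many
nonzero terms, since the empirical autocovariance vanishes for `|ℓ| ≥ T`. -/
def estimator (X Y : ℤ → Ω → I → ℝ) (W : ℝ → ℝ) (h : ℕ → ℝ) (T : ℕ) (ω : Ω)
    (t s u v : I) : ℝ :=
  ∑' ℓ : ℤ, W ((ℓ : ℝ) / h T) * sampleAutocov X Y T ω ℓ t s u v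

/-- `Z_T = o_P(1)` as `T → ∞`, for `[0, ∞]`-valued `Z_T`. -/
def IsLittleOP (P : Measure Ω) (Z : ℕ → Ω → ℝ≥0∞) : Prop :=
  ∀ δ : ℝ, 0 < δ → Tendsto (fun T => P {ω | ENNReal.ofReal δ ≤ Z T ω}) atTop (𝓝 0)

end Model

/-- A symmetric continuous weight function (lag window) with bounded support, of order
(characteristic exponent) `b`: `(1 - W x) / |x|^b` has a finite nonzero limit at `0`. In
particular `W 0 = 1`. -/
structure IsWeightFunction (W : ℝ → ℝ) (b : ℝ) : Prop where
  continuous : Continuous W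
  symm : ∀ x, W (-x) = W x
  compactSupport : HasCompactSupport W
  order_pos : 0 < b
  order : ∃ k : ℝ, k ≠ 0 ∧ Tendsto (fun x => (1 - W x) / |x| ^ b) (𝓝[≠] 0) (𝓝 k)

end FTS

end

set_option linter.unusedSectionVars false

/-! Let x_j, y_j be the components of g(ε_j, ε_{j-1}, …) and let ζ_j be (x_j - μ_X) ⊗ (y_j - μ_Y)
minus its mean, a random element of L²([0,1]²). Up to representatives, D̂_T is the quadratic form
T⁻¹ ∑ W((k-j)/h) r_j ⊗ r_k over 1 ≤ j, k ≤ T, where r_j is the sample-centred analogue of ζ_j, and D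
= ∑_ℓ E[ζ_0 ⊗ ζ_ℓ]. Since p > 4, Hölder gives ζ_j second moments and an L² coupling error of order
m^{-γ} with γ = min(α, β) > 1.

Passing from r_j to ζ_j costs O_P(h/√T), because averages of centred terms are O_P(T^{-1/2}); this
is `norm_quadForm_sampleResidual_sub_le`.

The core is the L¹ convergence of the form in ζ, `Approximable.tendsto_quadForm`. Without fourth
moments of ζ its variance is not available, and replacing ζ by a sequence of finite range at once
costs a factor of the band width. Instead the range is doubled step by step. For two sequences of
range n, with band width L, pairs at distance at most 2n contribute O(nT) trivially. The remaining
pairs give a sum of tensors which are orthogonal once their indices are more than 2n apart, of L²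
norm O(n √(TL)) (`FiniteRange.lpBound_upperForm`). Hence going from range 2^k to 2^{k+1} changes the
form by O(T 2^k 2^{-γk}), which is summable since γ > 1, uniformly in L
(`lpBound_quadForm_sub_of_dyadic`). At a fixed range the variables may be truncated, and the form of
a bounded sequence fluctuates by O(√(TL)) = o(T). The expectation converges by dominated
convergence, the covariances being summable.

Finally, Bochner integrals and series in L² are identified with the pointwise means, covariances and
series (`Represents.integral`, `WeaklyDependent.ae_hasSum_autocov`). -/

namespace FTS

/-! ### Calculus of real upper bounds for Lᵠ norms. -/

section LpBound

variable {Ω : Type*} [MeasurableSpace Ω] {P : Measure Ω} {E F G : Type*}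
  [NormedAddCommGroup E] [NormedSpace ℝ E] [NormedAddCommGroup F] [NormedSpace ℝ F]
  [NormedAddCommGroup G] [NormedSpace ℝ G] {p q r : ℝ≥0∞} {f g : Ω → E} {s t : ℝ}

/-- `f` is a.e. strongly measurable with `Lᵠ` norm at most the real number `s`. -/
structure LpBound (P : Measure Ω) (q : ℝ≥0∞) (f : Ω → E) (s : ℝ) : Prop where
  aesm : AEStronglyMeasurable f P
  le : eLpNorm f q P ≤ ENNReal.ofReal s

namespace LpBound

lemma memLp (hf : LpBound P q f s) : MemLp f q P := ⟨hf.aesm, hf.le.trans_lt ENNReal.ofReal_lt_top⟩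

lemma integrable [IsFiniteMeasure P] (hf : LpBound P q f s) (hq : 1 ≤ q) : Integrable f P :=
  hf.memLp.integrable hq

lemma mono (hf : LpBound P q f s) (h : s ≤ t) : LpBound P q f t :=
  ⟨hf.aesm, hf.le.trans (ENNReal.ofReal_le_ofReal h)⟩

lemma congr (hf : LpBound P q f s) (h : f =ᵐ[P] g) : LpBound P q g s :=
  ⟨hf.aesm.congr h, (eLpNorm_congr_ae h).ge.trans hf.le⟩

lemma add (hf : LpBound P q f s) (hg : LpBound P q g t) (hq : 1 ≤ q) (hs : 0 ≤ s) (ht : 0 ≤ t) :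
    LpBound P q (fun ω => f ω + g ω) (s + t) :=
  ⟨hf.aesm.add hg.aesm, (eLpNorm_add_le hf.aesm hg.aesm hq).trans
    ((add_le_add hf.le hg.le).trans_eq (ENNReal.ofReal_add hs ht).symm)⟩

lemma neg (hf : LpBound P q f s) : LpBound P q (fun ω => -f ω) s :=
  ⟨hf.aesm.neg, (eLpNorm_neg f q P).le.trans hf.le⟩

lemma sub (hf : LpBound P q f s) (hg : LpBound P q g t) (hq : 1 ≤ q) (hs : 0 ≤ s) (ht : 0 ≤ t) :
    LpBound P q (fun ω => f ω - g ω) (s + t) := by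
  simpa only [sub_eq_add_neg] using hf.add hg.neg hq hs ht

lemma const_smul (hf : LpBound P q f s) (c : ℝ) : LpBound P q (fun ω => c • f ω) (|c| * s) := by
  refine ⟨hf.aesm.const_smul c, (eLpNorm_const_smul c f q P).le.trans ?_⟩
  rw [ENNReal.ofReal_mul (abs_nonneg c), ← Real.norm_eq_abs, ofReal_norm]
  gcongr
  exact hf.le

lemma sum {ι : Type*} {J : Finset ι} {f : ι → Ω → E} {s : ι → ℝ}
    (hf : ∀ i ∈ J, LpBound P q (f i) (s i)) (hq : 1 ≤ q) (hs : ∀ i ∈ J, 0 ≤ s i) :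
    LpBound P q (fun ω => ∑ i ∈ J, f i ω) (∑ i ∈ J, s i) := by
  have e : (fun ω => ∑ i ∈ J, f i ω) = ∑ i ∈ J, f i := by ext ω; simp
  rw [e]
  refine ⟨Finset.aestronglyMeasurable_sum _ fun i hi => (hf i hi).aesm,
    (eLpNorm_sum_le (fun i hi => (hf i hi).aesm) hq).trans ?_⟩
  rw [ENNReal.ofReal_sum_of_nonneg hs]
  exact Finset.sum_le_sum fun i hi => (hf i hi).le

lemma mono_exponent [IsProbabilityMeasure P] (hf : LpBound P q f s) (h : p ≤ q) :
    LpBound P p f s :=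
  ⟨hf.aesm, (eLpNorm_le_eLpNorm_of_exponent_le h hf.aesm).trans hf.le⟩

lemma of_norm_le [IsProbabilityMeasure P] (hf : AEStronglyMeasurable f P) (h : ∀ ω, ‖f ω‖ ≤ s) :
    LpBound P q f s :=
  ⟨hf, (eLpNorm_le_of_ae_bound (ae_of_all _ h)).trans (by simp)⟩

lemma bilin [hpqr : p.HolderTriple q r] {f : Ω → E} {g : Ω → F} (hf : LpBound P p f s)
    (hg : LpBound P q g t) (τ : E →L[ℝ] F →L[ℝ] G) (hτ : ∀ x y, ‖τ x y‖ ≤ ‖x‖ * ‖y‖) (hs : 0 ≤ s) :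
    LpBound P r (fun ω => τ (f ω) (g ω)) (s * t) := by
  refine ⟨?_, (eLpNorm_le_eLpNorm_mul_eLpNorm'_of_norm (p := p) (q := q) hf.aesm hg.aesm
    (fun x y => τ x y) 1 (ae_of_all _ fun ω => by simpa using hτ _ _)).trans ?_⟩
  · exact τ.aestronglyMeasurable_comp₂ hf.aesm hg.aesm
  · rw [ENNReal.ofReal_mul hs]
    simpa using mul_le_mul' hf.le hg.le

lemma norm_integral_le (hf : LpBound P 1 f s) (hs : 0 ≤ s) : ‖∫ ω, f ω ∂P‖ ≤ s := by
  have h := enorm_integral_le_lintegral_enorm (μ := P) f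
  rw [← eLpNorm_one_eq_lintegral_enorm] at h
  have h2 := h.trans hf.le
  rwa [← ofReal_norm, ENNReal.ofReal_le_ofReal_iff hs] at h2

lemma const [IsProbabilityMeasure P] (c : E) : LpBound P q (fun _ => c) ‖c‖ :=
  of_norm_le aestronglyMeasurable_const fun _ => le_rfl

lemma center [IsProbabilityMeasure P] (hf : LpBound P q f s) (hq : 1 ≤ q) (hs : 0 ≤ s) :
    LpBound P q (fun ω => f ω - ∫ x, f x ∂P) (2 * s) := by
  rw [two_mul]
  exact hf.sub ((const _).mono ((hf.mono_exponent hq).norm_integral_le hs)) hq hs hs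

end LpBound

end LpBound

/-! ### Sums of weakly correlated vectors; bilinear maps of independent variables. -/

section Hilbert

variable {E : Type*} [NormedAddCommGroup E] [InnerProductSpace ℝ E]

/-- Expand the square: each row of the Gram matrix is dominated by a reflected translate of `c`. The
norm of the sum therefore grows like the square root of the number of terms. -/
lemma norm_sum_sq_le_of_inner_le {V : ℤ → E} {c : ℤ → ℝ} (hc : Summable c)
    (h : ∀ j k, |inner ℝ (V j) (V k)| ≤ c (j - k)) (J : Finset ℤ) :
    ‖∑ j ∈ J, V j‖ ^ 2 ≤ J.card * ∑' d, c d := by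
  have hc0 : ∀ d, 0 ≤ c d := fun d => by simpa using (abs_nonneg _).trans (h d 0)
  rw [← real_inner_self_eq_norm_sq, sum_inner, ← nsmul_eq_mul]
  refine Finset.sum_le_card_nsmul _ _ _ fun j _ => ?_
  rw [inner_sum]
  calc ∑ k ∈ J, inner ℝ (V j) (V k) ≤ ∑ k ∈ J, c (j - k) :=
        Finset.sum_le_sum fun k _ => (le_abs_self _).trans (h j k)
    _ ≤ ∑' k, c (j - k) :=
        ((Equiv.subLeft j).summable_iff.mpr hc).sum_le_tsum J fun k _ => hc0 _
    _ = ∑' d, c d := (Equiv.subLeft j).tsum_eq c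

end Hilbert

section Probability

variable {Ω : Type*} [MeasurableSpace Ω] {P : Measure Ω} {E F G : Type*}
  [NormedAddCommGroup E] [InnerProductSpace ℝ E] [NormedAddCommGroup F] [InnerProductSpace ℝ F]
  [NormedAddCommGroup G] [InnerProductSpace ℝ G]

lemma lpBound_sum_of_inner_le {V : ℤ → Ω → E} {c : ℤ → ℝ} (hc : Summable c)
    (hV : ∀ j, MemLp (V j) 2 P) (h : ∀ j k, |∫ ω, inner ℝ (V j ω) (V k ω) ∂P| ≤ c (j - k))
    (J : Finset ℤ) : LpBound P 2 (fun ω => ∑ j ∈ J, V j ω) (√(J.card * ∑' d, c d)) := by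
  have key := norm_sum_sq_le_of_inner_le (V := fun j => (hV j).toLp) hc (fun j k => ?_) J
  · have e : ∑ j ∈ J, (hV j).toLp = (memLp_finsetSum J fun j _ => hV j).toLp := by
      refine Lp.ext ((Lp.coeFn_finsetSum _ _).trans ?_)
      refine EventuallyEq.trans ?_ (MemLp.coeFn_toLp _).symm
      filter_upwards [ae_all_iff.2 fun j => (hV j).coeFn_toLp] with ω hω
      simp [hω]
    rw [e, Lp.norm_toLp] at key
    have hm := memLp_finsetSum J (f := V) fun j _ => hV j
    refine ⟨hm.1, ?_⟩
    rw [← ENNReal.ofReal_toReal hm.2.ne]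
    exact ENNReal.ofReal_le_ofReal (Real.le_sqrt_of_sq_le key)
  · rw [L2.inner_def]
    refine le_trans (le_of_eq ?_) (h j k)
    congr 1
    refine integral_congr_ae ?_
    filter_upwards [(hV j).coeFn_toLp, (hV k).coeFn_toLp] with ω h1 h2
    rw [h1, h2]

variable [MeasurableSpace E] [BorelSpace E] [SecondCountableTopology E]
  [MeasurableSpace F] [BorelSpace F] [SecondCountableTopology F] [CompleteSpace F]

/-- The joint law is a product, so `B` can be integrated out first. Nothing beyond measurability is
asked of `A`: if the product is not integrable, or `G` is not complete, the integral is zero by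
convention. -/
lemma integral_bilin_eq_zero_of_indepFun [IsProbabilityMeasure P] {A : Ω → E} {B : Ω → F}
    (β : E →L[ℝ] F →L[ℝ] G) (hA : AEMeasurable A P) (hB : Integrable B P) (hAB : IndepFun A B P)
    (h0 : ∫ ω, B ω ∂P = 0) : ∫ ω, β (A ω) (B ω) ∂P = 0 := by
  by_cases hG : CompleteSpace G
  swap
  · simp [integral, hG]
  have hlaw := (indepFun_iff_map_prod_eq_prod_map_map hA hB.aemeasurable).1 hAB
  have hcont : Continuous fun z : E × F => β z.1 z.2 := by fun_prop
  have hpair : AEMeasurable (fun ω => (A ω, B ω)) P := hA.prodMk hB.aemeasurable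
  have h1 : ∫ ω, β (A ω) (B ω) ∂P
      = ∫ z, β z.1 z.2 ∂((Measure.map A P).prod (Measure.map B P)) := by
    rw [← hlaw, integral_map hpair hcont.aestronglyMeasurable]
  rw [h1]
  have : IsProbabilityMeasure (Measure.map A P) := Measure.isProbabilityMeasure_map hA
  have : IsProbabilityMeasure (Measure.map B P) := Measure.isProbabilityMeasure_map hB.aemeasurable
  by_cases hint : Integrable (fun z : E × F => β z.1 z.2)
      ((Measure.map A P).prod (Measure.map B P))
  · have hid : Integrable (fun y : F => y) (Measure.map B P) :=
      (integrable_map_measure measurable_id.aestronglyMeasurable hB.aemeasurable).2 hB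
    have hid0 : ∫ y, y ∂(Measure.map B P) = 0 :=
      (integral_map (f := fun y : F => y) hB.aemeasurable
        measurable_id.aestronglyMeasurable).trans h0
    rw [integral_prod _ hint]
    have : ∀ x, ∫ y, β x y ∂(Measure.map B P) = 0 := fun x => by
      rw [(β x).integral_comp_comm hid, hid0, map_zero]
    simp [this]
  · exact integral_undef hint

/-- Independence factorizes the second moment, so the product stays in L², where Hölder alone would
only give L¹. This is what replaces fourth moments later on. -/
lemma LpBound.bilin_indep {A : Ω → E} {B : Ω → F} {s t : ℝ} (hA : LpBound P 2 A s)
    (hB : LpBound P 2 B t) (β : E →L[ℝ] F →L[ℝ] G) (hβ : ∀ x y, ‖β x y‖ ≤ ‖x‖ * ‖y‖)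
    (hAB : IndepFun A B P) (hs : 0 ≤ s) : LpBound P 2 (fun ω => β (A ω) (B ω)) (s * t) := by
  refine ⟨β.aestronglyMeasurable_comp₂ hA.aesm hB.aesm, ?_⟩
  rw [ENNReal.ofReal_mul hs]
  refine le_trans ?_ (mul_le_mul' hA.le hB.le)
  simp only [eLpNorm_eq_lintegral_rpow_enorm_toReal two_ne_zero ENNReal.ofNat_ne_top]
  rw [← ENNReal.mul_rpow_of_nonneg _ _ (by norm_num),
    ← lintegral_mul_eq_lintegral_mul_lintegral_of_indepFun''
      (hA.aesm.enorm.pow_const _) (hB.aesm.enorm.pow_const _)]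
  · gcongr with ω
    rw [← ENNReal.mul_rpow_of_nonneg _ _ (by norm_num)]
    gcongr
    rw [← ofReal_norm, ← ofReal_norm, ← ofReal_norm,
      ← ENNReal.ofReal_mul (norm_nonneg _)]
    exact ENNReal.ofReal_le_ofReal (hβ _ _)
  · exact hAB.comp (φ := fun x : E => ‖x‖ₑ ^ (2 : ℝ≥0∞).toReal)
      (ψ := fun x : F => ‖x‖ₑ ^ (2 : ℝ≥0∞).toReal) (by fun_prop) (by fun_prop)

end Probability

/-! ### σ-algebras generated by blocks of innovations. -/

section Window

variable {Ω S : Type*} [mΩ : MeasurableSpace Ω] [mS : MeasurableSpace S] {P : Measure Ω}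
  {ε : ℤ → Ω → S} {J J' : Set ℤ}

/-- The σ-algebra generated by the innovations with index in `J`. -/
@[reducible] def window (ε : ℤ → Ω → S) (J : Set ℤ) : MeasurableSpace Ω :=
  ⨆ i ∈ J, MeasurableSpace.comap (ε i) mS

lemma window_mono (h : J ⊆ J') : window ε J ≤ window ε J' := biSup_mono h

lemma window_le (hε : ∀ i, Measurable (ε i)) (J : Set ℤ) : window ε J ≤ mΩ :=
  iSup₂_le fun i _ => (hε i).comap_le

lemma measurable_window {i : ℤ} (hi : i ∈ J) : Measurable[window ε J] (ε i) :=
  Measurable.of_comap_le (le_biSup (fun i => MeasurableSpace.comap (ε i) mS) hi)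

variable {E F : Type*} [NormedAddCommGroup E] [MeasurableSpace E] [BorelSpace E]
  [NormedAddCommGroup F] [MeasurableSpace F] [BorelSpace F]

lemma indepFun_of_window (hε : ∀ i, Measurable (ε i)) (hi : iIndepFun ε P) (h : Disjoint J J')
    {A : Ω → E} {B : Ω → F} (hA : StronglyMeasurable[window ε J] A)
    (hB : StronglyMeasurable[window ε J'] B) : IndepFun A B P := by
  rw [IndepFun_iff_Indep]
  refine indep_of_indep_of_le_left (indep_of_indep_of_le_right ?_ hB.measurable.comap_le)
    hA.measurable.comap_le
  exact indep_iSup_of_disjoint (fun i => (hε i).comap_le) hi.iIndep h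

end Window

/-! ### Sums of vectors that are orthogonal at large distance. -/

section Orthogonal

variable {Ω : Type*} [MeasurableSpace Ω] {P : Measure Ω}
  {E : Type*} [NormedAddCommGroup E] [InnerProductSpace ℝ E]

lemma LpBound.abs_integral_inner_le {A B : Ω → E} {s t : ℝ} (hA : LpBound P 2 A s)
    (hB : LpBound P 2 B t) (hs : 0 ≤ s) (ht : 0 ≤ t) :
    |∫ ω, inner ℝ (A ω) (B ω) ∂P| ≤ s * t :=
  (hA.bilin hB (r := 1) (innerSL ℝ) (fun x y => norm_inner_le_norm x y) hs).norm_integral_le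
    (mul_nonneg hs ht)

/-- Only the `2 * N + 1` lags in `[-N, N]` can correlate, and there Cauchy–Schwarz bounds the
covariance by `v ^ 2`. -/
lemma lpBound_sum_of_orthogonal {V : ℤ → Ω → E} {v : ℝ} {N : ℕ} (hV : ∀ j, LpBound P 2 (V j) v)
    (hv : 0 ≤ v) (h : ∀ j k : ℤ, N < j - k → ∫ ω, inner ℝ (V j ω) (V k ω) ∂P = 0) (J : Finset ℤ) :
    LpBound P 2 (fun ω => ∑ j ∈ J, V j ω) (√(J.card * (2 * N + 1)) * v) := by
  have hsupp : ∀ d ∉ Finset.Icc (-N : ℤ) N, (if |d| ≤ N then v ^ 2 else 0) = 0 := by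
    intro d hd
    rw [if_neg]
    rwa [abs_le, ← Finset.mem_Icc]
  have hsum : ∑' d : ℤ, (if |d| ≤ N then v ^ 2 else 0) = (2 * N + 1) * v ^ 2 := by
    rw [tsum_eq_sum hsupp, Finset.sum_congr rfl (g := fun _ => v ^ 2)]
    · rw [Finset.sum_const, Int.card_Icc, nsmul_eq_mul]
      congr 1
      rw [show (N + 1 - -N : ℤ) = ((2 * N + 1 : ℕ) : ℤ) by push_cast; ring, Int.toNat_natCast]
      push_cast
      ring
    · intro d hd
      rw [if_pos]
      rwa [abs_le, ← Finset.mem_Icc]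
  have key := lpBound_sum_of_inner_le (P := P) (V := V)
    (c := fun d => if |d| ≤ N then v ^ 2 else 0)
    (summable_of_ne_finset_zero hsupp) (fun j => (hV j).memLp) (fun j k => ?_) J
  · rw [hsum, ← mul_assoc, Real.sqrt_mul (by positivity), Real.sqrt_sq hv] at key
    exact key
  · split_ifs with hd
    · exact ((hV j).abs_integral_inner_le (hV k) hv hv).trans (by rw [sq])
    · rcases le_total k j with hjk | hjk
      · rw [abs_of_nonneg (by lia)] at hd
        rw [h j k (by lia), abs_zero]
      · rw [abs_of_nonpos (by lia)] at hd
        rw [integral_congr_ae (ae_of_all _ fun ω => real_inner_comm (V k ω) (V j ω)), h k j (by lia), abs_zero]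

end Orthogonal

/-! ### Quadratic forms with banded Toeplitz weights. -/

section QuadForm

variable {E F : Type*} [NormedAddCommGroup E] [NormedSpace ℝ E] [NormedAddCommGroup F]
  [NormedSpace ℝ F]

/-- The quadratic form `∑_{j,k ∈ J} w (k - j) a_j ⊗ b_k`. -/
noncomputable def quadForm (τ : E →L[ℝ] E →L[ℝ] F) (J : Finset ℤ) (w : ℤ → ℝ) (a b : ℤ → E) : F :=
  ∑ j ∈ J, ∑ k ∈ J, w (k - j) • τ (a j) (b k)

/-- The part of the quadratic form with `k - j > 2n`. -/
noncomputable def upperForm (τ : E →L[ℝ] E →L[ℝ] F) (J : Finset ℤ) (w : ℤ → ℝ) (n : ℕ) (a b : ℤ → E) : F :=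
  ∑ k ∈ J, τ (∑ j ∈ J.filter (fun j => j + 2 * n < k), w (k - j) • a j) (b k)

/-- The weights restricted to lags in `[-2n, 2n]`. -/
noncomputable def nearWeight (w : ℤ → ℝ) (n : ℕ) (d : ℤ) : ℝ := if |d| ≤ 2 * n then w d else 0

/-- Lag weights bounded by `B` and vanishing beyond the lag `L`. -/
structure IsBand (w : ℤ → ℝ) (B : ℝ) (L : ℕ) : Prop where
  nonneg : 0 ≤ B
  bound : ∀ d, |w d| ≤ B
  supp : ∀ d : ℤ, L < |d| → w d = 0

variable {w : ℤ → ℝ} {B : ℝ} {L : ℕ}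

lemma IsBand.neg (hw : IsBand w B L) : IsBand (fun d => w (-d)) B L :=
  ⟨hw.nonneg, fun _ => hw.bound _, fun d hd => hw.supp _ (by rwa [abs_neg])⟩

lemma IsBand.near (hw : IsBand w B L) (n : ℕ) : IsBand (nearWeight w n) B (2 * n) := by
  refine ⟨hw.nonneg, fun d => ?_, fun d hd => ?_⟩
  · unfold nearWeight
    split_ifs
    · exact hw.bound d
    · simpa using hw.nonneg
  · exact if_neg (by push_cast at hd; lia)

lemma IsBand.sum_le (hw : IsBand w B L) (J : Finset ℤ) (j : ℤ) :
    ∑ k ∈ J, |w (k - j)| ≤ (2 * L + 1) * B := by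
  calc ∑ k ∈ J, |w (k - j)| ≤ ∑ k ∈ J, if k ∈ Finset.Icc (j - L) (j + L) then B else 0 := by
        refine Finset.sum_le_sum fun k _ => ?_
        split_ifs with hk
        · exact hw.bound _
        · rw [hw.supp, abs_zero]
          rw [Finset.mem_Icc] at hk
          by_contra hlt
          rw [not_lt, abs_le] at hlt
          lia
    _ = ((J.filter (· ∈ Finset.Icc (j - (L : ℤ)) (j + L))).card : ℝ) * B := by
        rw [← Finset.sum_filter, Finset.sum_const, nsmul_eq_mul]
    _ ≤ ((Finset.Icc (j - (L : ℤ)) (j + L)).card : ℝ) * B := by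
        gcongr
        · exact hw.nonneg
        · exact fun k hk => (Finset.mem_filter.1 hk).2
    _ = (2 * L + 1) * B := by
        rw [Int.card_Icc, show (j + L + 1 - (j - L) : ℤ) = ((2 * L + 1 : ℕ) : ℤ) by
          push_cast; ring, Int.toNat_natCast]
        push_cast
        ring

lemma IsBand.sum_le' (hw : IsBand w B L) (J : Finset ℤ) (k : ℤ) :
    ∑ j ∈ J, |w (k - j)| ≤ (2 * L + 1) * B := by
  simpa using hw.neg.sum_le J k

/-- The pairs with `j - k > 2n` become an upper part after swapping the two sequences, which flips
`τ` and reflects the weights. One estimate then serves both far parts. -/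
lemma quadForm_eq_near_add (τ : E →L[ℝ] E →L[ℝ] F) (J : Finset ℤ) (w : ℤ → ℝ) (n : ℕ)
    (a b : ℤ → E) : quadForm τ J w a b = quadForm τ J (nearWeight w n) a b +
      (upperForm τ J w n a b + upperForm τ.flip J (fun d => w (-d)) n b a) := by
  have h1 : upperForm τ J w n a b
      = ∑ j ∈ J, ∑ k ∈ J, if j + 2 * n < k then w (k - j) • τ (a j) (b k) else 0 := by
    rw [Finset.sum_comm]
    refine Finset.sum_congr rfl fun k _ => ?_
    rw [map_sum, sum_apply, Finset.sum_filter]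
    simp
  have h2 : upperForm τ.flip J (fun d => w (-d)) n b a
      = ∑ j ∈ J, ∑ k ∈ J, if k + 2 * n < j then w (k - j) • τ (a j) (b k) else 0 := by
    refine Finset.sum_congr rfl fun k _ => ?_
    rw [map_sum, sum_apply, Finset.sum_filter]
    simp
  rw [h1, h2]
  simp only [quadForm, ← Finset.sum_add_distrib]
  refine Finset.sum_congr rfl fun j _ => Finset.sum_congr rfl fun k _ => ?_
  unfold nearWeight
  rcases lt_or_ge (j + 2 * n) k with h | h
  · rw [if_neg (by rw [abs_le]; lia), if_pos h, if_neg (by lia)]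
    simp
  · rcases lt_or_ge (k + 2 * n) j with h' | h'
    · rw [if_neg (by rw [abs_le]; lia), if_neg (by lia), if_pos h']
      simp
    · rw [if_pos (by rw [abs_le]; lia), if_neg (by lia), if_neg (by lia)]
      simp

lemma quadForm_sub_left (τ : E →L[ℝ] E →L[ℝ] F) (J : Finset ℤ) (w : ℤ → ℝ) (a a' b : ℤ → E) :
    quadForm τ J w (fun j => a j - a' j) b = quadForm τ J w a b - quadForm τ J w a' b := by
  simp [quadForm, smul_sub, Finset.sum_sub_distrib]

lemma quadForm_sub_right (τ : E →L[ℝ] E →L[ℝ] F) (J : Finset ℤ) (w : ℤ → ℝ) (a b b' : ℤ → E) :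
    quadForm τ J w a (fun j => b j - b' j) = quadForm τ J w a b - quadForm τ J w a b' := by
  simp [quadForm, smul_sub, Finset.sum_sub_distrib]

/-- Schur test: split each weight as √|w| · √|w|, apply Cauchy–Schwarz over pairs, and bound row and
column sums of the weights by the size of the band. -/
lemma IsBand.norm_quadForm_le (hw : IsBand w B L) (τ : E →L[ℝ] E →L[ℝ] F)
    (hτ : ∀ x y, ‖τ x y‖ ≤ ‖x‖ * ‖y‖) (J : Finset ℤ) (a b : ℤ → E) :
    ‖quadForm τ J w a b‖ ≤
      (2 * L + 1) * B * (√(∑ j ∈ J, ‖a j‖ ^ 2) * √(∑ j ∈ J, ‖b j‖ ^ 2)) := by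
  have hc : 0 ≤ (2 * L + 1) * B := mul_nonneg (by positivity) hw.nonneg
  have h1 : ‖quadForm τ J w a b‖ ≤
      ∑ z ∈ J ×ˢ J, (√|w (z.2 - z.1)| * ‖a z.1‖) * (√|w (z.2 - z.1)| * ‖b z.2‖) := by
    rw [quadForm, ← Finset.sum_product']
    refine norm_sum_le_of_le _ fun z _ => ?_
    rw [norm_smul, Real.norm_eq_abs, mul_mul_mul_comm, Real.mul_self_sqrt (abs_nonneg _)]
    gcongr
    exact hτ _ _
  refine h1.trans ((Real.sum_mul_le_sqrt_mul_sqrt _ _ _).trans ?_)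
  have h2 : ∑ z ∈ J ×ˢ J, (√|w (z.2 - z.1)| * ‖a z.1‖) ^ 2
      ≤ (2 * L + 1) * B * ∑ j ∈ J, ‖a j‖ ^ 2 := by
    rw [Finset.sum_product, Finset.mul_sum]
    refine Finset.sum_le_sum fun j _ => ?_
    simp_rw [mul_pow, Real.sq_sqrt (abs_nonneg _)]
    rw [← Finset.sum_mul]
    gcongr
    exact hw.sum_le J j
  have h3 : ∑ z ∈ J ×ˢ J, (√|w (z.2 - z.1)| * ‖b z.2‖) ^ 2
      ≤ (2 * L + 1) * B * ∑ j ∈ J, ‖b j‖ ^ 2 := by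
    rw [Finset.sum_product_right, Finset.mul_sum]
    refine Finset.sum_le_sum fun j _ => ?_
    simp_rw [mul_pow, Real.sq_sqrt (abs_nonneg _)]
    rw [← Finset.sum_mul]
    gcongr
    exact hw.sum_le' J j
  calc _ ≤ √((2 * L + 1) * B * ∑ j ∈ J, ‖a j‖ ^ 2) * √((2 * L + 1) * B * ∑ j ∈ J, ‖b j‖ ^ 2) := by
        gcongr
    _ = _ := by
        rw [Real.sqrt_mul hc, Real.sqrt_mul hc, mul_mul_mul_comm, Real.mul_self_sqrt hc]

variable {Ω : Type*} [MeasurableSpace Ω] {P : Measure Ω}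

/-- The triangle inequality with Hölder on each pair. The factor `2 * L + 1` is too large for the
final estimate, so this serves only for narrow bands, for integrability, and for errors that vanish
while `L` is fixed. -/
lemma IsBand.lpBound_quadForm (hw : IsBand w B L) (τ : E →L[ℝ] E →L[ℝ] F)
    (hτ : ∀ x y, ‖τ x y‖ ≤ ‖x‖ * ‖y‖) (J : Finset ℤ) {a b : ℤ → Ω → E} {s t : ℝ}
    (ha : ∀ j, LpBound P 2 (a j) s) (hb : ∀ j, LpBound P 2 (b j) t) (hs : 0 ≤ s) (ht : 0 ≤ t) :
    LpBound P 1 (fun ω => quadForm τ J w (fun j => a j ω) (fun j => b j ω))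
      (J.card * ((2 * L + 1) * B * (s * t))) := by
  have h := LpBound.sum (P := P) (J := J)
    (f := fun j ω => ∑ k ∈ J, w (k - j) • τ (a j ω) (b k ω))
    (s := fun j => ∑ k ∈ J, |w (k - j)| * (s * t)) (q := 1)
    (fun j _ => LpBound.sum (fun k _ => ((ha j).bilin (hb k) τ hτ hs).const_smul _) le_rfl
      fun k _ => by positivity) le_rfl fun j _ => by positivity
  refine h.mono ?_
  rw [← nsmul_eq_mul]
  refine Finset.sum_le_card_nsmul _ _ _ fun j _ => ?_
  rw [← Finset.sum_mul]
  gcongr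
  exact hw.sum_le J j

end QuadForm

/-! ### Sequences of finite range and the far part of their quadratic forms. -/

section FiniteRange

variable {Ω S : Type*} [mΩ : MeasurableSpace Ω] [MeasurableSpace S] {P : Measure Ω}
  {ε : ℤ → Ω → S}
  {E F : Type*} [NormedAddCommGroup E] [InnerProductSpace ℝ E] [NormedAddCommGroup F]
  [InnerProductSpace ℝ F]

/-- A centered sequence with `L²` norms at most `s` such that `a_j` is a function of the
innovations with index in `[j - n, j + n]`. -/
structure FiniteRange (P : Measure Ω) (ε : ℤ → Ω → S) (n : ℕ) (a : ℤ → Ω → E) (s : ℝ) :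
    Prop where
  meas : ∀ j, StronglyMeasurable[window ε (Set.Icc (j - n) (j + n))] (a j)
  bound : ∀ j, LpBound P 2 (a j) s
  mean : ∀ j, ∫ ω, a j ω ∂P = 0

variable {n n' : ℕ} {a b : ℤ → Ω → E} {s t B : ℝ} {w : ℤ → ℝ} {L : ℕ}

lemma FiniteRange.const_smul (ha : FiniteRange P ε n a s) (hs : 0 ≤ s) {c : ℤ → ℝ}
    (hc : ∀ j, |c j| ≤ B) : FiniteRange P ε n (fun j ω => c j • a j ω) (B * s) where
  meas j := (ha.meas j).const_smul (c j)
  bound j := ((ha.bound j).const_smul (c j)).mono (by gcongr; exact hc j)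
  mean j := by rw [integral_smul, ha.mean, smul_zero]

lemma FiniteRange.mono (ha : FiniteRange P ε n a s) (h : n ≤ n') : FiniteRange P ε n' a s where
  meas j := (ha.meas j).mono (window_mono (Set.Icc_subset_Icc (by lia) (by lia)))
  bound := ha.bound
  mean := ha.mean

lemma FiniteRange.sub [IsFiniteMeasure P] (ha : FiniteRange P ε n a s)
    (hb : FiniteRange P ε n b t) {r : ℝ} (h : ∀ j, LpBound P 2 (fun ω => a j ω - b j ω) r) :
    FiniteRange P ε n (fun j ω => a j ω - b j ω) r where
  meas j := (ha.meas j).sub (hb.meas j)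
  bound := h
  mean j := by
    rw [integral_sub ((ha.bound j).integrable one_le_two) ((hb.bound j).integrable one_le_two),
      ha.mean, hb.mean, sub_zero]

variable [IsProbabilityMeasure P] [CompleteSpace E] [SecondCountableTopology E]
  [MeasurableSpace E] [BorelSpace E]
  (hε : ∀ i, Measurable (ε i)) (hi : iIndepFun ε P)
include hε hi

lemma FiniteRange.lpBound_sum (ha : FiniteRange P ε n a s) (hs : 0 ≤ s) (J : Finset ℤ) :
    LpBound P 2 (fun ω => ∑ j ∈ J, a j ω) (√(J.card * (4 * n + 1)) * s) := by
  have h := lpBound_sum_of_orthogonal (N := 2 * n) ha.bound hs (fun j k hjk => ?_) J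
  · convert h using 4
    push_cast
    ring
  · push_cast at hjk
    rw [integral_congr_ae (ae_of_all _ fun ω => real_inner_comm (a k ω) (a j ω))]
    refine integral_bilin_eq_zero_of_indepFun (innerSL ℝ) (ha.bound k).aesm.aemeasurable
      ((ha.bound j).integrable one_le_two) (indepFun_of_window hε hi ?_ (ha.meas k) (ha.meas j))
      (ha.mean j)
    exact Set.disjoint_left.2 fun i h1 h2 => by
      rw [Set.mem_Icc] at h1 h2
      lia

/-- The inner sum attached to `k` involves only innovations before `k - n`, so it is independent of
`b k` and the product has an L² norm bounded by the product of the norms. Two such products whose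
indices differ by more than `2n` are orthogonal, because the later `b` is centred and independent of
everything else. Both the inner and the outer sum thus grow only like square roots. -/
lemma FiniteRange.lpBound_upperForm (ha : FiniteRange P ε n a s) (hb : FiniteRange P ε n b t)
    (hs : 0 ≤ s) (ht : 0 ≤ t) (hw : IsBand w B L) (τ : E →L[ℝ] E →L[ℝ] F)
    (hτ : ∀ x y x' y', inner ℝ (τ x y) (τ x' y') = inner ℝ x x' * inner ℝ y y') (J : Finset ℤ) :
    LpBound P 2 (fun ω => upperForm τ J w n (fun j => a j ω) (fun j => b j ω))
      ((4 * n + 1) * B * √(J.card * (2 * L + 1)) * (s * t)) := by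
  have hB := hw.nonneg
  have hτn : ∀ x y, ‖τ x y‖ ≤ ‖x‖ * ‖y‖ := fun x y => by
    refine le_of_eq ((sq_eq_sq₀ (by positivity) (by positivity)).1 ?_)
    rw [← real_inner_self_eq_norm_sq, hτ, real_inner_self_eq_norm_sq, real_inner_self_eq_norm_sq,
      mul_pow]
  set u : ℤ → Ω → E := fun k ω => ∑ j ∈ J.filter (fun j => j + 2 * n < k), w (k - j) • a j ω
  have hu : ∀ k, LpBound P 2 (u k) (√((2 * L + 1) * (4 * n + 1)) * (B * s)) := by
    intro k
    -- The weights vanish beyond lag `L`, so at most `2 * L + 1` indices contribute to the inner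
    -- sum.
    have e : u k = fun ω => ∑ j ∈ (J.filter (fun j => j + 2 * n < k)).filter
        (· ∈ Finset.Icc (k - (L : ℤ)) (k + L)), w (k - j) • a j ω := by
      ext ω
      refine (Finset.sum_filter_of_ne fun j _ hj => ?_).symm
      by_contra hlt
      refine hj ?_
      rw [hw.supp, zero_smul]
      by_contra h
      rw [not_lt, abs_le] at h
      exact hlt (Finset.mem_Icc.2 (by lia))
    rw [e]
    refine ((ha.const_smul hs (c := fun j => w (k - j)) fun j => hw.bound _).lpBound_sum hε hi
      (by positivity) _).mono ?_
    gcongr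
    calc ((Finset.filter (· ∈ Finset.Icc (k - (L : ℤ)) (k + L)) _).card : ℝ)
        ≤ ((Finset.Icc (k - (L : ℤ)) (k + L)).card : ℝ) := by
          gcongr
          exact fun k hk => (Finset.mem_filter.1 hk).2
      _ = 2 * L + 1 := by
          rw [Int.card_Icc, show (k + L + 1 - (k - L) : ℤ) = ((2 * L + 1 : ℕ) : ℤ) by
            push_cast; ring, Int.toNat_natCast]
          push_cast
          ring
  have hum : ∀ k, StronglyMeasurable[window ε (Set.Iio (k - n))] (u k) := fun k =>
    Finset.stronglyMeasurable_fun_sum _ fun j hj => ((ha.meas j).mono (window_mono fun i hij => by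
      have := (Finset.mem_filter.1 hj).2
      rw [Set.mem_Icc] at hij
      rw [Set.mem_Iio]
      lia)).const_smul _
  have hub : ∀ k, LpBound P 2 (fun ω => τ (u k ω) (b k ω))
      (√((2 * L + 1) * (4 * n + 1)) * (B * s) * t) := fun k =>
    (hu k).bilin_indep (hb.bound k) τ hτn (indepFun_of_window hε hi
      (Set.disjoint_left.2 fun i h1 h2 => by
        rw [Set.mem_Iio] at h1
        rw [Set.mem_Icc] at h2
        lia) (hum k) (hb.meas k)) (by positivity)
  have h := lpBound_sum_of_orthogonal (N := 2 * n) hub (by positivity) (fun j k hjk => ?_) J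
  · refine h.mono (le_of_eq ?_)
    have h4 : (0 : ℝ) ≤ 4 * n + 1 := by positivity
    have e4 : √(4 * n + 1) * √(4 * n + 1) = (4 * n + 1 : ℝ) := Real.mul_self_sqrt h4
    rw [show (2 * ((2 * n : ℕ) : ℝ) + 1) = 4 * n + 1 by push_cast; ring,
      Real.sqrt_mul (by positivity), Real.sqrt_mul (by positivity), Real.sqrt_mul (by positivity)]
    linear_combination √(J.card : ℝ) * √(2 * L + 1 : ℝ) * B * s * t * e4
  · push_cast at hjk
    -- The factorized inner product is rewritten as a pairing of `b j` with a single vector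
    -- depending only on innovations before `j - n`.
    have e : ∀ ω, inner ℝ (τ (u j ω) (b j ω)) (τ (u k ω) (b k ω))
        = innerSL ℝ ((inner ℝ (u j ω) (u k ω) : ℝ) • b k ω) (b j ω) := fun ω => by
      rw [hτ, innerSL_apply_apply, inner_smul_left, real_inner_comm (b k ω)]
      simp
    simp_rw [e]
    have hm : StronglyMeasurable[window ε (Set.Iio (j - n))]
        (fun ω => (inner ℝ (u j ω) (u k ω) : ℝ) • b k ω) := by
      refine StronglyMeasurable.smul (StronglyMeasurable.inner (hum j) ((hum k).mono
        (window_mono fun i hi => ?_))) ((hb.meas k).mono (window_mono fun i hi => ?_))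
      · rw [Set.mem_Iio] at hi ⊢
        lia
      · rw [Set.mem_Icc] at hi
        rw [Set.mem_Iio]
        lia
    refine integral_bilin_eq_zero_of_indepFun (innerSL ℝ)
      (hm.mono (window_le hε _)).measurable.aemeasurable
      ((hb.bound j).integrable one_le_two) (indepFun_of_window hε hi ?_ hm (hb.meas j))
      (hb.mean j)
    exact Set.disjoint_left.2 fun i h1 h2 => by
      rw [Set.mem_Iio] at h1
      rw [Set.mem_Icc] at h2
      lia

end FiniteRange

/-! ### Reindexing double sums by the lag. -/

section Lags

/-- The indices `j` such that `j` and `j + ℓ` both lie in `{1, …, T}`. -/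
noncomputable def lagSet (T : ℕ) (ℓ : ℤ) : Finset ℤ :=
  (Finset.Icc (1 : ℤ) T).filter fun j => j + ℓ ∈ Finset.Icc (1 : ℤ) T

lemma lagSet_eq_of_nonneg (T : ℕ) {ℓ : ℤ} (h : 0 ≤ ℓ) : lagSet T ℓ = Finset.Icc 1 (T - ℓ) := by
  ext j
  simp only [lagSet, Finset.mem_filter, Finset.mem_Icc]
  lia

lemma lagSet_eq_of_neg (T : ℕ) {ℓ : ℤ} (h : ℓ < 0) : lagSet T ℓ = Finset.Icc (1 - ℓ) T := by
  ext j
  simp only [lagSet, Finset.mem_filter, Finset.mem_Icc]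
  lia

lemma lagSet_eq_empty {T : ℕ} {ℓ : ℤ} (h : ℓ ∉ Finset.Ioo (-T : ℤ) T) : lagSet T ℓ = ∅ := by
  rw [Finset.mem_Ioo] at h
  ext j
  simp only [lagSet, Finset.mem_filter, Finset.mem_Icc, Finset.notMem_empty, iff_false]
  lia

lemma card_lagSet_le (T : ℕ) (ℓ : ℤ) : (lagSet T ℓ).card ≤ T := by
  refine (Finset.card_filter_le _ _).trans ?_
  simp

lemma le_card_lagSet (T : ℕ) (ℓ : ℤ) : (T : ℤ) - |ℓ| ≤ (lagSet T ℓ).card := by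
  rcases le_or_gt 0 ℓ with h | h
  · rw [lagSet_eq_of_nonneg T h, Int.card_Icc, abs_of_nonneg h]
    lia
  · rw [lagSet_eq_of_neg T h, Int.card_Icc, abs_of_neg h]
    lia

lemma sum_sum_eq_sum_lagSet {M : Type*} [AddCommMonoid M] (T : ℕ) (f : ℤ → ℤ → M) :
    ∑ j ∈ Finset.Icc (1 : ℤ) T, ∑ k ∈ Finset.Icc (1 : ℤ) T, f j k
      = ∑ ℓ ∈ Finset.Ioo (-T : ℤ) T, ∑ j ∈ lagSet T ℓ, f j (j + ℓ) := by
  simp_rw [lagSet, Finset.sum_filter]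
  rw [Finset.sum_comm (s := Finset.Ioo (-T : ℤ) T)]
  refine Finset.sum_congr rfl fun j hj => ?_
  rw [← Finset.sum_filter]
  rw [Finset.mem_Icc] at hj
  refine Finset.sum_nbij' (fun k => k - j) (fun ℓ => j + ℓ) ?_ ?_ ?_ ?_ ?_
  · intro k hk
    simp only [Finset.mem_filter, Finset.mem_Icc, Finset.mem_Ioo] at hk ⊢
    lia
  · intro ℓ hℓ
    exact (Finset.mem_filter.1 hℓ).2
  · simp
  · simp
  · simp

end Lags

/-! ### Convergence of the expected quadratic form. -/

section Limit

variable {G : Type*} [NormedAddCommGroup G] [NormedSpace ℝ G] [CompleteSpace G]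

/-- Under the summability of the covariances, the normalized weighted sums converge to the long
run covariance. -/
lemma tendsto_weighted_sum {w : ℕ → ℤ → ℝ} {B : ℝ} (hB : ∀ᶠ T in atTop, ∀ d, |w T d| ≤ B)
    (hw : ∀ d, Tendsto (fun T => w T d) atTop (𝓝 1)) {Γ : ℤ → G} (hΓ : Summable fun d => ‖Γ d‖) :
    Tendsto (fun T : ℕ => (T : ℝ)⁻¹ • ∑ j ∈ Finset.Icc (1 : ℤ) T, ∑ k ∈ Finset.Icc (1 : ℤ) T,
      w T (k - j) • Γ (k - j)) atTop (𝓝 (∑' d, Γ d)) := by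
  have e : ∀ T : ℕ, (T : ℝ)⁻¹ • ∑ j ∈ Finset.Icc (1 : ℤ) T, ∑ k ∈ Finset.Icc (1 : ℤ) T,
      w T (k - j) • Γ (k - j) = ∑' d, (((lagSet T d).card : ℝ) / T * w T d) • Γ d := by
    intro T
    rw [sum_sum_eq_sum_lagSet, tsum_eq_sum (s := Finset.Ioo (-T : ℤ) T), Finset.smul_sum]
    · refine Finset.sum_congr rfl fun d _ => ?_
      simp only [add_sub_cancel_left, Finset.sum_const, ← Nat.cast_smul_eq_nsmul ℝ, smul_smul]
      congr 1
      ring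
    · intro d hd
      simp [lagSet_eq_empty hd]
  simp_rw [e]
  -- After grouping by lag, the coefficient of `Γ d` is the proportion of pairs at lag `d` times the
  -- weight. It tends to 1 and is eventually bounded by `B`.
  refine tendsto_tsum_of_dominated_convergence (bound := fun d => B * ‖Γ d‖) (hΓ.mul_left B)
    (fun d => ?_) ?_
  · have h1 : Tendsto (fun T : ℕ => ((lagSet T d).card : ℝ) / T) atTop (𝓝 1) := by
      have hl : Tendsto (fun T : ℕ => 1 - (|d| : ℤ) * (T : ℝ)⁻¹) atTop (𝓝 1) := by
        simpa using (tendsto_inv_atTop_nhds_zero_nat (𝕜 := ℝ)).const_mul ((|d| : ℤ) : ℝ)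
          |>.const_sub 1
      refine tendsto_of_tendsto_of_tendsto_of_le_of_le' hl tendsto_const_nhds ?_ ?_
      · filter_upwards [eventually_gt_atTop 0] with T hT
        have hT' : (0 : ℝ) < T := by exact_mod_cast hT
        rw [le_div_iff₀ hT', sub_mul, one_mul, mul_assoc, inv_mul_cancel₀ hT'.ne', mul_one]
        exact_mod_cast le_card_lagSet T d
      · refine Eventually.of_forall fun T => div_le_one_of_le₀ ?_ (by positivity)
        exact_mod_cast card_lagSet_le T d
    simpa using (h1.mul (hw d)).smul_const (Γ d)
  · filter_upwards [hB] with T hT d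
    rw [norm_smul]
    gcongr
    rw [norm_mul, Real.norm_of_nonneg (by positivity), Real.norm_eq_abs]
    have h1 : ((lagSet T d).card : ℝ) / T ≤ 1 :=
      div_le_one_of_le₀ (by exact_mod_cast card_lagSet_le T d) (by positivity)
    calc _ ≤ 1 * B := mul_le_mul h1 (hT d) (abs_nonneg _) zero_le_one
      _ = B := one_mul B

end Limit

/-! ### Covariance bounds for approximable sequences. -/

section Approximation

variable {Ω S : Type*} [mΩ : MeasurableSpace Ω] [MeasurableSpace S] {P : Measure Ω}
  {ε : ℤ → Ω → S}
  {E F : Type*} [NormedAddCommGroup E] [InnerProductSpace ℝ E] [NormedAddCommGroup F]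
  [InnerProductSpace ℝ F] [MeasurableSpace E]

/-- A causal sequence with `L²` norms at most `M`, which is approximated at rate
`C m⁻ᵞ` by centered sequences depending on `m` innovations only. -/
structure Approximable (P : Measure Ω) (ε : ℤ → Ω → S) (ζ : ℤ → Ω → E) (M C γ : ℝ) : Prop where
  M_nonneg : 0 ≤ M
  C_nonneg : 0 ≤ C
  one_lt : 1 < γ
  meas : ∀ j, StronglyMeasurable[window ε (Set.Iic j)] (ζ j)
  bound : ∀ j, LpBound P 2 (ζ j) M
  approx : ∀ m : ℕ, 1 ≤ m → ∃ a : ℤ → Ω → E,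
    (∀ j, StronglyMeasurable[window ε (Set.Ioc (j - m) j)] (a j)) ∧ (∀ j, ∫ ω, a j ω ∂P = 0) ∧
    (∀ j, IdentDistrib (a j) (a 0) P P) ∧
    ∀ j, LpBound P 2 (fun ω => ζ j ω - a j ω) (C * (m : ℝ) ^ (-γ))

/-- A summable bound for the covariances of an `Approximable` sequence. -/
noncomputable def covBound (M C γ : ℝ) (d : ℤ) : ℝ :=
  (if d = 0 then M ^ 2 else 0) + M * C * |(d : ℝ)| ^ (-γ)

lemma summable_covBound {γ : ℝ} (hγ : 1 < γ) (M C : ℝ) : Summable (covBound M C γ) :=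
  (summable_of_ne_finset_zero (s := {0}) fun d hd => if_neg (by simpa using hd)).add
    ((Real.summable_abs_int_rpow hγ).mul_left _)

lemma covBound_nonneg {M C : ℝ} (hM : 0 ≤ M) (hC : 0 ≤ C) (γ : ℝ) (d : ℤ) :
    0 ≤ covBound M C γ d := by
  unfold covBound
  positivity

variable [BorelSpace E] [IsProbabilityMeasure P] [CompleteSpace E] [SecondCountableTopology E]
  {ζ : ℤ → Ω → E} {M C γ : ℝ}
  (hε : ∀ i, Measurable (ε i)) (hi : iIndepFun ε P)
include hε hi

/-- With `m = k - j`, the approximant of `ζ k` uses only innovations after time `j`. It is therefore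
independent of `ζ j`, and only the approximation error contributes. -/
lemma Approximable.norm_integral_le_of_lt (hζ : Approximable P ε ζ M C γ) (β : E →L[ℝ] E →L[ℝ] F)
    (hβ : ∀ x y, ‖β x y‖ ≤ ‖x‖ * ‖y‖) {j k : ℤ} (hjk : j < k) :
    ‖∫ ω, β (ζ j ω) (ζ k ω) ∂P‖ ≤ covBound M C γ (k - j) := by
  obtain ⟨m, hm⟩ : ∃ m : ℕ, (m : ℤ) = k - j := ⟨(k - j).toNat, by lia⟩
  obtain ⟨a, ha, ha0, -, hζa⟩ := hζ.approx m (by lia)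
  have hM := hζ.M_nonneg
  have hC := hζ.C_nonneg
  have hla : LpBound P 2 (a k) (M + C * (m : ℝ) ^ (-γ)) :=
    ((hζ.bound k).sub (hζa k) one_le_two hM (by positivity)).congr (ae_of_all _ fun ω => by simp)
  have h0 : ∫ ω, β (ζ j ω) (a k ω) ∂P = 0 := by
    refine integral_bilin_eq_zero_of_indepFun β (hζ.bound j).aesm.aemeasurable
      (hla.integrable one_le_two) (indepFun_of_window hε hi ?_ (hζ.meas j) (ha k)) (ha0 k)
    exact Set.disjoint_left.2 fun i h1 h2 => by
      rw [Set.mem_Iic] at h1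
      rw [Set.mem_Ioc] at h2
      lia
  have i1 := ((hζ.bound j).bilin (hζa k) (r := 1) β hβ hM)
  have i2 := ((hζ.bound j).bilin hla (r := 1) β hβ hM)
  have e : ∫ ω, β (ζ j ω) (ζ k ω) ∂P = ∫ ω, β (ζ j ω) (ζ k ω - a k ω) ∂P := by
    rw [← add_zero (∫ ω, β (ζ j ω) (ζ k ω - a k ω) ∂P), ← h0,
      ← integral_add (i1.integrable le_rfl) (i2.integrable le_rfl)]
    simp
  rw [e]
  refine (i1.norm_integral_le (by positivity)).trans (le_of_eq ?_)
  rw [covBound, if_neg (by lia), ← hm]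
  simp [mul_assoc]

lemma Approximable.norm_integral_le (hζ : Approximable P ε ζ M C γ) (β : E →L[ℝ] E →L[ℝ] F)
    (hβ : ∀ x y, ‖β x y‖ ≤ ‖x‖ * ‖y‖) (j k : ℤ) :
    ‖∫ ω, β (ζ j ω) (ζ k ω) ∂P‖ ≤ covBound M C γ (k - j) := by
  have hM := hζ.M_nonneg
  have hC := hζ.C_nonneg
  rcases lt_trichotomy j k with h | rfl | h
  · exact hζ.norm_integral_le_of_lt hε hi β hβ h
  · refine (((hζ.bound j).bilin (hζ.bound j) (r := 1) β hβ hM).norm_integral_le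
      (by positivity)).trans ?_
    rw [covBound, sub_self, if_pos rfl, sq]
    exact le_add_of_nonneg_right (by positivity)
  · have h' := hζ.norm_integral_le_of_lt hε hi β.flip
      (fun x y => (hβ y x).trans_eq (mul_comm _ _)) h
    refine h'.trans (le_of_eq ?_)
    rw [covBound, covBound, if_neg (by lia), if_neg (by lia)]
    push_cast
    rw [abs_sub_comm]

lemma Approximable.lpBound_sum (hζ : Approximable P ε ζ M C γ) (J : Finset ℤ) :
    LpBound P 2 (fun ω => ∑ j ∈ J, ζ j ω) (√(J.card * ∑' d, covBound M C γ d)) :=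
  lpBound_sum_of_inner_le (summable_covBound hζ.one_lt M C) (fun j => (hζ.bound j).memLp)
    (fun j k => by
      simp_rw [fun ω => real_inner_comm (ζ k ω) (ζ j ω)]
      exact hζ.norm_integral_le hε hi (innerSL ℝ) (fun x y => norm_inner_le_norm x y) k j) J

end Approximation

/-! ### Finite range approximation of the quadratic form along dyadic scales. -/

section Dyadic

variable {Ω S : Type*} [mΩ : MeasurableSpace Ω] [MeasurableSpace S] {P : Measure Ω}
  {ε : ℤ → Ω → S}
  {E F : Type*} [NormedAddCommGroup E] [InnerProductSpace ℝ E] [NormedAddCommGroup F]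
  [InnerProductSpace ℝ F] [MeasurableSpace E]
  [BorelSpace E] [IsProbabilityMeasure P] [CompleteSpace E] [SecondCountableTopology E]
  {n : ℕ} {a b : ℤ → Ω → E} {s t B : ℝ} {w : ℤ → ℝ} {L : ℕ}
  (hε : ∀ i, Measurable (ε i)) (hi : iIndepFun ε P)

lemma norm_bilin_le {τ : E →L[ℝ] E →L[ℝ] F}
    (hτ : ∀ x y x' y', inner ℝ (τ x y) (τ x' y') = inner ℝ x x' * inner ℝ y y') (x y : E) :
    ‖τ x y‖ ≤ ‖x‖ * ‖y‖ := by
  refine le_of_eq ((sq_eq_sq₀ (by positivity) (by positivity)).1 ?_)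
  rw [← real_inner_self_eq_norm_sq, hτ, real_inner_self_eq_norm_sq, real_inner_self_eq_norm_sq,
    mul_pow]

lemma inner_flip {τ : E →L[ℝ] E →L[ℝ] F}
    (hτ : ∀ x y x' y', inner ℝ (τ x y) (τ x' y') = inner ℝ x x' * inner ℝ y y') (x y x' y' : E) :
    inner ℝ (τ.flip x y) (τ.flip x' y') = inner ℝ x x' * inner ℝ y y' := by
  simp [hτ, mul_comm]

include hε hi

/-- The near part and the two far parts contribute a factor `4 * n + 1` each. Because `2 * L + 1 ≤
J.card`, the square root in the far bound is at most `J.card`, and the band width disappears. -/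
lemma FiniteRange.lpBound_quadForm (ha : FiniteRange P ε n a s) (hb : FiniteRange P ε n b t)
    (hs : 0 ≤ s) (ht : 0 ≤ t) (hw : IsBand w B L) (τ : E →L[ℝ] E →L[ℝ] F)
    (hτ : ∀ x y x' y', inner ℝ (τ x y) (τ x' y') = inner ℝ x x' * inner ℝ y y') {J : Finset ℤ}
    (hL : 2 * L + 1 ≤ J.card) :
    LpBound P 1 (fun ω => quadForm τ J w (fun j => a j ω) (fun j => b j ω))
      (J.card * (3 * (4 * n + 1) * B * (s * t))) := by
  have hB := hw.nonneg
  have h1 := (hw.near n).lpBound_quadForm τ (norm_bilin_le hτ) J ha.bound hb.bound hs ht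
  have h2 := (ha.lpBound_upperForm hε hi hb hs ht hw τ hτ J).mono_exponent one_le_two
  have h3 := (hb.lpBound_upperForm hε hi ha ht hs hw.neg τ.flip (inner_flip hτ) J).mono_exponent
    one_le_two
  have h := h1.add (h2.add h3 le_rfl (by positivity) (by positivity)) le_rfl (by positivity)
    (by positivity)
  have hsq : √((J.card : ℝ) * (2 * L + 1)) ≤ J.card := by
    refine Real.sqrt_le_left (by positivity) |>.2 ?_
    rw [sq]
    gcongr
    exact_mod_cast hL
  refine (h.mono ?_).congr (ae_of_all _ fun ω => (quadForm_eq_near_add τ J w n _ _).symm)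
  calc _ ≤ (J.card : ℝ) * ((2 * (2 * n : ℕ) + 1) * B * (s * t)) +
        ((4 * n + 1) * B * J.card * (s * t) + (4 * n + 1) * B * J.card * (t * s)) := by gcongr
    _ = _ := by push_cast; ring

end Dyadic

lemma LpBound.of_tendsto {Ω E : Type*} [MeasurableSpace Ω] {P : Measure Ω}
    [NormedAddCommGroup E] {f : Ω → E} {q : ℝ≥0∞} {u : ℝ} {v : ℕ → ℝ} {r : ℕ}
    (h : ∀ R ≥ r, LpBound P q f (v R)) (hv : Tendsto v atTop (𝓝 u)) : LpBound P q f u :=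
  ⟨(h r le_rfl).aesm, ge_of_tendsto ((ENNReal.continuous_ofReal.tendsto u).comp hv)
    (eventually_atTop.2 ⟨r, fun R hR => (h R hR).le⟩)⟩

section Dyadic

variable {Ω S : Type*} [mΩ : MeasurableSpace Ω] [MeasurableSpace S] {P : Measure Ω}
  {ε : ℤ → Ω → S}
  {E F : Type*} [NormedAddCommGroup E] [InnerProductSpace ℝ E] [NormedAddCommGroup F]
  [InnerProductSpace ℝ F] [MeasurableSpace E]
  [BorelSpace E] [IsProbabilityMeasure P] [CompleteSpace E] [SecondCountableTopology E]
  {n : ℕ} {a b : ℤ → Ω → E} {s t B : ℝ} {w : ℤ → ℝ} {L : ℕ}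

/-- Bounded approximation of identically distributed finite range sequences. -/
lemma FiniteRange.exists_bounded (ha : FiniteRange P ε n a s)
    (hid : ∀ j, IdentDistrib (a j) (a 0) P P) {η : ℝ} (hη : 0 < η) :
    ∃ (a' : ℤ → Ω → E) (K : ℝ), 0 ≤ K ∧ FiniteRange P ε n a' K ∧ (∀ j ω, ‖a' j ω‖ ≤ K) ∧
      ∀ j, LpBound P 2 (fun ω => a j ω - a' j ω) η := by
  have ham : ∀ j, AEMeasurable (a j) P := fun j => (ha.bound j).aesm.aemeasurable
  have hmem : MemLp (fun x : E => x) 2 (Measure.map (a 0) P) :=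
    (memLp_map_measure_iff measurable_id.aestronglyMeasurable (ham 0)).2 (ha.bound 0).memLp
  -- A simple function close to the identity under the common law truncates every `a j` at once and
  -- preserves its window of innovations. Recentring doubles the error, hence `η / 2`.
  obtain ⟨φ, hφ, -⟩ := hmem.exists_simpleFunc_eLpNorm_sub_lt ENNReal.ofNat_ne_top
    (ε := ENNReal.ofReal (η / 2)) (by simpa using hη)
  obtain ⟨K, hK⟩ := φ.exists_forall_norm_le
  have hK0 : 0 ≤ K := (norm_nonneg _).trans (hK 0)
  have hφm : ∀ j, AEStronglyMeasurable (fun ω => φ (a j ω)) P := fun j =>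
    (φ.measurable.comp_aemeasurable (ham j)).aestronglyMeasurable
  have hφb : ∀ j, LpBound P 2 (fun ω => φ (a j ω)) K := fun j =>
    LpBound.of_norm_le (hφm j) fun ω => hK _
  have hd : ∀ j, LpBound P 2 (fun ω => a j ω - φ (a j ω)) (η / 2) := fun j => by
    refine ⟨(ha.bound j).aesm.sub (hφm j), ?_⟩
    rw [← (hid j).map_eq, eLpNorm_map_measure (by fun_prop) (ham j)] at hφ
    exact hφ.le
  have hba : ∀ j ω, ‖φ (a j ω) - ∫ x, φ (a j x) ∂P‖ ≤ 2 * K := fun j ω => by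
    rw [two_mul]
    exact (norm_sub_le _ _).trans (add_le_add (hK _)
      (((hφb j).mono_exponent one_le_two).norm_integral_le hK0))
  have hm : ∀ j, StronglyMeasurable[window ε (Set.Icc (j - n) (j + n))]
      (fun ω => φ (a j ω) - ∫ x, φ (a j x) ∂P) := fun j =>
    (φ.measurable.comp (ha.meas j).measurable).stronglyMeasurable.sub stronglyMeasurable_const
  refine ⟨fun j ω => φ (a j ω) - ∫ x, φ (a j x) ∂P, 2 * K, by positivity,
    ⟨hm, fun j => LpBound.of_norm_le ((hφm j).sub aestronglyMeasurable_const) (hba j), fun j => ?_⟩,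
    hba, fun j => ?_⟩
  · rw [integral_sub ((hφb j).integrable one_le_two) (integrable_const _)]
    simp
  · have h := (hd j).center one_le_two (by positivity)
    rw [integral_sub ((ha.bound j).integrable one_le_two) ((hφb j).integrable one_le_two),
      ha.mean] at h
    refine (h.mono (by linarith)).congr (ae_of_all _ fun ω => ?_)
    simp only [zero_sub, sub_neg_eq_add]
    exact sub_add _ _ _

variable (hε : ∀ i, Measurable (ε i)) (hi : iIndepFun ε P)
include hε hi

/-- The difference of the quadratic forms of two nearby finite range sequences. -/
lemma FiniteRange.lpBound_quadForm_sub (ha : FiniteRange P ε n a s) (hb : FiniteRange P ε n b s)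
    (hs : 0 ≤ s) (ht : 0 ≤ t) (hab : ∀ j, LpBound P 2 (fun ω => a j ω - b j ω) t)
    (hw : IsBand w B L) (τ : E →L[ℝ] E →L[ℝ] F)
    (hτ : ∀ x y x' y', inner ℝ (τ x y) (τ x' y') = inner ℝ x x' * inner ℝ y y') {J : Finset ℤ}
    (hL : 2 * L + 1 ≤ J.card) :
    LpBound P 1 (fun ω => quadForm τ J w (fun j => a j ω) (fun j => a j ω) -
      quadForm τ J w (fun j => b j ω) (fun j => b j ω))
      (J.card * (6 * (4 * n + 1) * B * (s * t))) := by
  have hB := hw.nonneg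
  have hd := ha.sub hb hab
  have h1 := hd.lpBound_quadForm hε hi ha ht hs hw τ hτ hL
  have h2 := hb.lpBound_quadForm hε hi hd hs ht hw τ hτ hL
  refine ((h1.add h2 le_rfl (by positivity) (by positivity)).mono (le_of_eq (by ring))).congr
    (ae_of_all _ fun ω => ?_)
  simp only [quadForm_sub_left, quadForm_sub_right]
  abel

/-- Taking `m = 2 ^ k` turns the polynomial rate into a geometric one of ratio `2 ^ (-γ)`. -/
lemma Approximable.exists_finiteRange {ζ : ℤ → Ω → E} {M C γ : ℝ}
    (hζ : Approximable P ε ζ M C γ) : ∃ A : ℕ → ℤ → Ω → E,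
      (∀ k, FiniteRange P ε (2 ^ k) (A k) (M + C)) ∧
      (∀ k j, IdentDistrib (A k j) (A k 0) P P) ∧
      ∀ k j, LpBound P 2 (fun ω => ζ j ω - A k j ω) (C * ((2 : ℝ) ^ (-γ)) ^ k) := by
  choose A hA using fun k : ℕ => hζ.approx (2 ^ k) Nat.one_le_two_pow
  have hpow : ∀ k : ℕ, (((2 ^ k : ℕ) : ℝ)) ^ (-γ) = ((2 : ℝ) ^ (-γ)) ^ k := fun k => by
    push_cast
    rw [← Real.rpow_natCast, ← Real.rpow_natCast, ← Real.rpow_mul zero_le_two,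
      ← Real.rpow_mul zero_le_two, mul_comm]
  have hle : ∀ k : ℕ, ((2 : ℝ) ^ (-γ)) ^ k ≤ 1 := fun k => pow_le_one₀ (by positivity)
    (Real.rpow_le_one_of_one_le_of_nonpos one_le_two (by linarith [hζ.one_lt]))
  have hC := hζ.C_nonneg
  refine ⟨A, fun k => ⟨fun j => ((hA k).1 j).mono (window_mono fun i hi => ?_), fun j => ?_,
    (hA k).2.1⟩, fun k => (hA k).2.2.1, fun k j => hpow k ▸ (hA k).2.2.2 j⟩
  · rw [Set.mem_Ioc] at hi
    rw [Set.mem_Icc]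
    push_cast at hi ⊢
    have : (0 : ℤ) < 2 ^ k := by positivity
    lia
  · have h := hpow k ▸ (hA k).2.2.2 j
    refine (((hζ.bound j).sub h one_le_two hζ.M_nonneg (by positivity)).mono ?_).congr
      (ae_of_all _ fun ω => by simp)
    gcongr
    exact mul_le_of_le_one_right hC (hle k)

/-- Dyadic telescoping: finite range approximation of the quadratic form, uniformly in the sample
size and the band width. -/
lemma lpBound_quadForm_sub_of_dyadic {ζ : ℤ → Ω → E} {A : ℕ → ℤ → Ω → E} {M C θ : ℝ}
    (hM : 0 ≤ M) (hC : 0 ≤ C) (hθ : 0 < θ) (hθ2 : 2 * θ < 1) (hζ : ∀ j, LpBound P 2 (ζ j) M)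
    (hA : ∀ k, FiniteRange P ε (2 ^ k) (A k) M)
    (hζA : ∀ k j, LpBound P 2 (fun ω => ζ j ω - A k j ω) (C * θ ^ k)) 
    (hw : IsBand w B L) (τ : E →L[ℝ] E →L[ℝ] F)
    (hτ : ∀ x y x' y', inner ℝ (τ x y) (τ x' y') = inner ℝ x x' * inner ℝ y y') {J : Finset ℤ}
    (hL : 2 * L + 1 ≤ J.card) (r : ℕ) :
    LpBound P 1 (fun ω => quadForm τ J w (fun j => ζ j ω) (fun j => ζ j ω) -
      quadForm τ J w (fun j => A r j ω) (fun j => A r j ω))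
      (J.card * (108 * B * M * C * ((2 * θ) ^ r / (1 - 2 * θ)))) := by
  have hB := hw.nonneg
  have hθ1 : 0 < 1 - 2 * θ := by linarith
  -- Doubling the range costs a factor proportional to `2 ^ k`, while the two approximants are
  -- within `2 * C * θ ^ k` of each other. The constant is 108 = 6 · 9 · 2.
  have hstep : ∀ k, LpBound P 1 (fun ω => quadForm τ J w (fun j => A (k + 1) j ω)
      (fun j => A (k + 1) j ω) - quadForm τ J w (fun j => A k j ω) (fun j => A k j ω))
      (J.card * (108 * B * M * C * (2 * θ) ^ k)) := by
    intro k
    have hd : ∀ j, LpBound P 2 (fun ω => A (k + 1) j ω - A k j ω) (2 * (C * θ ^ k)) := by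
      intro j
      refine (((hζA k j).sub (hζA (k + 1) j) one_le_two (by positivity)
        (by positivity)).mono ?_).congr (ae_of_all _ fun ω => by simp)
      rw [two_mul]
      gcongr C * θ ^ k + C * ?_
      exact pow_le_pow_of_le_one hθ.le (by linarith) k.le_succ
    refine ((hA (k + 1)).lpBound_quadForm_sub hε hi ((hA k).mono (Nat.pow_le_pow_right two_pos
      k.le_succ)) hM (by positivity) hd hw τ hτ hL).mono ?_
    have h2 : (4 * ((2 ^ (k + 1) : ℕ) : ℝ) + 1) ≤ 9 * 2 ^ k := by
      push_cast
      have : (1 : ℝ) ≤ 2 ^ k := one_le_pow₀ one_le_two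
      rw [pow_succ]
      linarith
    calc (J.card : ℝ) * (6 * (4 * ((2 ^ (k + 1) : ℕ) : ℝ) + 1) * B * (M * (2 * (C * θ ^ k))))
        ≤ (J.card : ℝ) * (6 * (9 * 2 ^ k) * B * (M * (2 * (C * θ ^ k)))) := by gcongr
      _ = _ := by rw [mul_pow]; ring
  have htel : ∀ R ≥ r, LpBound P 1 (fun ω => quadForm τ J w (fun j => A R j ω)
      (fun j => A R j ω) - quadForm τ J w (fun j => A r j ω) (fun j => A r j ω))
      (J.card * (108 * B * M * C * (((2 * θ) ^ r - (2 * θ) ^ R) / (1 - 2 * θ)))) := by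
    intro R hR
    induction R, hR using Nat.le_induction with
    | base => simpa using LpBound.const (P := P) (q := 1) (0 : F)
    | succ R hR ih =>
      have hle : 0 ≤ (2 * θ) ^ r - (2 * θ) ^ R :=
        sub_nonneg.2 (pow_le_pow_of_le_one (by positivity) hθ2.le hR)
      refine (((hstep R).add ih le_rfl (by positivity) (by positivity)).mono
        (le_of_eq ?_)).congr (ae_of_all _ fun ω => by simp)
      field_simp
      ring
  -- Here the crude bound with its factor `2 * L + 1` is harmless: `R` tends to infinity with `J`
  -- and `L` fixed.
  have hlast : ∀ R, LpBound P 1 (fun ω => quadForm τ J w (fun j => ζ j ω) (fun j => ζ j ω) -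
      quadForm τ J w (fun j => A R j ω) (fun j => A R j ω))
      (J.card * ((2 * L + 1) * B * (C * θ ^ R * M)) +
        J.card * ((2 * L + 1) * B * (M * (C * θ ^ R)))) := by
    intro R
    have h1 := hw.lpBound_quadForm τ (norm_bilin_le hτ) J (hζA R) hζ (by positivity) hM
    have h2 := hw.lpBound_quadForm τ (norm_bilin_le hτ) J (hA R).bound (hζA R) hM (by positivity)
    refine (h1.add h2 le_rfl (by positivity) (by positivity)).congr (ae_of_all _ fun ω => ?_)
    simp only [quadForm_sub_left, quadForm_sub_right]
    abel
  refine LpBound.of_tendsto (r := r) (v := fun R =>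
    (J.card * ((2 * L + 1) * B * (C * θ ^ R * M)) + J.card * ((2 * L + 1) * B * (M * (C * θ ^ R))))
      + J.card * (108 * B * M * C * (((2 * θ) ^ r - (2 * θ) ^ R) / (1 - 2 * θ)))) ?_ ?_
  · intro R hR
    have hle : 0 ≤ (2 * θ) ^ r - (2 * θ) ^ R :=
        sub_nonneg.2 (pow_le_pow_of_le_one (by positivity) hθ2.le hR)
    exact ((hlast R).add (htel R hR) le_rfl (by positivity) (by positivity)).congr
      (ae_of_all _ fun ω => by simp)
  · have t1 : Tendsto (fun R : ℕ => θ ^ R) atTop (𝓝 0) :=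
      tendsto_pow_atTop_nhds_zero_of_lt_one hθ.le (by linarith)
    have t2 : Tendsto (fun R : ℕ => (2 * θ) ^ R) atTop (𝓝 0) :=
      tendsto_pow_atTop_nhds_zero_of_lt_one (by positivity) hθ2
    have hcont : Continuous fun z : ℝ × ℝ =>
      ((J.card : ℝ) * ((2 * L + 1) * B * (C * z.1 * M)) +
        J.card * ((2 * L + 1) * B * (M * (C * z.1))))
      + J.card * (108 * B * M * C * (((2 * θ) ^ r - z.2) / (1 - 2 * θ))) := by fun_prop
    have := (hcont.tendsto (0, 0)).comp (t1.prodMk_nhds t2)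
    simpa [Function.comp_def] using this

/-- The fluctuations of the quadratic form of a bounded finite range sequence. -/
lemma FiniteRange.lpBound_quadForm_center {K : ℝ} (hK : 0 ≤ K) (ha : FiniteRange P ε n a K)
    (hb : ∀ j ω, ‖a j ω‖ ≤ K) (hw : IsBand w B L) [CompleteSpace F] [SecondCountableTopology F]
    [MeasurableSpace F] [BorelSpace F] (τ : E →L[ℝ] E →L[ℝ] F)
    (hτ : ∀ x y x' y', inner ℝ (τ x y) (τ x' y') = inner ℝ x x' * inner ℝ y y') (J : Finset ℤ) :
    LpBound P 1 (fun ω => quadForm τ J w (fun j => a j ω) (fun j => a j ω) -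
      ∫ x, quadForm τ J w (fun j => a j x) (fun j => a j x) ∂P)
      (√(J.card * (2 * L + 1)) * (2 * (12 * n + 3) * (4 * n + 1) * B * K ^ 2)) := by
  have hB := hw.nonneg
  have hτn := norm_bilin_le hτ
  -- The near part is a sum of bounded variables, to which the variance bound applies. Boundedness
  -- of `a` matters only here, since `V j` is quadratic in `a`; the far parts are already small in
  -- L².
  set V : ℤ → Ω → F := fun j ω => ∑ k ∈ J, nearWeight w n (k - j) • τ (a j ω) (a k ω)
  have hVb : ∀ j ω, ‖V j ω‖ ≤ (4 * n + 1) * B * K ^ 2 := by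
    intro j ω
    calc ‖V j ω‖ ≤ ∑ k ∈ J, |nearWeight w n (k - j)| * K ^ 2 := by
          refine norm_sum_le_of_le _ fun k _ => ?_
          rw [norm_smul, Real.norm_eq_abs, sq]
          gcongr
          exact (hτn _ _).trans (by gcongr <;> exact hb _ _)
      _ ≤ (4 * n + 1) * B * K ^ 2 := by
          rw [← Finset.sum_mul]
          gcongr
          refine ((hw.near n).sum_le J j).trans (le_of_eq ?_)
          push_cast
          ring
  -- Range `3n`: indices at distance up to `2n` from `j`, each with its own range `n`.
  have hVm : ∀ j, StronglyMeasurable[window ε (Set.Icc (j - (3 * n : ℕ)) (j + (3 * n : ℕ)))]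
      (V j) := by
    intro j
    refine Finset.stronglyMeasurable_fun_sum _ fun k _ => ?_
    by_cases hk : |k - j| ≤ 2 * n
    · rw [abs_le] at hk
      refine StronglyMeasurable.const_smul (τ.continuous₂.comp_stronglyMeasurable
        (StronglyMeasurable.prodMk ((ha.meas j).mono (window_mono ?_))
          ((ha.meas k).mono (window_mono ?_)))) _
      · exact Set.Icc_subset_Icc (by push_cast; lia) (by push_cast; lia)
      · exact Set.Icc_subset_Icc (by push_cast; lia) (by push_cast; lia)
    · simp only [nearWeight, if_neg hk, zero_smul]
      exact stronglyMeasurable_const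
  have hVa : ∀ j, AEStronglyMeasurable (V j) P := fun j =>
    ((hVm j).mono (window_le hε _)).aestronglyMeasurable
  have hVl : ∀ j, LpBound P 2 (V j) ((4 * n + 1) * B * K ^ 2) := fun j =>
    LpBound.of_norm_le (hVa j) (hVb j)
  have hVi : ∀ j, Integrable (V j) P := fun j => (hVl j).integrable one_le_two
  have hVF : FiniteRange P ε (3 * n) (fun j ω => V j ω - ∫ x, V j x ∂P)
      (2 * ((4 * n + 1) * B * K ^ 2)) :=
    ⟨fun j => (hVm j).sub stronglyMeasurable_const,
      fun j => (hVl j).center one_le_two (by positivity), fun j => by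
        rw [integral_sub (hVi j) (integrable_const _)]
        simp⟩
  have h1 := (hVF.lpBound_sum hε hi (by positivity) J).mono_exponent one_le_two
  have h2 := (ha.lpBound_upperForm hε hi ha hK hK hw τ hτ J).mono_exponent one_le_two
  have h3 := (ha.lpBound_upperForm hε hi ha hK hK hw.neg τ.flip (inner_flip hτ) J).mono_exponent
    one_le_two
  have h23 := h2.add h3 le_rfl (by positivity) (by positivity)
  have h := h1.add (h23.center le_rfl (by positivity)) le_rfl (by positivity) (by positivity)
  have hQ : ∀ ω, quadForm τ J w (fun j => a j ω) (fun j => a j ω) = (∑ j ∈ J, V j ω) +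
      (upperForm τ J w n (fun j => a j ω) (fun j => a j ω) +
        upperForm τ.flip J (fun d => w (-d)) n (fun j => a j ω) (fun j => a j ω)) :=
    fun ω => quadForm_eq_near_add τ J w n _ _
  refine (h.mono ?_).congr (ae_of_all _ fun ω => ?_)
  · have hs1 : √((J.card : ℝ) * (4 * ((3 * n : ℕ) : ℝ) + 1))
        ≤ √(J.card * (2 * L + 1)) * (12 * n + 1) := by
      refine Real.sqrt_le_left (by positivity) |>.2 ?_
      rw [mul_pow, Real.sq_sqrt (by positivity)]
      push_cast
      have hn : (0 : ℝ) ≤ n := by positivity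
      have hL : (0 : ℝ) ≤ L := by positivity
      rw [mul_assoc]
      gcongr
      nlinarith [mul_nonneg hL hn, mul_nonneg hL (mul_nonneg hn hn)]
    calc _ ≤ √(J.card * (2 * L + 1)) * (12 * n + 1) * (2 * ((4 * n + 1) * B * K ^ 2)) +
          2 * ((4 * n + 1) * B * √(J.card * (2 * L + 1)) * (K * K) +
            (4 * n + 1) * B * √(J.card * (2 * L + 1)) * (K * K)) := by gcongr
      _ = _ := by ring
  · simp_rw [hQ]
    rw [integral_add (integrable_finsetSum _ fun j _ => hVi j) (h23.integrable le_rfl),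
      integral_finsetSum _ fun j _ => hVi j, Finset.sum_sub_distrib]
    abel

end Dyadic

/-! ### L¹ convergence of the normalized quadratic form. -/

section Consistency

variable {Ω S : Type*} [mΩ : MeasurableSpace Ω] [MeasurableSpace S] {P : Measure Ω}
  {ε : ℤ → Ω → S}
  {E F : Type*} [NormedAddCommGroup E] [InnerProductSpace ℝ E] [NormedAddCommGroup F]
  [InnerProductSpace ℝ F] [MeasurableSpace E]
  [BorelSpace E] [IsProbabilityMeasure P] [CompleteSpace E] [SecondCountableTopology E]
  [CompleteSpace F] [SecondCountableTopology F] [MeasurableSpace F] [BorelSpace F]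
  {ζ : ℤ → Ω → E} {M C γ B : ℝ} {w : ℕ → ℤ → ℝ} {L : ℕ → ℕ}

lemma tendsto_band_div {L : ℕ → ℕ}
    (hL : Tendsto (fun T : ℕ => (2 * L T + 1) / √(T : ℝ)) atTop (𝓝 0)) :
    Tendsto (fun T : ℕ => (2 * L T + 1) / (T : ℝ)) atTop (𝓝 0) := by
  have h1 : Tendsto (fun T : ℕ => (√(T : ℝ))⁻¹) atTop (𝓝 0) :=
    (Real.tendsto_sqrt_atTop.comp tendsto_natCast_atTop_atTop).inv_tendsto_atTop
  have h := hL.mul h1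
  rw [mul_zero] at h
  refine h.congr fun T => ?_
  rw [div_eq_mul_inv, mul_assoc, ← mul_inv, Real.mul_self_sqrt (by positivity), div_eq_mul_inv]

variable (hε : ∀ i, Measurable (ε i)) (hi : iIndepFun ε P)
include hε hi

lemma Approximable.summable_norm (hζ : Approximable P ε ζ M C γ) (τ : E →L[ℝ] E →L[ℝ] F)
    (hτ : ∀ x y, ‖τ x y‖ ≤ ‖x‖ * ‖y‖) {Γ : ℤ → F}
    (hΓ : ∀ d, ∫ ω, τ (ζ 0 ω) (ζ d ω) ∂P = Γ d) : Summable fun d => ‖Γ d‖ := by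
  refine Summable.of_nonneg_of_le (fun d => norm_nonneg _) (fun d => ?_)
    (summable_covBound hζ.one_lt M C)
  rw [← hΓ]
  simpa using hζ.norm_integral_le hε hi τ hτ 0 d

/-- Only second moments are used. The form in `ζ` is replaced by that of a finite range sequence `A
r`, then by that of a bounded sequence `a`, both with error a small multiple of `T`, uniformly in
the band width. The form in `a` concentrates because the band width is o(√T), and the exact
expectation of the form in `ζ` is compared with the series. -/
theorem Approximable.tendsto_quadForm (hζ : Approximable P ε ζ M C γ)
    (hw : ∀ᶠ T in atTop, IsBand (w T) B (L T)) (hw1 : ∀ d, Tendsto (fun T => w T d) atTop (𝓝 1))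
    (hL : Tendsto (fun T : ℕ => (2 * L T + 1) / √(T : ℝ)) atTop (𝓝 0))
    (τ : E →L[ℝ] E →L[ℝ] F)
    (hτ : ∀ x y x' y', inner ℝ (τ x y) (τ x' y') = inner ℝ x x' * inner ℝ y y')
    {Γ : ℤ → F} (hΓ : ∀ j k, ∫ ω, τ (ζ j ω) (ζ k ω) ∂P = Γ (k - j)) :
    Tendsto (fun T : ℕ => eLpNorm (fun ω => (T : ℝ)⁻¹ • quadForm τ (Finset.Icc (1 : ℤ) T) (w T)
      (fun j => ζ j ω) (fun j => ζ j ω) - ∑' d, Γ d) 1 P) atTop (𝓝 0) := by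
  have hM := hζ.M_nonneg
  have hC := hζ.C_nonneg
  have hτn := norm_bilin_le hτ
  have hB : 0 ≤ B := hw.exists.choose_spec.nonneg
  obtain ⟨A, hA, hid, hζA⟩ := hζ.exists_finiteRange hε hi
  set θ : ℝ := (2 : ℝ) ^ (-γ) with hθdef
  have hθ : 0 < θ := by positivity
  have hθ2 : 2 * θ < 1 := by
    have : (2 : ℝ) * θ = 2 ^ (1 - γ) := by
      rw [sub_eq_add_neg, Real.rpow_add two_pos, Real.rpow_one]
    rw [this]
    exact Real.rpow_lt_one_of_one_lt_of_neg one_lt_two (by linarith [hζ.one_lt])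
  rw [ENNReal.tendsto_nhds_zero]
  intro δ hδ
  obtain ⟨η, hη0, hηδ⟩ : ∃ η : ℝ, 0 < η ∧ ENNReal.ofReal η ≤ δ := by
    obtain ⟨η, h0, h1⟩ := ENNReal.lt_iff_exists_nnreal_btwn.1 hδ
    exact ⟨η, by exact_mod_cast h0, by rw [ENNReal.ofReal_coe_nnreal]; exact h1.le⟩
  -- Budget: the range and truncation errors take `η / 8` each and are doubled by centring;
  -- fluctuation and bias take `η / 4` each.
  obtain ⟨r, hr⟩ : ∃ r : ℕ, 108 * B * (M + C) * C * ((2 * θ) ^ r / (1 - 2 * θ)) ≤ η / 8 := by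
    have t2 : Tendsto (fun R : ℕ => (2 * θ) ^ R) atTop (𝓝 0) :=
      tendsto_pow_atTop_nhds_zero_of_lt_one (by positivity) hθ2
    have t3 := (t2.div_const (1 - 2 * θ)).const_mul (108 * B * (M + C) * C)
    rw [zero_div, mul_zero] at t3
    exact (t3.eventually_le_const (by positivity)).exists
  obtain ⟨η₁, hη₁0, hη₁1, hη₁⟩ : ∃ η₁ : ℝ, 0 < η₁ ∧ η₁ ≤ 1 ∧
      6 * (4 * ((2 ^ r : ℕ) : ℝ) + 1) * B * ((M + C + 1) * η₁) ≤ η / 8 := by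
    have hD : 0 < 6 * (4 * ((2 ^ r : ℕ) : ℝ) + 1) * B * (M + C + 1) + 1 := by positivity
    refine ⟨min 1 (η / 8 / (6 * (4 * ((2 ^ r : ℕ) : ℝ) + 1) * B * (M + C + 1) + 1)),
      lt_min one_pos (by positivity), min_le_left _ _, ?_⟩
    calc _ ≤ 6 * (4 * ((2 ^ r : ℕ) : ℝ) + 1) * B * ((M + C + 1) *
          (η / 8 / (6 * (4 * ((2 ^ r : ℕ) : ℝ) + 1) * B * (M + C + 1) + 1))) := by
          gcongr
          exact min_le_right _ _
      _ = (6 * (4 * ((2 ^ r : ℕ) : ℝ) + 1) * B * (M + C + 1)) /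
          (6 * (4 * ((2 ^ r : ℕ) : ℝ) + 1) * B * (M + C + 1) + 1) * (η / 8) := by ring
      _ ≤ 1 * (η / 8) := by
          gcongr
          exact div_le_one_of_le₀ (by linarith) hD.le
      _ = η / 8 := one_mul _
  obtain ⟨a, K, hK, ha, haK, hAa⟩ := (hA r).exists_bounded (hid r) hη₁0
  have ha' : FiniteRange P ε (2 ^ r) a (M + C + 1) := ⟨ha.meas, fun j =>
    (((hA r).bound j).sub (hAa j) one_le_two (by positivity) hη₁0.le |>.mono (by linarith)).congr
      (ae_of_all _ fun ω => by simp), ha.mean⟩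
  have hA' : FiniteRange P ε (2 ^ r) (A r) (M + C + 1) :=
    ⟨(hA r).meas, fun j => ((hA r).bound j).mono (by linarith), (hA r).mean⟩
  have hband := tendsto_band_div hL
  set cc : ℝ := 2 * (12 * ((2 ^ r : ℕ) : ℝ) + 3) * (4 * ((2 ^ r : ℕ) : ℝ) + 1) * B * K ^ 2
  have hcc : 0 ≤ cc := by positivity
  have ev1 : ∀ᶠ T : ℕ in atTop, √((2 * L T + 1) / (T : ℝ)) * cc ≤ η / 4 := by
    have h := ((Real.continuous_sqrt.tendsto 0).comp hband).mul_const cc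
    rw [Real.sqrt_zero, zero_mul] at h
    exact h.eventually_le_const (by positivity)
  have ev2 : ∀ᶠ T : ℕ in atTop, ‖(T : ℝ)⁻¹ • ∑ j ∈ Finset.Icc (1 : ℤ) T,
      ∑ k ∈ Finset.Icc (1 : ℤ) T, w T (k - j) • Γ (k - j) - ∑' d, Γ d‖ ≤ η / 4 := by
    have h := tendsto_weighted_sum (hw.mono fun T hT => hT.bound) hw1
      (hζ.summable_norm hε hi τ hτn fun d => (by simpa using hΓ 0 d))
    rw [tendsto_iff_norm_sub_tendsto_zero] at h
    exact h.eventually_le_const (by positivity)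
  filter_upwards [hw, ev1, ev2, hband.eventually_le_const one_pos, eventually_gt_atTop 0] with
    T hwT h1 h2 h3 hT0
  have hT : (0 : ℝ) < T := by exact_mod_cast hT0
  set J := Finset.Icc (1 : ℤ) T
  have hJ : J.card = T := by simp [J]
  have hLT : 2 * L T + 1 ≤ J.card := by
    rw [hJ]
    rw [div_le_one hT] at h3
    exact_mod_cast h3
  have b1 := lpBound_quadForm_sub_of_dyadic hε hi (add_nonneg hM hC) hC hθ hθ2
    (fun j => (hζ.bound j).mono (by linarith)) hA hζA hwT τ hτ hLT r
  have b2 := hA'.lpBound_quadForm_sub hε hi ha' (by positivity) hη₁0.le hAa hwT τ hτ hLT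
  have b3 := ha.lpBound_quadForm_center hε hi hK haK hwT τ hτ J
  rw [hJ] at b1 b2 b3
  have c1 := b1.mono (mul_le_mul_of_nonneg_left hr hT.le)
  have c2 := b2.mono (mul_le_mul_of_nonneg_left hη₁ hT.le)
  have c3 : LpBound P 1 (fun ω => quadForm τ J (w T) (fun j => a j ω) (fun j => a j ω) -
      ∫ x, quadForm τ J (w T) (fun j => a j x) (fun j => a j x) ∂P) (T * (η / 4)) := by
    refine b3.mono ?_
    have e : √((T : ℝ) * (2 * L T + 1)) = T * √((2 * L T + 1) / (T : ℝ)) := by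
      rw [show (T : ℝ) * (2 * L T + 1) = T ^ 2 * ((2 * L T + 1) / (T : ℝ)) by field_simp,
        Real.sqrt_mul (by positivity), Real.sqrt_sq hT.le]
    rw [e, mul_assoc]
    exact mul_le_mul_of_nonneg_left h1 hT.le
  -- Centring the replacement error lets the expectation of the form in `a` cancel against the one
  -- in `c3`, leaving the form in `ζ` minus its own expectation.
  have c12 := (c1.add c2 le_rfl (by positivity) (by positivity)).center le_rfl (by positivity)
  have c := ((c12.add c3 le_rfl (by positivity) (by positivity)).const_smul (T : ℝ)⁻¹).add
    (LpBound.const (P := P) (q := 1) ((T : ℝ)⁻¹ • ∑ j ∈ J, ∑ k ∈ J, w T (k - j) • Γ (k - j)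
      - ∑' d, Γ d)) le_rfl (by positivity) (by positivity)
  have iζ : Integrable (fun ω => quadForm τ J (w T) (fun j => ζ j ω) (fun j => ζ j ω)) P :=
    (hwT.lpBound_quadForm τ hτn J hζ.bound hζ.bound hM hM).integrable le_rfl
  have ia : Integrable (fun ω => quadForm τ J (w T) (fun j => a j ω) (fun j => a j ω)) P :=
    (hwT.lpBound_quadForm τ hτn J ha.bound ha.bound hK hK).integrable le_rfl
  have hEζ : ∫ ω, quadForm τ J (w T) (fun j => ζ j ω) (fun j => ζ j ω) ∂P
      = ∑ j ∈ J, ∑ k ∈ J, w T (k - j) • Γ (k - j) := by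
    have hint : ∀ j k, Integrable (fun ω => w T (k - j) • τ (ζ j ω) (ζ k ω)) P := fun j k =>
      (((hζ.bound j).bilin (hζ.bound k) (r := 1) τ hτn hM).integrable le_rfl).smul _
    simp only [quadForm]
    rw [integral_finsetSum _ fun j _ => integrable_finsetSum _ fun k _ => hint j k]
    refine Finset.sum_congr rfl fun j _ => ?_
    rw [integral_finsetSum _ fun k _ => hint j k]
    refine Finset.sum_congr rfl fun k _ => ?_
    rw [integral_smul, hΓ]
  have c' := (c.mono (t := η) ?_).congr (g := fun ω => (T : ℝ)⁻¹ • quadForm τ J (w T)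
      (fun j => ζ j ω) (fun j => ζ j ω) - ∑' d, Γ d) (ae_of_all _ fun ω => ?_)
  · exact c'.le.trans hηδ
  · rw [abs_of_nonneg (by positivity)]
    calc _ ≤ (T : ℝ)⁻¹ * (2 * (T * (η / 8) + T * (η / 8)) + T * (η / 4)) + η / 4 := by gcongr
      _ = η := by field_simp; ring
  · have e12 : ∫ x, ((quadForm τ J (w T) (fun j => ζ j x) (fun j => ζ j x) -
        quadForm τ J (w T) (fun j => A r j x) (fun j => A r j x)) +
        (quadForm τ J (w T) (fun j => A r j x) (fun j => A r j x) -
        quadForm τ J (w T) (fun j => a j x) (fun j => a j x))) ∂P =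
        ∑ j ∈ J, ∑ k ∈ J, w T (k - j) • Γ (k - j) -
          ∫ x, quadForm τ J (w T) (fun j => a j x) (fun j => a j x) ∂P := by
      simp only [sub_add_sub_cancel]
      rw [integral_sub iζ ia, hEζ]
    simp only [e12]
    rw [← sub_eq_zero, ← add_sub_assoc, sub_sub_sub_cancel_right, ← smul_add, ← smul_sub]
    convert smul_zero _ using 2
    abel

end Consistency

/-! ### Bernoulli shifts: stationarity and coupling. -/

section Shift

variable {Ω S : Type*} [mΩ : MeasurableSpace Ω] [mS : MeasurableSpace S] {P : Measure Ω}
  [IsProbabilityMeasure P] {ε : ℤ → Ω → S}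

lemma measurable_past (hε : ∀ i, Measurable (ε i)) (j : ℤ) : Measurable (past ε j) :=
  measurable_pi_lambda _ fun k => hε (j - k)

/-- The sequence which agrees with `e` before position `m` and with `e'` from there on. -/
def splice (m : ℕ) (e e' : ℕ → S) (k : ℕ) : S := if k < m then e k else e' k

lemma measurable_splice (m : ℕ) :
    Measurable fun z : (ℕ → S) × (ℕ → S) => splice m z.1 z.2 := by
  refine measurable_pi_lambda _ fun k => ?_
  unfold splice
  split_ifs <;> fun_prop

lemma measurable_past_window (j : ℤ) : Measurable[window ε (Set.Iic j)] (past ε j) :=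
  @measurable_pi_lambda _ _ _ (window ε (Set.Iic j)) _ _ fun k =>
    measurable_window (by simp)

lemma measurable_splice_past_window (m : ℕ) (j : ℤ) (e' : ℕ → S) :
    Measurable[window ε (Set.Ioc (j - m) j)] fun ω => splice m (past ε j ω) e' := by
  refine @measurable_pi_lambda _ _ _ (window ε (Set.Ioc (j - m) j)) _ _ fun k => ?_
  unfold splice
  split_ifs with h
  · exact measurable_window (by rw [Set.mem_Ioc]; lia)
  · exact measurable_const

variable (hε : ∀ i, Measurable (ε i)) (hi : iIndepFun ε P)
  (hid : ∀ i, IdentDistrib (ε i) (ε 0) P P)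
include hε hi hid

/-- Both laws are infinite products of the same marginal. -/
lemma map_shift_eq (j : ℤ) : P.map (fun ω (k : ℤ) => ε (k + j) ω) = P.map fun ω k => ε k ω := by
  rw [(iIndepFun_iff_map_fun_eq_infinitePi_map fun k => hε (k + j)).1
    (hi.precomp (add_left_injective j)), (iIndepFun_iff_map_fun_eq_infinitePi_map hε).1 hi]
  congr 1
  ext1 k
  rw [(hid (k + j)).map_eq, (hid k).map_eq]

lemma integral_shift_eq {F : Type*} [NormedAddCommGroup F] [NormedSpace ℝ F]
    {Φ : (ℤ → S) → F} (hΦ : StronglyMeasurable Φ) (j : ℤ) :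
    ∫ ω, Φ (fun k => ε (k + j) ω) ∂P = ∫ ω, Φ (fun k => ε k ω) ∂P := by
  have h1 : Measurable fun ω (k : ℤ) => ε (k + j) ω := measurable_pi_lambda _ fun k => hε _
  have h2 : Measurable fun ω (k : ℤ) => ε k ω := measurable_pi_lambda _ hε
  rw [← integral_map (φ := fun ω (k : ℤ) => ε (k + j) ω) h1.aemeasurable hΦ.aestronglyMeasurable,
    map_shift_eq hε hi hid,
    integral_map (φ := fun ω (k : ℤ) => ε k ω) h2.aemeasurable hΦ.aestronglyMeasurable]

lemma identDistrib_past (j : ℤ) : IdentDistrib (past ε j) (past ε 0) P P := by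
  refine ⟨(measurable_past hε j).aemeasurable, (measurable_past hε 0).aemeasurable, ?_⟩
  have h := map_shift_eq hε hi hid j
  have h1 : Measurable fun ω (k : ℤ) => ε (k + j) ω := measurable_pi_lambda _ fun k => hε _
  have h2 : Measurable fun ω (k : ℤ) => ε k ω := measurable_pi_lambda _ hε
  have hr : Measurable fun (s : ℤ → S) (k : ℕ) => s (-k) :=
    measurable_pi_lambda _ fun k => measurable_pi_apply _
  have h3 := congrArg (Measure.map fun (s : ℤ → S) (k : ℕ) => s (-k)) h
  rw [Measure.map_map hr h1, Measure.map_map hr h2] at h3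
  convert h3 using 2
  · ext ω k
    simp [past, sub_eq_neg_add]
  · ext ω k
    simp [past]

variable {E F : Type*} [NormedAddCommGroup E] [InnerProductSpace ℝ E] [MeasurableSpace E]
  [BorelSpace E] [NormedAddCommGroup F] [InnerProductSpace ℝ F] {G : (ℕ → S) → E} {s : ℝ}

lemma LpBound.past (hG : StronglyMeasurable G) {q : ℝ≥0∞}
    (h : LpBound P q (fun ω => G (past ε 0 ω)) s) (j : ℤ) :
    LpBound P q (fun ω => G (FTS.past ε j ω)) s := by
  refine ⟨(hG.comp_measurable (measurable_past hε j)).aestronglyMeasurable, ?_⟩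
  refine le_trans (le_of_eq ?_) h.le
  have e := fun j => eLpNorm_map_measure (p := q) (hG.aestronglyMeasurable)
    (measurable_past hε j).aemeasurable (μ := P)
  have h1 := e j
  rw [(identDistrib_past hε hi hid j).map_eq, e 0] at h1
  exact h1.symm

lemma integral_past_eq (hG : StronglyMeasurable G) (j : ℤ) :
    ∫ ω, G (past ε j ω) ∂P = ∫ ω, G (past ε 0 ω) ∂P := by
  have e := fun j => integral_map (μ := P) (measurable_past hε j).aemeasurable
    (hG.aestronglyMeasurable)
  rw [← e j, (identDistrib_past hε hi hid j).map_eq, e 0]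

lemma integral_bilin_past_eq [SecondCountableTopology E] (hG : StronglyMeasurable G)
    (τ : E →L[ℝ] E →L[ℝ] F) (j k : ℤ) :
    ∫ ω, τ (G (past ε j ω)) (G (past ε k ω)) ∂P
      = ∫ ω, τ (G (past ε 0 ω)) (G (past ε (k - j) ω)) ∂P := by
  have hm : ∀ d : ℤ, Measurable fun (s : ℤ → S) (i : ℕ) => s (d - i) := fun d =>
    measurable_pi_lambda _ fun k => measurable_pi_apply _
  have hΦ : StronglyMeasurable fun s : ℤ → S =>
      τ (G fun i : ℕ => s (0 - i)) (G fun i : ℕ => s (k - j - i)) :=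
    τ.continuous₂.comp_stronglyMeasurable
      ((hG.comp_measurable (hm 0)).prodMk (hG.comp_measurable (hm (k - j))))
  have h := integral_shift_eq hε hi hid hΦ j
  have e : ∀ (d : ℤ) (ω : Ω), (fun i : ℕ => ε (d - i + j) ω) = past ε (d + j) ω := fun d ω => by
    funext i
    simp only [FTS.past]
    congr 1
    ring
  simp only [e, zero_add, sub_add_cancel] at h
  exact h

/-- Freezing the tail of the coupled innovations at a deterministic sequence. -/
lemma exists_splice_lpBound {εs : ℤ → Ω → S} (hεs : ∀ i, Measurable (εs i))
    (his : iIndepFun (fun k : ℤ ⊕ ℤ => Sum.elim ε εs k) P) (m : ℕ) [SecondCountableTopology E]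
    (hG : StronglyMeasurable G)
    (h : LpBound P 2 (fun ω => G (past ε 0 ω) - G (splice m (past ε 0 ω) (past εs 0 ω))) s) :
    ∃ e' : ℕ → S, LpBound P 2 (fun ω => G (past ε 0 ω) - G (splice m (past ε 0 ω) e')) s := by
  have hp := measurable_past hε 0
  have hps := measurable_past hεs 0
  have hall : ∀ k : ℤ ⊕ ℤ, Measurable (Sum.elim ε εs k) := by
    rintro (k | k)
    · exact hε k
    · exact hεs k
  have hind : IndepFun (past ε 0) (past εs 0) P := by
    rw [IndepFun_iff_Indep]
    have hd := indep_iSup_of_disjoint (fun k => (hall k).comap_le) his.iIndep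
      (S := Set.range Sum.inl) (T := Set.range Sum.inr)
      (by rw [Set.disjoint_left]; rintro _ ⟨x, rfl⟩ ⟨y, hy⟩; cases hy)
    refine indep_of_indep_of_le_left (indep_of_indep_of_le_right hd ?_) ?_
    · refine Measurable.comap_le (@measurable_pi_lambda _ _ _ (_) _ _ fun k => ?_)
      exact Measurable.of_comap_le (le_biSup (fun k : ℤ ⊕ ℤ =>
        MeasurableSpace.comap (Sum.elim ε εs k) mS) (i := Sum.inr (0 - k)) ⟨_, rfl⟩)
    · refine Measurable.comap_le (@measurable_pi_lambda _ _ _ (_) _ _ fun k => ?_)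
      exact Measurable.of_comap_le (le_biSup (fun k : ℤ ⊕ ℤ =>
        MeasurableSpace.comap (Sum.elim ε εs k) mS) (i := Sum.inl (0 - k)) ⟨_, rfl⟩)
  have hlaw := (indepFun_iff_map_prod_eq_prod_map_map hp.aemeasurable hps.aemeasurable).1 hind
  have : IsProbabilityMeasure (P.map (past ε 0)) := Measure.isProbabilityMeasure_map hp.aemeasurable
  have : IsProbabilityMeasure (P.map (past εs 0)) :=
    Measure.isProbabilityMeasure_map hps.aemeasurable
  have hD : StronglyMeasurable fun z : (ℕ → S) × (ℕ → S) => G z.1 - G (splice m z.1 z.2) :=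
    (hG.comp_measurable measurable_fst).sub (hG.comp_measurable (measurable_splice m))
  have hDm : Measurable fun z : (ℕ → S) × (ℕ → S) =>
      ‖G z.1 - G (splice m z.1 z.2)‖ₑ ^ (2 : ℝ) := hD.enorm.pow_const 2
  -- The two pasts are independent, so the squared coupling error is an iterated integral over tails
  -- and pasts.
  have key : ∫⁻ ω, ‖G (past ε 0 ω) - G (splice m (past ε 0 ω) (past εs 0 ω))‖ₑ ^ (2 : ℝ) ∂P
      = ∫⁻ e', ∫⁻ e, ‖G e - G (splice m e e')‖ₑ ^ (2 : ℝ) ∂(P.map (past ε 0))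
        ∂(P.map (past εs 0)) := by
    rw [← lintegral_prod_symm' _ hDm, ← hlaw, lintegral_map hDm (hp.prodMk hps)]
  -- Some deterministic tail does no worse than the average over random tails. The frozen variable
  -- then depends on `m` of the original innovations only, which the coupled one does not.
  obtain ⟨e', he'⟩ := exists_le_lintegral (μ := P.map (past εs 0))
    (f := fun e' => ∫⁻ e, ‖G e - G (splice m e e')‖ₑ ^ (2 : ℝ) ∂(P.map (past ε 0)))
    hDm.lintegral_prod_left'.aemeasurable
  have hm' : Measurable fun e : ℕ → S => splice m e e' :=
    (measurable_splice m).comp (measurable_id.prodMk measurable_const)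
  refine ⟨e', ((hG.comp_measurable hp).sub (hG.comp_measurable
    (hm'.comp hp))).aestronglyMeasurable, le_trans ?_ h.le⟩
  have hDe : Measurable fun e : ℕ → S => ‖G e - G (splice m e e')‖ₑ ^ (2 : ℝ) :=
    (hG.sub (hG.comp_measurable hm')).enorm.pow_const 2
  rw [← key, lintegral_map hDe hp] at he'
  rw [eLpNorm_eq_lintegral_rpow_enorm_toReal two_ne_zero ENNReal.ofNat_ne_top,
    eLpNorm_eq_lintegral_rpow_enorm_toReal two_ne_zero ENNReal.ofNat_ne_top]
  simp only [ENNReal.toReal_ofNat]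
  gcongr

/-- Bernoulli shifts with polynomially decaying coupling error are `Approximable`. -/
theorem approximable_of_coupling {εs : ℕ → ℤ → Ω → S} (hεs : ∀ m, 1 ≤ m → ∀ i, Measurable (εs m i))
    (his : ∀ m, 1 ≤ m → iIndepFun (fun k : ℤ ⊕ ℤ => Sum.elim ε (εs m) k) P)
    [SecondCountableTopology E] [CompleteSpace E] (hG : StronglyMeasurable G) {M C γ : ℝ}
    (hM : 0 ≤ M) (hC : 0 ≤ C) (hγ : 1 < γ) (hGM : LpBound P 2 (fun ω => G (past ε 0 ω)) M)
    (h : ∀ m : ℕ, 1 ≤ m → LpBound P 2 (fun ω => G (past ε 0 ω) - G (coupledPast ε εs m 0 ω))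
      (C * (m : ℝ) ^ (-γ))) :
    Approximable P ε (fun j ω => G (past ε j ω) - ∫ x, G (past ε 0 x) ∂P) (2 * M) (2 * C) γ where
  M_nonneg := by positivity
  C_nonneg := by positivity
  one_lt := hγ
  meas j := (hG.comp_measurable (measurable_past_window j)).sub stronglyMeasurable_const
  bound j := by
    have := (hGM.past hε hi hid hG j).center one_le_two hM
    rwa [integral_past_eq hε hi hid hG] at this
  approx m hm := by
    obtain ⟨e', he'⟩ := exists_splice_lpBound hε hi hid (hεs m hm) (his m hm) m hG (h m hm)
    have hm' : Measurable fun e : ℕ → S => splice m e e' :=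
      (measurable_splice m).comp (measurable_id.prodMk measurable_const)
    set A : (ℕ → S) → E := fun e => G (splice m e e')
    have hA : StronglyMeasurable A := hG.comp_measurable hm'
    have hd := fun j => LpBound.past hε hi hid (G := fun e => G e - A e) (hG.sub hA) he' j
    have hAi : ∀ j, Integrable (fun ω => A (past ε j ω)) P := fun j =>
      (((hGM.past hε hi hid hG j).integrable one_le_two).sub
        ((hd j).integrable one_le_two)).congr (ae_of_all _ fun ω => sub_sub_cancel _ _)
    refine ⟨fun j ω => A (past ε j ω) - ∫ x, A (past ε 0 x) ∂P, fun j => ?_, fun j => ?_,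
      fun j => ?_, fun j => ?_⟩
    · exact (hG.comp_measurable (measurable_splice_past_window m j e')).sub
        stronglyMeasurable_const
    · rw [integral_sub (hAi j) (integrable_const _), integral_past_eq hε hi hid hA]
      simp
    · exact (identDistrib_past hε hi hid j).comp
        (u := fun e => A e - ∫ x, A (past ε 0 x) ∂P) (hA.measurable.sub_const _)
    · have hc := (hd j).center one_le_two (by positivity)
      rw [integral_sub ((hGM.past hε hi hid hG j).integrable one_le_two) (hAi j),
        integral_past_eq hε hi hid hG, integral_past_eq hε hi hid hA] at hc
      refine (hc.mono (by rw [mul_assoc])).congr (ae_of_all _ fun ω => ?_)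
      simp only
      abel

end Shift

/-! ### Functions representing L² classes, and their tensor products. -/

section Represents

variable {α : Type*} [MeasurableSpace α] {μ : Measure α}

/-- `F ∈ L²(μ)` is the class of the function `f`. -/
def Represents (μ : Measure α) (f : α → ℝ) (F : Lp ℝ 2 μ) : Prop := f =ᵐ[μ] F

variable {f g : α → ℝ} {F G : Lp ℝ 2 μ}

lemma Represents.add (hf : Represents μ f F) (hg : Represents μ g G) :
    Represents μ (fun z => f z + g z) (F + G) :=
  (EventuallyEq.add hf hg).trans (Lp.coeFn_add F G).symm

lemma Represents.sub (hf : Represents μ f F) (hg : Represents μ g G) :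
    Represents μ (fun z => f z - g z) (F - G) :=
  (EventuallyEq.sub hf hg).trans (Lp.coeFn_sub F G).symm

lemma Represents.const_mul (hf : Represents μ f F) (c : ℝ) :
    Represents μ (fun z => c * f z) (c • F) := by
  filter_upwards [hf, Lp.coeFn_smul c F] with z h1 h2
  rw [h2, h1, Pi.smul_apply, smul_eq_mul]

lemma Represents.sum {ι : Type*} {J : Finset ι} {f : ι → α → ℝ} {F : ι → Lp ℝ 2 μ}
    (h : ∀ i ∈ J, Represents μ (f i) (F i)) :
    Represents μ (fun z => ∑ i ∈ J, f i z) (∑ i ∈ J, F i) := by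
  have h' : ∀ᵐ z ∂μ, ∀ i ∈ J, f i z = F i z := (ae_ball_iff J.countable_toSet).2 h
  filter_upwards [h', Lp.coeFn_fun_finsetSum J F] with z h1 h2
  rw [h2]
  exact Finset.sum_congr rfl h1

end Represents

section Tensor

variable {α : Type*} [MeasurableSpace α] {μ : Measure α} [SFinite μ]

lemma memLp_tensor {f g : α → ℝ} (hf : MemLp f 2 μ) (hg : MemLp g 2 μ) :
    MemLp (fun z : α × α => f z.1 * g z.2) 2 (μ.prod μ) := by
  refine (memLp_two_iff_integrable_sq (hf.1.comp_fst.mul hg.1.comp_snd)).2 ?_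
  simp only [Pi.mul_apply, mul_pow]
  exact hf.integrable_sq.mul_prod hg.integrable_sq

lemma ae_eq_tensor {f f' g g' : α → ℝ} (hf : f =ᵐ[μ] f') (hg : g =ᵐ[μ] g') :
    (fun z : α × α => f z.1 * g z.2) =ᵐ[μ.prod μ] fun z => f' z.1 * g' z.2 := by
  filter_upwards [Measure.quasiMeasurePreserving_fst.ae hf,
    Measure.quasiMeasurePreserving_snd.ae hg] with z h1 h2
  rw [h1, h2]

/-- The class of `(x, y) ↦ f x * g y`. -/
noncomputable def tensorLp (f g : Lp ℝ 2 μ) : Lp ℝ 2 (μ.prod μ) :=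
  (memLp_tensor (Lp.memLp f) (Lp.memLp g)).toLp

lemma Represents.tensorLp {f g : α → ℝ} {F G : Lp ℝ 2 μ} (hf : Represents μ f F)
    (hg : Represents μ g G) :
    Represents (μ.prod μ) (fun z => f z.1 * g z.2) (tensorLp F G) :=
  (ae_eq_tensor hf hg).trans (MemLp.coeFn_toLp _).symm

lemma inner_tensorLp (f g f' g' : Lp ℝ 2 μ) :
    inner ℝ (tensorLp f g) (tensorLp f' g') = inner ℝ f f' * inner ℝ g g' := by
  simp only [L2.inner_def]
  rw [← integral_prod_mul]
  refine integral_congr_ae ?_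
  filter_upwards [(memLp_tensor (Lp.memLp f) (Lp.memLp g)).coeFn_toLp,
    (memLp_tensor (Lp.memLp f') (Lp.memLp g')).coeFn_toLp] with z h1 h2
  rw [tensorLp, tensorLp, h1, h2]
  simp only [RCLike.inner_apply, conj_trivial]
  ring

lemma norm_tensorLp (f g : Lp ℝ 2 μ) : ‖tensorLp f g‖ = ‖f‖ * ‖g‖ := by
  refine (sq_eq_sq₀ (by positivity) (by positivity)).1 ?_
  rw [← real_inner_self_eq_norm_sq, inner_tensorLp, real_inner_self_eq_norm_sq,
    real_inner_self_eq_norm_sq, mul_pow]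

variable (μ) in
/-- The tensor product as a continuous bilinear map. -/
noncomputable def tensor : Lp ℝ 2 μ →L[ℝ] Lp ℝ 2 μ →L[ℝ] Lp ℝ 2 (μ.prod μ) :=
  LinearMap.mkContinuous₂ (LinearMap.mk₂ ℝ tensorLp
    (fun f f' g => Lp.ext <| by
      have hr : ∀ F : Lp ℝ 2 μ, Represents μ F F := fun F => EventuallyEq.rfl
      refine ((((hr f).add (hr f')).tensorLp (hr g)).symm.trans ?_).trans
        (((hr f).tensorLp (hr g)).add ((hr f').tensorLp (hr g)))
      exact ae_of_all _ fun z => add_mul _ _ _)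
    (fun c f g => Lp.ext <| by
      have hr : ∀ F : Lp ℝ 2 μ, Represents μ F F := fun F => EventuallyEq.rfl
      refine ((((hr f).const_mul c).tensorLp (hr g)).symm.trans ?_).trans
        (((hr f).tensorLp (hr g)).const_mul c)
      exact ae_of_all _ fun z => mul_assoc _ _ _)
    (fun f g g' => Lp.ext <| by
      have hr : ∀ F : Lp ℝ 2 μ, Represents μ F F := fun F => EventuallyEq.rfl
      refine (((hr f).tensorLp ((hr g).add (hr g'))).symm.trans ?_).trans
        (((hr f).tensorLp (hr g)).add ((hr f).tensorLp (hr g')))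
      exact ae_of_all _ fun z => mul_add _ _ _)
    (fun c f g => Lp.ext <| by
      have hr : ∀ F : Lp ℝ 2 μ, Represents μ F F := fun F => EventuallyEq.rfl
      refine (((hr f).tensorLp ((hr g).const_mul c)).symm.trans ?_).trans
        (((hr f).tensorLp (hr g)).const_mul c)
      exact ae_of_all _ fun z => mul_left_comm _ _ _))
    1 fun f g => by simp [norm_tensorLp]

lemma inner_tensor (f g f' g' : Lp ℝ 2 μ) :
    inner ℝ (tensor μ f g) (tensor μ f' g') = inner ℝ f f' * inner ℝ g g' :=
  inner_tensorLp f g f' g'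

lemma Represents.tensor {f g : α → ℝ} {F G : Lp ℝ 2 μ} (hf : Represents μ f F)
    (hg : Represents μ g G) :
    Represents (μ.prod μ) (fun z => f z.1 * g z.2) (tensor μ F G) := hf.tensorLp hg

end Tensor

/-! ### Bochner integrals in L² and pointwise integrals. -/

section Bochner

variable {Ω α : Type*} [MeasurableSpace Ω] [MeasurableSpace α] {P : Measure Ω}
  [IsProbabilityMeasure P] {μ : Measure α} [IsProbabilityMeasure μ]
  {V₀ : Ω → α → ℝ} {V : Ω → Lp ℝ 2 μ}

/-- On a probability space the L¹(μ) norm of a path is at most its L²(μ) norm, which is integrable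
in `ω`. -/
lemma Represents.integrable_uncurry (hm : Measurable (Function.uncurry V₀)) (hV : Integrable V P)
    (h : ∀ᵐ ω ∂P, Represents μ (V₀ ω) (V ω)) : Integrable (Function.uncurry V₀) (P.prod μ) := by
  have hi : ∀ F : Lp ℝ 2 μ, Integrable F μ := fun F => (Lp.memLp F).integrable one_le_two
  rw [integrable_prod_iff hm.aestronglyMeasurable]
  constructor
  · filter_upwards [h] with ω hω
    exact (hi (V ω)).congr (EventuallyEq.symm hω)
  · refine hV.norm.mono (hm.aestronglyMeasurable.norm.integral_prod_right') ?_
    filter_upwards [h] with ω hω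
    have h1 : ∫ z, ‖Function.uncurry V₀ (ω, z)‖ ∂μ = ∫ z, ‖V ω z‖ ∂μ :=
      integral_congr_ae (by filter_upwards [hω] with z hz using by simp [hz])
    have h2 : LpBound μ 1 (V ω) ‖V ω‖ := by
      refine LpBound.mono_exponent (q := 2) ⟨Lp.aestronglyMeasurable _, ?_⟩ one_le_two
      rw [Lp.norm_def, ENNReal.ofReal_toReal (Lp.eLpNorm_ne_top _)]
    have h3 : ∫ z, ‖V ω z‖ ∂μ ≤ ‖V ω‖ := by
      have h4 : LpBound μ 1 (fun z => ‖V ω z‖) ‖V ω‖ :=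
        ⟨h2.aesm.norm, (eLpNorm_norm (V ω)).le.trans h2.le⟩
      exact (le_abs_self _).trans (h4.norm_integral_le (norm_nonneg _))
    rw [h1, Real.norm_of_nonneg (integral_nonneg fun z => norm_nonneg _)]
    simpa using h3

/-- The Bochner integral of an `L²`-valued map is represented by the pointwise integral. -/
lemma Represents.integral (hm : Measurable (Function.uncurry V₀)) (hV : Integrable V P)
    (h : ∀ᵐ ω ∂P, Represents μ (V₀ ω) (V ω)) :
    Represents μ (fun z => ∫ ω, V₀ ω z ∂P) (∫ ω, V ω ∂P) := by
  have hint := Represents.integrable_uncurry hm hV h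
  -- It suffices to compare integrals over measurable sets. Pairing with an indicator is a
  -- continuous functional and commutes with the Bochner integral; Fubini treats the pointwise side.
  refine Integrable.ae_eq_of_forall_setIntegral_eq _ _ hint.integral_prod_right
    ((Lp.memLp _).integrable one_le_two) fun s hs hμs => ?_
  rw [← L2.inner_indicatorConstLp_one (𝕜 := ℝ) hs hμs.ne, ← integral_inner hV]
  have h1 : ∫ z in s, ∫ ω, V₀ ω z ∂P ∂μ = ∫ ω, ∫ z in s, V₀ ω z ∂μ ∂P := by
    refine integral_integral_swap (f := fun z ω => V₀ ω z) ?_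
    have h2 : Integrable (Function.uncurry V₀) (P.prod (μ.restrict s)) := by
      rw [← Measure.restrict_univ (μ := P), Measure.prod_restrict]
      exact hint.restrict
    exact h2.swap
  rw [h1]
  refine integral_congr_ae ?_
  filter_upwards [h] with ω hω
  rw [L2.inner_indicatorConstLp_one]
  exact integral_congr_ae (ae_restrict_of_ae hω)

end Bochner

/-! ### The effect of centring by sample means. -/

section StepA

variable {E F G : Type*} [NormedAddCommGroup E] [InnerProductSpace ℝ E] [NormedAddCommGroup F]
  [InnerProductSpace ℝ F] [NormedAddCommGroup G] [InnerProductSpace ℝ G]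

/-- The average of `a_1, …, a_T`. -/
noncomputable def average (T : ℕ) (a : ℤ → E) : E := (T : ℝ)⁻¹ • ∑ j ∈ Finset.Icc (1 : ℤ) T, a j

/-- The centered tensor products built from the sample means. -/
noncomputable def sampleResidual (κ : E →L[ℝ] E →L[ℝ] F) (T : ℕ) (x y : ℤ → E) (j : ℤ) : F :=
  κ (x j - average T x) (y j - average T y) -
    average T fun i => κ (x i - average T x) (y i - average T y)

/-- The random variable which controls the effect of centering by the sample means. -/
noncomputable def controlSum (T : ℕ) (x y : ℤ → E) (ζ : ℤ → F) : ℝ :=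
  T * ‖average T x‖ ^ 2 + T * ‖average T y‖ ^ 2 + T * ‖average T ζ‖ ^ 2 +
    (average T (fun j => ‖x j‖ ^ 2) + average T (fun j => ‖y j‖ ^ 2) +
      average T (fun j => ‖ζ j‖ ^ 2))

lemma average_sub (T : ℕ) (a b : ℤ → E) :
    average T (fun j => a j - b j) = average T a - average T b := by
  simp [average, Finset.sum_sub_distrib, smul_sub]

lemma average_map (T : ℕ) (f : E →L[ℝ] F) (a : ℤ → E) :
    average T (fun j => f (a j)) = f (average T a) := by
  simp [average]

lemma average_const {T : ℕ} (hT : T ≠ 0) (c : E) : average T (fun _ => c) = c := by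
  have : (T : ℝ) ≠ 0 := by exact_mod_cast hT
  simp [average, ← Nat.cast_smul_eq_nsmul ℝ, smul_smul, this]

lemma average_nonneg (T : ℕ) {a : ℤ → ℝ} (h : ∀ j, 0 ≤ a j) : 0 ≤ average T a := by
  unfold average
  exact smul_nonneg (by positivity) (Finset.sum_nonneg fun j _ => h j)

/-- Sample centring cancels constants, so both sequences may be assumed centred at their true means.
-/
lemma sampleResidual_sub_const {T : ℕ} (hT : T ≠ 0) (κ : E →L[ℝ] E →L[ℝ] F) (x y : ℤ → E)
    (m m' : E) (j : ℤ) : sampleResidual κ T (fun j => x j - m) (fun j => y j - m') j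
      = sampleResidual κ T x y j := by
  simp [sampleResidual, average_sub, average_const hT]

/-- Expanding by bilinearity, every term of the correction contains at least one average of `x`, of
`y` or of the centred tensors. -/
lemma sampleResidual_eq {T : ℕ} (hT : T ≠ 0) (κ : E →L[ℝ] E →L[ℝ] F) (x y : ℤ → E) (c : F)
    (j : ℤ) : sampleResidual κ T x y j = (κ (x j) (y j) - c) -
      (κ (average T x) (y j) + κ (x j) (average T y) - (2 : ℝ) • κ (average T x) (average T y) +
        average T fun i => κ (x i) (y i) - c) := by
  have h1 : average T (fun i => κ (x i - average T x) (y i - average T y))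
      = average T (fun i => κ (x i) (y i)) - κ (average T x) (average T y) := by
    have e : average T (fun i => κ (x i) (average T y)) = κ (average T x) (average T y) :=
      average_map T (κ.flip (average T y)) x
    simp only [map_sub, sub_apply]
    rw [average_sub, average_sub, average_sub, average_map T (κ (average T x)) y, e,
      average_const hT]
    simp
  rw [sampleResidual, h1, average_sub, average_const hT, two_smul]
  simp only [map_sub, sub_apply]
  abel

/-- With `s` the control sum, the corrections `r j` have total squared norm O((1 + s)²), without
growth in `T`, while that of `ζ` is at most `T * (1 + s) ^ 2`. The Schur bound on the cross terms is
thus of order `(2 * L + 1) * √T`, which division by `T` makes small. -/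
lemma norm_quadForm_sampleResidual_sub_le {T : ℕ} (hT : T ≠ 0) {w : ℤ → ℝ} {B : ℝ} {L : ℕ}
    (hw : IsBand w B L) (κ : E →L[ℝ] E →L[ℝ] F) (hκ : ∀ x y, ‖κ x y‖ ≤ ‖x‖ * ‖y‖)
    (τ : F →L[ℝ] F →L[ℝ] G) (hτ : ∀ x y, ‖τ x y‖ ≤ ‖x‖ * ‖y‖) (x y : ℤ → E) (c : F) :
    ‖(T : ℝ)⁻¹ • (quadForm τ (Finset.Icc (1 : ℤ) T) w (sampleResidual κ T x y)
      (sampleResidual κ T x y) - quadForm τ (Finset.Icc (1 : ℤ) T) w (fun j => κ (x j) (y j) - c)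
        (fun j => κ (x j) (y j) - c))‖ ≤
      48 * B * ((2 * L + 1) / √T) *
        (1 + controlSum T x y (fun j => κ (x j) (y j) - c)) ^ 2 := by
  set ζ : ℤ → F := fun j => κ (x j) (y j) - c
  set s := controlSum T x y ζ
  set J := Finset.Icc (1 : ℤ) T
  have hJ : (J.card : ℝ) = T := by simp [J]
  have hT1 : (1 : ℝ) ≤ T := by exact_mod_cast Nat.one_le_iff_ne_zero.2 hT
  have hT0 : (0 : ℝ) < T := by linarith
  have hB := hw.nonneg
  set r : ℤ → F := fun j => κ (average T x) (y j) + κ (x j) (average T y) -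
    (2 : ℝ) • κ (average T x) (average T y) + average T ζ
  have hres : sampleResidual κ T x y = fun j => ζ j - r j :=
    funext fun j => sampleResidual_eq hT κ x y c j
  have p1 : 0 ≤ T * ‖average T x‖ ^ 2 := by positivity
  have p2 : 0 ≤ T * ‖average T y‖ ^ 2 := by positivity
  have p3 : 0 ≤ T * ‖average T ζ‖ ^ 2 := by positivity
  have p4 : 0 ≤ average T (fun j => ‖x j‖ ^ 2) := average_nonneg T fun j => by positivity
  have p5 : 0 ≤ average T (fun j => ‖y j‖ ^ 2) := average_nonneg T fun j => by positivity
  have p6 : 0 ≤ average T (fun j => ‖ζ j‖ ^ 2) := average_nonneg T fun j => by positivity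
  have hs : s = T * ‖average T x‖ ^ 2 + T * ‖average T y‖ ^ 2 + T * ‖average T ζ‖ ^ 2 +
    (average T (fun j => ‖x j‖ ^ 2) + average T (fun j => ‖y j‖ ^ 2) +
      average T (fun j => ‖ζ j‖ ^ 2)) := rfl
  have hs0 : 0 ≤ s := by rw [hs]; positivity
  have hav : ∀ a : ℤ → ℝ, ∑ j ∈ J, a j = T * average T a := fun a => by
    rw [average, smul_eq_mul, mul_inv_cancel_left₀ hT0.ne']
  have hζs : √(∑ j ∈ J, ‖ζ j‖ ^ 2) ≤ √T * (1 + s) := by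
    rw [hav, Real.sqrt_mul hT0.le]
    gcongr
    refine Real.sqrt_le_left (by positivity) |>.2 ?_
    nlinarith
  have hr1 : ∀ j, ‖r j‖ ^ 2 ≤ 4 * (‖average T x‖ ^ 2 * ‖y j‖ ^ 2 +
      ‖average T y‖ ^ 2 * ‖x j‖ ^ 2 + 4 * (‖average T x‖ ^ 2 * ‖average T y‖ ^ 2) +
        ‖average T ζ‖ ^ 2) := by
    intro j
    have h1 : ‖r j‖ ≤ ‖average T x‖ * ‖y j‖ + ‖x j‖ * ‖average T y‖ +
        2 * (‖average T x‖ * ‖average T y‖) + ‖average T ζ‖ := by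
      refine (norm_add_le _ _).trans (add_le_add ((norm_sub_le _ _).trans (add_le_add
        ((norm_add_le _ _).trans (add_le_add (hκ _ _) (hκ _ _))) ?_)) le_rfl)
      rw [norm_smul, Real.norm_of_nonneg zero_le_two]
      gcongr
      exact hκ _ _
    refine (pow_le_pow_left₀ (norm_nonneg _) h1 2).trans ?_
    nlinarith [sq_nonneg (‖average T x‖ * ‖y j‖ - ‖x j‖ * ‖average T y‖),
      sq_nonneg (‖average T x‖ * ‖y j‖ - 2 * (‖average T x‖ * ‖average T y‖)),
      sq_nonneg (‖average T x‖ * ‖y j‖ - ‖average T ζ‖),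
      sq_nonneg (‖x j‖ * ‖average T y‖ - 2 * (‖average T x‖ * ‖average T y‖)),
      sq_nonneg (‖x j‖ * ‖average T y‖ - ‖average T ζ‖),
      sq_nonneg (2 * (‖average T x‖ * ‖average T y‖) - ‖average T ζ‖)]
  -- The sum of squares is at most 4(s² + s² + 4 · 4s² + s) before using that products of two
  -- averages carry an extra factor; the sharper count 4(s² + s² + 4s² + s) is what stays below 36(1
  -- + s)².
  have hrs : √(∑ j ∈ J, ‖r j‖ ^ 2) ≤ 6 * (1 + s) := by
    refine Real.sqrt_le_left (by positivity) |>.2 ((Finset.sum_le_sum fun j _ => hr1 j).trans ?_)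
    rw [← Finset.mul_sum, Finset.sum_add_distrib, Finset.sum_add_distrib, Finset.sum_add_distrib,
      ← Finset.mul_sum, ← Finset.mul_sum, Finset.sum_const, Finset.sum_const, hav, hav,
      nsmul_eq_mul, nsmul_eq_mul, hJ]
    have e1 : ‖average T x‖ ^ 2 * (T * average T fun j => ‖y j‖ ^ 2) ≤ s * s := by
      rw [← mul_assoc, mul_comm _ (T : ℝ)]
      exact mul_le_mul (by linarith) (by linarith) p5 hs0
    have e2 : ‖average T y‖ ^ 2 * (T * average T fun j => ‖x j‖ ^ 2) ≤ s * s := by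
      rw [← mul_assoc, mul_comm _ (T : ℝ)]
      exact mul_le_mul (by linarith) (by linarith) p4 hs0
    have e3 : T * (4 * (‖average T x‖ ^ 2 * ‖average T y‖ ^ 2)) ≤ 4 * (s * s) := by
      have : ‖average T y‖ ^ 2 ≤ T * ‖average T y‖ ^ 2 :=
        le_mul_of_one_le_left (by positivity) hT1
      calc _ = 4 * ((T * ‖average T x‖ ^ 2) * ‖average T y‖ ^ 2) := by ring
        _ ≤ 4 * (s * s) := by
          gcongr
          · linarith
          · linarith
    have e4 : T * ‖average T ζ‖ ^ 2 ≤ s := by linarith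
    nlinarith
  have hq : quadForm τ J w (sampleResidual κ T x y) (sampleResidual κ T x y) -
      quadForm τ J w ζ ζ = quadForm τ J w r r - quadForm τ J w r ζ - quadForm τ J w ζ r := by
    rw [hres]
    simp only [quadForm_sub_left, quadForm_sub_right]
    abel
  have hsT : 1 ≤ √(T : ℝ) := Real.one_le_sqrt.2 hT1
  -- The pure correction gives 36 and the two cross terms 12√T; as √T ≥ 1, together at most 48√T.
  have hmain : ‖quadForm τ J w r r - quadForm τ J w r ζ - quadForm τ J w ζ r‖ ≤
      (2 * L + 1) * B * (48 * √T * (1 + s) ^ 2) := by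
    calc _ ≤ ‖quadForm τ J w r r‖ + ‖quadForm τ J w r ζ‖ + ‖quadForm τ J w ζ r‖ :=
          (norm_sub_le _ _).trans (add_le_add (norm_sub_le _ _) le_rfl)
      _ ≤ (2 * L + 1) * B * ((6 * (1 + s)) * (6 * (1 + s))) +
          (2 * L + 1) * B * ((6 * (1 + s)) * (√T * (1 + s))) +
          (2 * L + 1) * B * ((√T * (1 + s)) * (6 * (1 + s))) := by
          refine add_le_add (add_le_add ?_ ?_) ?_
          · exact (hw.norm_quadForm_le τ hτ J r r).trans (by gcongr)
          · exact (hw.norm_quadForm_le τ hτ J r ζ).trans (by gcongr)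
          · exact (hw.norm_quadForm_le τ hτ J ζ r).trans (by gcongr)
      _ = (2 * L + 1) * B * ((36 + 12 * √T) * (1 + s) ^ 2) := by ring
      _ ≤ _ := by
          gcongr
          linarith
  rw [hq, norm_smul, norm_inv, Real.norm_of_nonneg hT0.le]
  calc _ ≤ (T : ℝ)⁻¹ * ((2 * L + 1) * B * (48 * √T * (1 + s) ^ 2)) := by gcongr
    _ = 48 * B * ((2 * L + 1) / √T) * (1 + s) ^ 2 := by
        have e : (T : ℝ)⁻¹ * √T = (√T)⁻¹ := by
          nth_rw 1 [← Real.mul_self_sqrt hT0.le]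
          field_simp
        rw [div_eq_mul_inv, ← e]
        ring

end StepA

/-! ### Moment bounds for the control variable and convergence in probability. -/

section Markov

variable {Ω : Type*} [MeasurableSpace Ω] {P : Measure Ω} {E F : Type*} [NormedAddCommGroup E]
  [InnerProductSpace ℝ E] [NormedAddCommGroup F] [InnerProductSpace ℝ F]

lemma LpBound.norm_sq {f : Ω → E} {s : ℝ} (hf : LpBound P 2 f s) (hs : 0 ≤ s) :
    LpBound P 1 (fun ω => ‖f ω‖ ^ 2) (s ^ 2) := by
  have h := hf.bilin hf (r := 1) (innerSL ℝ) (fun x y => norm_inner_le_norm x y) hs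
  rw [sq s]
  exact h.congr (ae_of_all _ fun ω => real_inner_self_eq_norm_sq _)

lemma LpBound.average {T : ℕ} (hT : T ≠ 0) {f : ℤ → Ω → E} {s : ℝ} (hs : 0 ≤ s)
    (hf : ∀ j, LpBound P 1 (f j) s) : LpBound P 1 (fun ω => FTS.average T fun j => f j ω) s := by
  have hT0 : (0 : ℝ) < T := by exact_mod_cast Nat.pos_of_ne_zero hT
  refine ((LpBound.sum (fun j _ => hf j) le_rfl fun _ _ => hs).const_smul (T : ℝ)⁻¹).mono ?_
  rw [Finset.sum_const, abs_of_nonneg (by positivity), Int.card_Icc, nsmul_eq_mul]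
  simp [hT0.ne']

lemma LpBound.mul_norm_average_sq {T : ℕ} (hT : T ≠ 0) {f : ℤ → Ω → E} {s : ℝ} (hs : 0 ≤ s)
    (hf : LpBound P 2 (fun ω => ∑ j ∈ Finset.Icc (1 : ℤ) T, f j ω) (√(T * s))) :
    LpBound P 1 (fun ω => T * ‖FTS.average T fun j => f j ω‖ ^ 2) s := by
  have hT0 : (0 : ℝ) < T := by exact_mod_cast Nat.pos_of_ne_zero hT
  have h := ((hf.const_smul (T : ℝ)⁻¹).norm_sq (by positivity)).const_smul (T : ℝ)
  refine h.mono (le_of_eq ?_)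
  rw [abs_of_pos hT0, abs_of_pos (by positivity), mul_pow, Real.sq_sqrt (by positivity)]
  field_simp

lemma LpBound.controlSum {T : ℕ} (hT : T ≠ 0) {x y : ℤ → Ω → E} {ζ : ℤ → Ω → F} {s c : ℝ}
    (hs : 0 ≤ s) (hc : 0 ≤ c) (hx : ∀ j, LpBound P 2 (x j) s) (hy : ∀ j, LpBound P 2 (y j) s)
    (hζ : ∀ j, LpBound P 2 (ζ j) s)
    (hxs : LpBound P 2 (fun ω => ∑ j ∈ Finset.Icc (1 : ℤ) T, x j ω) (√(T * c)))
    (hys : LpBound P 2 (fun ω => ∑ j ∈ Finset.Icc (1 : ℤ) T, y j ω) (√(T * c)))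
    (hζs : LpBound P 2 (fun ω => ∑ j ∈ Finset.Icc (1 : ℤ) T, ζ j ω) (√(T * c))) :
    LpBound P 1 (fun ω => FTS.controlSum T (fun j => x j ω) (fun j => y j ω) (fun j => ζ j ω))
      (3 * c + 3 * s ^ 2) := by
  have a1 := LpBound.mul_norm_average_sq hT hc hxs
  have a2 := LpBound.mul_norm_average_sq hT hc hys
  have a3 := LpBound.mul_norm_average_sq hT hc hζs
  have b1 := LpBound.average hT (sq_nonneg s) fun j => (hx j).norm_sq hs
  have b2 := LpBound.average hT (sq_nonneg s) fun j => (hy j).norm_sq hs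
  have b3 := LpBound.average hT (sq_nonneg s) fun j => (hζ j).norm_sq hs
  refine (((a1.add a2 le_rfl hc hc).add a3 le_rfl (by positivity) hc).add
    ((b1.add b2 le_rfl (by positivity) (by positivity)).add b3 le_rfl (by positivity)
      (by positivity)) le_rfl (by positivity) (by positivity)).mono (by linarith)

lemma controlSum_nonneg (T : ℕ) (x y : ℤ → E) (ζ : ℤ → F) : 0 ≤ controlSum T x y ζ := by
  have p4 : 0 ≤ average T (fun j => ‖x j‖ ^ 2) := average_nonneg T fun j => by positivity
  have p5 : 0 ≤ average T (fun j => ‖y j‖ ^ 2) := average_nonneg T fun j => by positivity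
  have p6 : 0 ≤ average T (fun j => ‖ζ j‖ ^ 2) := average_nonneg T fun j => by positivity
  unfold controlSum
  positivity

/-- Markov's inequality twice: `R T` is small in L¹, and `s T`, bounded in L¹, lies below a constant
`K` with probability close to one, where `c T * (1 + K) ^ 2` is negligible. No measurability of `Z`
is needed. -/
lemma isLittleOP_of_le {Z : ℕ → Ω → ℝ≥0∞} {R : ℕ → Ω → F} {s : ℕ → Ω → ℝ} {c : ℕ → ℝ} {M : ℝ}
    (hZ : ∀ᶠ T in atTop, ∀ᵐ ω ∂P,
      Z T ω ≤ ‖R T ω‖ₑ + ENNReal.ofReal (c T * (1 + s T ω) ^ 2))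
    (hRm : ∀ᶠ T in atTop, AEStronglyMeasurable (R T) P)
    (hR : Tendsto (fun T => eLpNorm (R T) 1 P) atTop (𝓝 0)) (hc : Tendsto c atTop (𝓝 0))
    (hc0 : ∀ᶠ T in atTop, 0 ≤ c T) (hs : ∀ᶠ T in atTop, LpBound P 1 (s T) M)
    (hs0 : ∀ T ω, 0 ≤ s T ω) : IsLittleOP P Z := by
  intro δ hδ
  rw [ENNReal.tendsto_nhds_zero]
  intro η hη
  have hη2 : 0 < η / 2 := ENNReal.half_pos hη.ne'
  have hδ2 : 0 < ENNReal.ofReal (δ / 2) := ENNReal.ofReal_pos.2 (by positivity)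
  obtain ⟨K, hK0, hK⟩ : ∃ K : ℝ, 0 < K ∧ ENNReal.ofReal M / ENNReal.ofReal K ≤ η / 2 := by
    have h1 : Tendsto (fun K : ℝ => ENNReal.ofReal M / ENNReal.ofReal K) atTop (𝓝 0) := by
      have h2 := ENNReal.Tendsto.const_div (a := ENNReal.ofReal M) ENNReal.tendsto_ofReal_atTop
        (Or.inr ENNReal.ofReal_ne_top)
      rwa [ENNReal.div_top] at h2
    exact ((eventually_gt_atTop 0).and (ENNReal.tendsto_nhds_zero.1 h1 _ hη2)).exists
  have hR' : ∀ᶠ T in atTop, eLpNorm (R T) 1 P / ENNReal.ofReal (δ / 2) ≤ η / 2 := by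
    have h2 := ENNReal.Tendsto.div_const hR (b := ENNReal.ofReal (δ / 2)) (Or.inr hδ2.ne')
    rw [ENNReal.zero_div] at h2
    exact ENNReal.tendsto_nhds_zero.1 h2 _ hη2
  have hc' : ∀ᶠ T in atTop, c T * (1 + K) ^ 2 < δ / 2 := by
    have h2 := hc.mul_const ((1 + K) ^ 2)
    rw [zero_mul] at h2
    exact h2.eventually_lt_const (by positivity)
  filter_upwards [hZ, hRm, hR', hc', hc0, hs] with T h1 h2 h3 h4 h5 h6
  have hsub : {ω | ENNReal.ofReal δ ≤ Z T ω} ≤ᵐ[P]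
      ({ω | ENNReal.ofReal (δ / 2) ≤ ‖R T ω‖ₑ} ∪ {ω | ENNReal.ofReal K ≤ ‖s T ω‖ₑ} : Set Ω) := by
    filter_upwards [h1] with ω hω hle
    by_contra hcon
    have hcon' : ¬ (ENNReal.ofReal (δ / 2) ≤ ‖R T ω‖ₑ ∨ ENNReal.ofReal K ≤ ‖s T ω‖ₑ) := hcon
    rw [not_or, not_le, not_le] at hcon'
    obtain ⟨c1, c2⟩ := hcon'
    rw [← ofReal_norm, ENNReal.ofReal_lt_ofReal_iff hK0, Real.norm_of_nonneg (hs0 T ω)] at c2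
    have c3 : c T * (1 + s T ω) ^ 2 ≤ c T * (1 + K) ^ 2 := by
      have := hs0 T ω
      gcongr
    have c4 : ENNReal.ofReal δ < ENNReal.ofReal (δ / 2) + ENNReal.ofReal (δ / 2) :=
      ((show ENNReal.ofReal δ ≤ Z T ω from hle).trans hω).trans_lt (ENNReal.add_lt_add c1
        ((ENNReal.ofReal_lt_ofReal_iff (by positivity)).2 (c3.trans_lt h4)))
    rw [← ENNReal.ofReal_add (by positivity) (by positivity), add_halves] at c4
    exact lt_irrefl _ c4
  calc P {ω | ENNReal.ofReal δ ≤ Z T ω} ≤ _ := measure_mono_ae hsub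
    _ ≤ _ := measure_union_le _ _
    _ ≤ eLpNorm (R T) 1 P / ENNReal.ofReal (δ / 2) + ENNReal.ofReal M / ENNReal.ofReal K := by
        refine add_le_add ?_ ?_
        · rw [eLpNorm_one_eq_lintegral_enorm]
          exact meas_ge_le_lintegral_div h2.enorm hδ2.ne' ENNReal.ofReal_ne_top
        · refine (meas_ge_le_lintegral_div h6.aesm.enorm (ENNReal.ofReal_pos.2 hK0).ne'
            ENNReal.ofReal_ne_top).trans ?_
          rw [← eLpNorm_one_eq_lintegral_enorm]
          gcongr
          exact h6.le
    _ ≤ η / 2 + η / 2 := add_le_add h3 hK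
    _ = η := ENNReal.add_halves η

end Markov

/-! ### The lag window as a band. -/

section Weight

variable {W : ℝ → ℝ} {b : ℝ}

/-- The finite limit of the quotient times |x|^b → 0 forces W → 1 at the origin; continuity does the
rest. -/
lemma IsWeightFunction.apply_zero (hW : IsWeightFunction W b) : W 0 = 1 := by
  obtain ⟨k, -, hk⟩ := hW.order
  have h1 : Tendsto (fun x : ℝ => |x| ^ b) (𝓝[≠] 0) (𝓝 0) := by
    have : Tendsto (fun x : ℝ => |x| ^ b) (𝓝 0) (𝓝 (|0| ^ b)) :=
      (continuous_abs.rpow_const fun _ => Or.inr hW.order_pos.le).tendsto 0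
    rw [abs_zero, Real.zero_rpow hW.order_pos.ne'] at this
    exact this.mono_left nhdsWithin_le_nhds
  have h2 := hk.mul h1
  rw [mul_zero] at h2
  have h3 : Tendsto (fun x => 1 - W x) (𝓝[≠] 0) (𝓝 0) := by
    refine h2.congr' ?_
    filter_upwards [self_mem_nhdsWithin] with x hx
    have : |x| ^ b ≠ 0 := (Real.rpow_pos_of_pos (abs_pos.2 hx) b).ne'
    field_simp
  have h4 : Tendsto (fun x => 1 - W x) (𝓝[≠] 0) (𝓝 (1 - W 0)) :=
    ((hW.continuous.tendsto 0).const_sub 1).mono_left nhdsWithin_le_nhds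
  have := tendsto_nhds_unique h3 h4
  linarith

/-- The lag window, evaluated at the lags of a sample of size `T`, is a band of width `O(h)`. -/
lemma IsWeightFunction.exists_band (hW : IsWeightFunction W b) {h : ℕ → ℝ}
    (h_top : Tendsto h atTop atTop)
    (h_rate : Tendsto (fun T : ℕ => h T / (T : ℝ) ^ (1 / 2 : ℝ)) atTop (𝓝 0)) :
    ∃ (B : ℝ) (L : ℕ → ℕ), (∀ᶠ T in atTop, IsBand (fun d : ℤ => W (d / h T)) B (L T)) ∧
      (∀ d : ℤ, Tendsto (fun T => W (d / h T)) atTop (𝓝 1)) ∧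
      Tendsto (fun T : ℕ => (2 * L T + 1) / √(T : ℝ)) atTop (𝓝 0) := by
  obtain ⟨B, hB⟩ := hW.continuous.bounded_above_of_compact_support hW.compactSupport
  obtain ⟨R, hR0, hR⟩ := hW.compactSupport.isCompact.isBounded.subset_closedBall_lt 0 0
  -- `W` vanishes outside the ball of radius `R`, so a lag `d` has weight zero once |d| > R h.
  refine ⟨B, fun T => ⌈R * h T⌉₊, ?_, fun d => ?_, ?_⟩
  · filter_upwards [h_top.eventually_gt_atTop 0] with T hT
    refine ⟨(norm_nonneg _).trans (hB 0), fun d => hB _, fun d hd => ?_⟩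
    by_contra hne
    have h1 := hR (subset_tsupport _ hne)
    rw [Metric.mem_closedBall, dist_zero_right, Real.norm_eq_abs, abs_div, abs_of_pos hT,
      div_le_iff₀ hT] at h1
    have h2 : (⌈R * h T⌉₊ : ℝ) < |(d : ℝ)| := by exact_mod_cast hd
    linarith [Nat.le_ceil (R * h T)]
  · have h1 : Tendsto (fun T => (d : ℝ) / h T) atTop (𝓝 0) := h_top.const_div_atTop _
    have h2 := (hW.continuous.tendsto 0).comp h1
    rw [hW.apply_zero] at h2
    exact h2
  · have hs : Tendsto (fun T : ℕ => (√(T : ℝ))⁻¹) atTop (𝓝 0) :=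
      (Real.tendsto_sqrt_atTop.comp tendsto_natCast_atTop_atTop).inv_tendsto_atTop
    have hu := (h_rate.const_mul (2 * R)).add (hs.const_mul 3)
    simp only [mul_zero, add_zero] at hu
    refine squeeze_zero' (Eventually.of_forall fun T => by positivity) ?_ hu
    filter_upwards [h_top.eventually_gt_atTop 0] with T hT
    rw [← Real.sqrt_eq_rpow]
    have h1 : (⌈R * h T⌉₊ : ℝ) ≤ R * h T + 1 := (Nat.ceil_lt_add_one (by positivity)).le
    calc (2 * (⌈R * h T⌉₊ : ℝ) + 1) / √(T : ℝ) ≤ (2 * (R * h T + 1) + 1) / √(T : ℝ) := by gcongr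
      _ = _ := by ring

end Weight

/-! ### The estimator as a quadratic form in L². -/

section Estimator

variable {Ω : Type*} {X Y : ℤ → Ω → I → ℝ} {W : ℝ → ℝ} {h : ℕ → ℝ}

lemma sampleAutocov_eq (X Y : ℤ → Ω → I → ℝ) (T : ℕ) (ω : Ω) (ℓ : ℤ) (t s u v : I) :
    sampleAutocov X Y T ω ℓ t s u v = (T : ℝ)⁻¹ * ∑ j ∈ lagSet T ℓ,
      residual X Y T ω j t s * residual X Y T ω (j + ℓ) u v := by
  unfold sampleAutocov
  split_ifs with hℓ
  · rw [lagSet_eq_of_nonneg T hℓ, one_div]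
  · rw [lagSet_eq_of_neg T (not_le.1 hℓ), one_div]

/-- Empirical autocovariances vanish at lags of modulus at least `T`, so the series is finite, and
grouping pairs by lag is reversed. -/
lemma estimator_eq (X Y : ℤ → Ω → I → ℝ) (W : ℝ → ℝ) (h : ℕ → ℝ) (T : ℕ) (ω : Ω)
    (t s u v : I) : estimator X Y W h T ω t s u v = (T : ℝ)⁻¹ * ∑ j ∈ Finset.Icc (1 : ℤ) T,
      ∑ k ∈ Finset.Icc (1 : ℤ) T, W ((k - j : ℤ) / h T) *
        (residual X Y T ω j t s * residual X Y T ω k u v) := by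
  rw [sum_sum_eq_sum_lagSet, estimator, tsum_eq_sum (s := Finset.Ioo (-T : ℤ) T), Finset.mul_sum]
  · refine Finset.sum_congr rfl fun d _ => ?_
    rw [sampleAutocov_eq]
    simp only [add_sub_cancel_left]
    rw [← Finset.mul_sum]
    ring
  · intro d hd
    rw [sampleAutocov_eq, lagSet_eq_empty hd]
    simp

lemma represents_residual {T : ℕ} {ω : Ω} {x y : ℤ → L2}
    (hX : ∀ j, Represents volume (X j ω) (x j)) (hY : ∀ j, Represents volume (Y j ω) (y j))
    (j : ℤ) : Represents (volume.prod volume) (fun z : I × I => residual X Y T ω j z.1 z.2)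
      (sampleResidual (tensor volume) T x y j) := by
  have hx : ∀ j, Represents volume (fun t => X j ω t - sampleMean X T ω t) (x j - average T x) := by
    intro j
    unfold sampleMean average
    simp only [one_div]
    exact (hX j).sub ((Represents.sum fun i _ => hX i).const_mul _)
  have hy : ∀ j, Represents volume (fun t => Y j ω t - sampleMean Y T ω t) (y j - average T y) := by
    intro j
    unfold sampleMean average
    simp only [one_div]
    exact (hY j).sub ((Represents.sum fun i _ => hY i).const_mul _)
  unfold residual sampleCrossCov sampleResidual
  simp only [one_div]
  exact ((hx j).tensor (hy j)).sub
    ((Represents.sum fun i _ => (hx i).tensor (hy i)).const_mul _)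

lemma represents_estimator {T : ℕ} {ω : Ω} {x y : ℤ → L2}
    (hX : ∀ j, Represents volume (X j ω) (x j)) (hY : ∀ j, Represents volume (Y j ω) (y j)) :
    Represents ((volume.prod volume).prod (volume.prod volume))
      (fun z : (I × I) × (I × I) => estimator X Y W h T ω z.1.1 z.1.2 z.2.1 z.2.2)
      ((T : ℝ)⁻¹ • quadForm (tensor (volume.prod volume)) (Finset.Icc (1 : ℤ) T)
        (fun d => W (d / h T)) (sampleResidual (tensor volume) T x y)
          (sampleResidual (tensor volume) T x y)) := by
  simp only [estimator_eq]
  have hr := fun j => represents_residual (T := T) hX hY j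
  exact (Represents.sum fun j _ => Represents.sum fun k _ =>
    ((hr j).tensor (hr k)).const_mul _).const_mul _

end Estimator

/-! ### Passage between [0,1]⁴ and ([0,1]²)². -/

section Rearrange

/-- The rearrangement `(t, s, u, v) ↦ ((t, s), (u, v))` preserves Lebesgue measure. -/
lemma measurePreserving_assoc :
    MeasurePreserving (fun z : I × I × I × I => ((z.1, z.2.1), (z.2.2.1, z.2.2.2)))
      volume ((volume.prod volume).prod (volume.prod volume)) :=
  (volume_preserving_prodAssoc (α₁ := I) (β₁ := I) (γ₁ := I × I)).symm

lemma norm4_eq_of_represents {f : I → I → I → I → ℝ}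
    {F : Lp ℝ 2 (((volume : Measure I).prod volume).prod (volume.prod volume))}
    (h : Represents _ (fun z : (I × I) × (I × I) => f z.1.1 z.1.2 z.2.1 z.2.2) F) :
    norm4 f = ‖F‖ₑ := by
  have hm : AEStronglyMeasurable (fun z : (I × I) × (I × I) => f z.1.1 z.1.2 z.2.1 z.2.2)
      (((volume : Measure I).prod volume).prod (volume.prod volume)) :=
    (Lp.aestronglyMeasurable F).congr (EventuallyEq.symm h)
  rw [Lp.enorm_def, ← eLpNorm_congr_ae h, ← eLpNorm_comp_measurePreserving hm
    measurePreserving_assoc]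
  rfl

lemma memLp_uncurry4_of_represents {f : I → I → I → I → ℝ}
    {F : Lp ℝ 2 (((volume : Measure I).prod volume).prod (volume.prod volume))}
    (h : Represents _ (fun z : (I × I) × (I × I) => f z.1.1 z.1.2 z.2.1 z.2.2) F) :
    MemLp (uncurry4 f) 2 volume :=
  ((memLp_congr_ae h).2 (Lp.memLp F)).comp_measurePreserving measurePreserving_assoc

end Rearrange

/-! ### Fourth moments and separability. -/

section Moments

variable {Ω : Type*} [MeasurableSpace Ω] {P : Measure Ω} [IsProbabilityMeasure P]
  {E : Type*} [NormedAddCommGroup E] [NormedSpace ℝ E]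

instance holderTriple_four_four_two : ENNReal.HolderTriple 4 4 2 where
  inv_add_inv_eq_inv := by
    have h : (4 : ℝ≥0∞) = 2 * 2 := by norm_num
    rw [h, ENNReal.mul_inv (by simp) (by simp), ← two_mul, ← mul_assoc,
      ENNReal.mul_inv_cancel two_ne_zero ENNReal.ofNat_ne_top, one_mul]

/-- On a probability space Lᵖ norms increase with the exponent, so moments of order `p > 4` give
fourth moments, which put tensor products in L². -/
lemma lpBound_four_of_lintegral_le {f : Ω → E} {N : Ω → ℝ≥0∞} {p s : ℝ}
    (hf : AEStronglyMeasurable f P) (hN : ∀ᵐ ω ∂P, N ω = ‖f ω‖ₑ) (hp : 4 < p)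
    (h : (∫⁻ ω, N ω ^ p ∂P) ^ (1 / p) ≤ ENNReal.ofReal s) : LpBound P 4 f s := by
  have hp0 : 0 < p := by linarith
  have h4 : (4 : ℝ≥0∞) ≤ ENNReal.ofReal p := by
    rw [show (4 : ℝ≥0∞) = ENNReal.ofReal 4 by simp]
    exact ENNReal.ofReal_le_ofReal hp.le
  refine LpBound.mono_exponent (q := ENNReal.ofReal p) ⟨hf, ?_⟩ h4
  rw [eLpNorm_eq_lintegral_rpow_enorm_toReal (by simpa using hp0) ENNReal.ofReal_ne_top,
    ENNReal.toReal_ofReal hp0.le]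
  refine le_trans (le_of_eq ?_) h
  congr 1
  refine lintegral_congr_ae ?_
  filter_upwards [hN] with ω hω
  rw [hω]

end Moments

section Separable

instance fact_two_ne_top : Fact ((2 : ℝ≥0∞) ≠ ∞) := ⟨ENNReal.ofNat_ne_top⟩

/-- Separability of the measure makes L² second countable, as the measurability and independence
lemmas require. -/
lemma isSeparable_prod {α β : Type*} [MeasurableSpace α] [MeasurableSpace β] (μ : Measure α)
    (ν : Measure β) [SFinite μ] [SFinite ν] [MeasurableSpace.CountablyGenerated α]
    [MeasurableSpace.CountablyGenerated β] : IsSeparable (μ.prod ν) := inferInstance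

instance isSeparable_unitSquare : IsSeparable ((volume : Measure I).prod (volume : Measure I)) :=
  isSeparable_prod _ _

end Separable

/-! ### Weakly dependent pairs give approximable sequences. -/

section Model

variable {Ω S : Type*} [MeasurableSpace Ω] [MeasurableSpace S] {P : Measure Ω}
  [IsProbabilityMeasure P] {X Y : ℤ → Ω → I → ℝ} {ε : ℤ → Ω → S} {εs : ℕ → ℤ → Ω → S}
  {g : (ℕ → S) → L2 × L2} {p α β : ℝ}

lemma norm1_eq_enorm {f : I → ℝ} {F : L2} (h : Represents volume f F) : norm1 f = ‖F‖ₑ := by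
  rw [norm1, Lp.enorm_def]
  exact eLpNorm_congr_ae h

/-- A coupling bound for one of the two components, at a common rate. -/
lemma exists_coupling_bound {Z : ℤ → Ω → I → ℝ} {G : (ℕ → S) → L2} (hG : StronglyMeasurable G)
    (hε : ∀ i, Measurable (ε i)) (hεs : ∀ m, 1 ≤ m → ∀ i, Measurable (εs m i)) (hp : 4 < p)
    (hZ : ∀ᵐ ω ∂P, Z 0 ω =ᵐ[volume] G (past ε 0 ω)) {γ : ℝ} (hγ : γ ≤ α)
    (hmom : ∫⁻ ω, norm1 (Z 0 ω) ^ p ∂P < ∞)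
    (happrox : ∃ C : ℝ, ∀ m : ℕ, 1 ≤ m →
      (∫⁻ ω, norm1 (fun t => Z 0 ω t - G (coupledPast ε εs m 0 ω) t) ^ p ∂P) ^ (1 / p)
        ≤ ENNReal.ofReal (C * (m : ℝ) ^ (-α))) :
    ∃ M C : ℝ, 0 ≤ M ∧ 0 ≤ C ∧ LpBound P 4 (fun ω => G (past ε 0 ω)) M ∧
      ∀ m : ℕ, 1 ≤ m → LpBound P 4 (fun ω => G (past ε 0 ω) - G (coupledPast ε εs m 0 ω))
        (C * (m : ℝ) ^ (-γ)) := by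
  obtain ⟨C, hC⟩ := happrox
  have hG0 : AEStronglyMeasurable (fun ω => G (past ε 0 ω)) P :=
    (hG.comp_measurable (measurable_past hε 0)).aestronglyMeasurable
  have hGm : ∀ m, 1 ≤ m → AEStronglyMeasurable (fun ω => G (coupledPast ε εs m 0 ω)) P :=
    fun m hm => (hG.comp_measurable ((measurable_splice m).comp
      ((measurable_past hε 0).prodMk (measurable_past (hεs m hm) 0)))).aestronglyMeasurable
  refine ⟨((∫⁻ ω, norm1 (Z 0 ω) ^ p ∂P) ^ (1 / p)).toReal, max C 0, ENNReal.toReal_nonneg,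
    le_max_right _ _, ?_, fun m hm => ?_⟩
  · refine lpBound_four_of_lintegral_le (N := fun ω => norm1 (Z 0 ω)) hG0 ?_ hp ?_
    · filter_upwards [hZ] with ω hω using norm1_eq_enorm hω
    · rw [ENNReal.ofReal_toReal]
      exact ENNReal.rpow_ne_top_of_nonneg (by positivity) hmom.ne
  · refine lpBound_four_of_lintegral_le
      (N := fun ω => norm1 (fun t => Z 0 ω t - G (coupledPast ε εs m 0 ω) t))
      (hG0.sub (hGm m hm)) ?_ hp ((hC m hm).trans (ENNReal.ofReal_le_ofReal ?_))
    · filter_upwards [hZ] with ω hω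
      exact norm1_eq_enorm (Represents.sub hω EventuallyEq.rfl)
    · have hm1 : (1 : ℝ) ≤ m := by exact_mod_cast hm
      gcongr
      exact le_max_left _ _

/-- The coupling bound for tensor products of affinely shifted components. -/
lemma coupling_bound_tensor {U V : Type*} [NormedAddCommGroup U] [InnerProductSpace ℝ U]
    [NormedAddCommGroup V] [InnerProductSpace ℝ V] (κ : U →L[ℝ] U →L[ℝ] V)
    (hκ : ∀ x y, ‖κ x y‖ ≤ ‖x‖ * ‖y‖) {A B : (ℕ → S) → U} {M C N D γ : ℝ}
    (hM : 0 ≤ M) (hC : 0 ≤ C) (hN : 0 ≤ N) (hD : 0 ≤ D) (hγ : 0 ≤ γ) (a b : U)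
    (hA : LpBound P 4 (fun ω => A (past ε 0 ω)) M)
    (hB : LpBound P 4 (fun ω => B (past ε 0 ω)) N)
    (hAc : ∀ m : ℕ, 1 ≤ m → LpBound P 4 (fun ω => A (past ε 0 ω) - A (coupledPast ε εs m 0 ω))
        (C * (m : ℝ) ^ (-γ)))
    (hBc : ∀ m : ℕ, 1 ≤ m → LpBound P 4 (fun ω => B (past ε 0 ω) - B (coupledPast ε εs m 0 ω))
        (D * (m : ℝ) ^ (-γ))) :
    LpBound P 2 (fun ω => κ (A (past ε 0 ω) - a) (B (past ε 0 ω) - b))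
      ((M + ‖a‖) * (N + ‖b‖)) ∧
    ∀ m : ℕ, 1 ≤ m → LpBound P 2 (fun ω => κ (A (past ε 0 ω) - a) (B (past ε 0 ω) - b) -
      κ (A (coupledPast ε εs m 0 ω) - a) (B (coupledPast ε εs m 0 ω) - b))
        ((C * (N + ‖b‖) + (M + C + ‖a‖) * D) * (m : ℝ) ^ (-γ)) := by
  have h4 : (1 : ℝ≥0∞) ≤ 4 := by norm_num
  have hA' := hA.sub (LpBound.const a) h4 hM (norm_nonneg _)
  have hB' := hB.sub (LpBound.const b) h4 hN (norm_nonneg _)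
  refine ⟨hA'.bilin hB' κ hκ (by positivity), fun m hm => ?_⟩
  have hm1 : (m : ℝ) ^ (-γ) ≤ 1 := Real.rpow_le_one_of_one_le_of_nonpos (by exact_mod_cast hm)
    (by linarith)
  have hA2 : LpBound P 4 (fun ω => A (coupledPast ε εs m 0 ω) - a) (M + C + ‖a‖) := by
    refine (((hA.sub (hAc m hm) h4 hM (by positivity)).sub (LpBound.const a) h4 (by positivity)
      (norm_nonneg _)).mono ?_).congr (ae_of_all _ fun ω => by simp)
    gcongr
    exact mul_le_of_le_one_right hC hm1
  have h1 := (hAc m hm).bilin hB' (r := 2) κ hκ (by positivity)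
  have h2 := hA2.bilin (hBc m hm) (r := 2) κ hκ (by positivity)
  refine ((h1.add h2 one_le_two (by positivity) (by positivity)).mono (le_of_eq (by ring))).congr
    (ae_of_all _ fun ω => ?_)
  simp only [map_sub, sub_apply]
  abel

lemma WeaklyDependent.stronglyMeasurable_g (hXY : WeaklyDependent P X Y ε εs g p α β) :
    StronglyMeasurable g := by
  let _ : MeasurableSpace (L2 × L2) := borel _
  have : BorelSpace (L2 × L2) := ⟨rfl⟩
  have : SecondCountableTopology L2 := inferInstance
  have : SecondCountableTopology (L2 × L2) := inferInstance
  have hm : Measurable g := hXY.measurable_g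
  exact hm.stronglyMeasurable

/-- The mean of the Bernoulli shift `X` in `L²`. -/
noncomputable def meanLp (P : Measure Ω) (ε : ℤ → Ω → S) {E : Type*} [NormedAddCommGroup E]
    [NormedSpace ℝ E] (G : (ℕ → S) → E) : E := ∫ ω, G (past ε 0 ω) ∂P

/-- The tensor product of the centered components. -/
noncomputable def tensorShift (P : Measure Ω) (ε : ℤ → Ω → S) (g : (ℕ → S) → L2 × L2)
    (e : ℕ → S) : Lp ℝ 2 ((volume : Measure I).prod (volume : Measure I)) :=
  tensor volume ((g e).1 - meanLp P ε fun e => (g e).1) ((g e).2 - meanLp P ε fun e => (g e).2)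

/-- The three sequences to which the limit theory is applied: the two components and the centered
tensor products. -/
lemma WeaklyDependent.exists_approximable (hXY : WeaklyDependent P X Y ε εs g p α β)
    [MeasurableSpace L2] [BorelSpace L2]
    [MeasurableSpace (Lp ℝ 2 ((volume : Measure I).prod (volume : Measure I)))]
    [BorelSpace (Lp ℝ 2 ((volume : Measure I).prod (volume : Measure I)))] :
    StronglyMeasurable (tensorShift P ε g) ∧ ∃ M C γ : ℝ,
      LpBound P 2 (fun ω => (g (past ε 0 ω)).1) M ∧ LpBound P 2 (fun ω => (g (past ε 0 ω)).2) M ∧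
      LpBound P 2 (fun ω => tensorShift P ε g (past ε 0 ω)) M ∧
      Approximable P ε (fun j ω => (g (past ε j ω)).1 - meanLp P ε fun e => (g e).1) M C γ ∧
      Approximable P ε (fun j ω => (g (past ε j ω)).2 - meanLp P ε fun e => (g e).2) M C γ ∧
      Approximable P ε (fun j ω => tensorShift P ε g (past ε j ω) - meanLp P ε (tensorShift P ε g))
        M C γ := by
  have hg := hXY.stronglyMeasurable_g
  have hg1 : StronglyMeasurable fun e => (g e).1 := continuous_fst.comp_stronglyMeasurable hg
  have hg2 : StronglyMeasurable fun e => (g e).2 := continuous_snd.comp_stronglyMeasurable hg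
  have hts : StronglyMeasurable (tensorShift P ε g) :=
    (tensor (volume : Measure I)).continuous₂.comp_stronglyMeasurable
      ((hg1.sub stronglyMeasurable_const).prodMk (hg2.sub stronglyMeasurable_const))
  refine ⟨hts, ?_⟩
  -- The tensor product inherits the slower of the two rates; a common rate and common constants
  -- serve all three sequences.
  have hγ : 1 < min α β := lt_min hXY.one_lt_α hXY.one_lt_β
  obtain ⟨M₁, C₁, hM₁, hC₁, b₁, c₁⟩ := exists_coupling_bound hg1 hXY.measurable_ε hXY.measurable_εs
    hXY.four_lt_p (hXY.X_eq 0) (min_le_left α β) hXY.moment_X (hXY.approx_X 0)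
  obtain ⟨M₂, C₂, hM₂, hC₂, b₂, c₂⟩ := exists_coupling_bound hg2 hXY.measurable_ε hXY.measurable_εs
    hXY.four_lt_p (hXY.Y_eq 0) (min_le_right α β) hXY.moment_Y (hXY.approx_Y 0)
  obtain ⟨b₃, c₃⟩ := coupling_bound_tensor (P := P) (ε := ε) (εs := εs)
    (A := fun e => (g e).1) (B := fun e => (g e).2) (tensor (volume : Measure I))
    (norm_bilin_le inner_tensor) hM₁ hC₁ hM₂ hC₂
    (show 0 ≤ min α β by linarith)
    (meanLp P ε fun e => (g e).1) (meanLp P ε fun e => (g e).2) b₁ b₂ c₁ c₂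
  set M₃ : ℝ := (M₁ + ‖meanLp P ε fun e => (g e).1‖) * (M₂ + ‖meanLp P ε fun e => (g e).2‖)
  set C₃ : ℝ := C₁ * (M₂ + ‖meanLp P ε fun e => (g e).2‖) +
    (M₁ + C₁ + ‖meanLp P ε fun e => (g e).1‖) * C₂
  have hM₃ : 0 ≤ M₃ := by positivity
  have hC₃ : 0 ≤ C₃ := by positivity
  have h24 : (2 : ℝ≥0∞) ≤ 4 := by norm_num
  have hM : 0 ≤ M₁ + M₂ + M₃ := by positivity
  have hC : 0 ≤ C₁ + C₂ + C₃ := by positivity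
  have B₁ := (b₁.mono_exponent h24).mono (show M₁ ≤ M₁ + M₂ + M₃ by linarith)
  have B₂ := (b₂.mono_exponent h24).mono (show M₂ ≤ M₁ + M₂ + M₃ by linarith)
  have B₃ := b₃.mono (show M₃ ≤ M₁ + M₂ + M₃ by linarith)
  have key {E : Type} [NormedAddCommGroup E] [InnerProductSpace ℝ E] [MeasurableSpace E]
      [BorelSpace E] [SecondCountableTopology E] [CompleteSpace E] {G : (ℕ → S) → E}
      (hG : StronglyMeasurable G) (hb : LpBound P 2 (fun ω => G (past ε 0 ω)) (M₁ + M₂ + M₃))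
      {C' : ℝ} (hC' : C' ≤ C₁ + C₂ + C₃)
      (hc : ∀ m : ℕ, 1 ≤ m → LpBound P 2 (fun ω => G (past ε 0 ω) - G (coupledPast ε εs m 0 ω))
        (C' * (m : ℝ) ^ (-(min α β)))) :
      Approximable P ε (fun j ω => G (past ε j ω) - meanLp P ε G) (2 * (M₁ + M₂ + M₃))
        (2 * (C₁ + C₂ + C₃)) (min α β) :=
    approximable_of_coupling hXY.measurable_ε hXY.indep_ε hXY.identDistrib_ε hXY.measurable_εs
      hXY.indep_εs hG hM hC hγ hb fun m hm => (hc m hm).mono (by gcongr)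
  refine ⟨2 * (M₁ + M₂ + M₃), 2 * (C₁ + C₂ + C₃), min α β, B₁.mono (by linarith),
    B₂.mono (by linarith), B₃.mono (by linarith), ?_, ?_, ?_⟩
  · exact key hg1 B₁ (C' := C₁) (by linarith) fun m hm => (c₁ m hm).mono_exponent h24
  · exact key hg2 B₂ (C' := C₂) (by linarith) fun m hm => (c₂ m hm).mono_exponent h24
  · exact key hts B₃ (C' := C₃) (by linarith) c₃

end Model

/-- Sample residuals are unchanged by subtracting the true means, so the triangle inequality
separates the centring error from the error of the form in the truly centred tensors. -/
lemma enorm_sub_quadForm_sampleResidual_le {E F G : Type*} [NormedAddCommGroup E]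
    [InnerProductSpace ℝ E] [NormedAddCommGroup F] [InnerProductSpace ℝ F] [NormedAddCommGroup G]
    [InnerProductSpace ℝ G] {T : ℕ} (hT : T ≠ 0) {w : ℤ → ℝ} {B : ℝ} {L : ℕ} (hw : IsBand w B L)
    (κ : E →L[ℝ] E →L[ℝ] F) (hκ : ∀ x y, ‖κ x y‖ ≤ ‖x‖ * ‖y‖)
    (τ : F →L[ℝ] F →L[ℝ] G) (hτ : ∀ x y, ‖τ x y‖ ≤ ‖x‖ * ‖y‖) (x y : ℤ → E) (m m' : E) (c : F)
    (D : G) :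
    ‖D - (T : ℝ)⁻¹ • quadForm τ (Finset.Icc (1 : ℤ) T) w (sampleResidual κ T x y)
      (sampleResidual κ T x y)‖ₑ ≤
    ‖(T : ℝ)⁻¹ • quadForm τ (Finset.Icc (1 : ℤ) T) w (fun j => κ (x j - m) (y j - m') - c)
      (fun j => κ (x j - m) (y j - m') - c) - D‖ₑ +
    ENNReal.ofReal (48 * B * ((2 * L + 1) / √T) * (1 + controlSum T (fun j => x j - m)
      (fun j => y j - m') (fun j => κ (x j - m) (y j - m') - c)) ^ 2) := by
  have hres : sampleResidual κ T x y = sampleResidual κ T (fun j => x j - m) (fun j => y j - m') :=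
    funext fun j => (sampleResidual_sub_const hT κ x y m m' j).symm
  have hbound := norm_quadForm_sampleResidual_sub_le hT hw κ hκ τ hτ (fun j => x j - m)
    (fun j => y j - m') c
  rw [← hres, smul_sub] at hbound
  have key : ∀ q q' : G, ‖D - q‖ₑ ≤ ‖q' - D‖ₑ + ‖q - q'‖ₑ := fun q q' => by
    rw [← enorm_neg]
    refine le_of_eq_of_le ?_ (enorm_add_le _ _)
    congr 1
    abel
  refine (key _ _).trans (add_le_add le_rfl ?_)
  exact (ofReal_norm _).symm.trans_le (ENNReal.ofReal_le_ofReal hbound)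

/-! ### Pointwise kernels, their L² classes, and consistency. -/

section Kernels

variable {Ω S : Type*} [MeasurableSpace Ω] [MeasurableSpace S] {P : Measure Ω}
  [IsProbabilityMeasure P] {X Y : ℤ → Ω → I → ℝ} {ε : ℤ → Ω → S} {εs : ℕ → ℤ → Ω → S}
  {g : (ℕ → S) → L2 × L2} {p α β : ℝ}

lemma measurable_meanFun (hX : Measurable (Function.uncurry (X 0))) : Measurable (meanFun P X) :=
  (hX.stronglyMeasurable.integral_prod_left' (μ := P)).measurable

lemma WeaklyDependent.measurable_centeredProduct (hXY : WeaklyDependent P X Y ε εs g p α β)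
    (j : ℤ) : Measurable (Function.uncurry fun ω (z : I × I) =>
      centeredProduct P X Y j z.1 z.2 ω) := by
  have hx := hXY.measurable_X j
  have hy := hXY.measurable_Y j
  have mx := measurable_meanFun (P := P) (hXY.measurable_X 0)
  have my := measurable_meanFun (P := P) (hXY.measurable_Y 0)
  have e1 : Measurable fun q : Ω × I × I => X j q.1 q.2.1 :=
    hx.comp (measurable_fst.prodMk (measurable_fst.comp measurable_snd))
  have e2 : Measurable fun q : Ω × I × I => Y j q.1 q.2.2 :=
    hy.comp (measurable_fst.prodMk (measurable_snd.comp measurable_snd))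
  exact (e1.sub (mx.comp (measurable_fst.comp measurable_snd))).mul
    (e2.sub (my.comp (measurable_snd.comp measurable_snd)))

lemma WeaklyDependent.ae_represents (hXY : WeaklyDependent P X Y ε εs g p α β) :
    ∀ᵐ ω ∂P, ∀ j, Represents volume (X j ω) (g (past ε j ω)).1 ∧
      Represents volume (Y j ω) (g (past ε j ω)).2 :=
  ae_all_iff.2 fun j => (hXY.X_eq j).and (hXY.Y_eq j)

variable [MeasurableSpace L2] [BorelSpace L2]
    [MeasurableSpace (Lp ℝ 2 ((volume : Measure I).prod (volume : Measure I)))]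
    [BorelSpace (Lp ℝ 2 ((volume : Measure I).prod (volume : Measure I)))]

lemma WeaklyDependent.integrable_fst (hXY : WeaklyDependent P X Y ε εs g p α β) :
    Integrable (fun ω => (g (past ε 0 ω)).1) P := by
  obtain ⟨-, M, C, γ, h, -⟩ := hXY.exists_approximable
  exact h.integrable one_le_two

lemma WeaklyDependent.integrable_snd (hXY : WeaklyDependent P X Y ε εs g p α β) :
    Integrable (fun ω => (g (past ε 0 ω)).2) P := by
  obtain ⟨-, M, C, γ, -, h, -⟩ := hXY.exists_approximable
  exact h.integrable one_le_two

lemma WeaklyDependent.represents_meanFun_fst (hXY : WeaklyDependent P X Y ε εs g p α β) :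
    Represents volume (meanFun P X) (meanLp P ε fun e => (g e).1) :=
  Represents.integral (hXY.measurable_X 0) hXY.integrable_fst (hXY.X_eq 0)

lemma WeaklyDependent.represents_meanFun_snd (hXY : WeaklyDependent P X Y ε εs g p α β) :
    Represents volume (meanFun P Y) (meanLp P ε fun e => (g e).2) :=
  Represents.integral (hXY.measurable_Y 0) hXY.integrable_snd (hXY.Y_eq 0)

lemma WeaklyDependent.represents_centeredProduct (hXY : WeaklyDependent P X Y ε εs g p α β) :
    ∀ᵐ ω ∂P, ∀ j, Represents (volume.prod volume)
      (fun z : I × I => centeredProduct P X Y j z.1 z.2 ω) (tensorShift P ε g (past ε j ω)) := by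
  filter_upwards [hXY.ae_represents] with ω hω j
  exact ((hω j).1.sub hXY.represents_meanFun_fst).tensor ((hω j).2.sub hXY.represents_meanFun_snd)

lemma WeaklyDependent.memLp_tensorShift (hXY : WeaklyDependent P X Y ε εs g p α β) (j : ℤ) :
    MemLp (fun ω => tensorShift P ε g (past ε j ω)) 2 P := by
  obtain ⟨hm, M, C, γ, -, -, h, -⟩ := hXY.exists_approximable
  exact (h.past hXY.measurable_ε hXY.indep_ε hXY.identDistrib_ε hm j).memLp

lemma WeaklyDependent.represents_mean_centeredProduct
    (hXY : WeaklyDependent P X Y ε εs g p α β) (j : ℤ) :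
    Represents (volume.prod volume) (fun z : I × I => ∫ ω, centeredProduct P X Y j z.1 z.2 ω ∂P)
      (meanLp P ε (tensorShift P ε g)) := by
  have h := Represents.integral (hXY.measurable_centeredProduct j)
    ((hXY.memLp_tensorShift j).integrable one_le_two)
    (hXY.represents_centeredProduct.mono fun ω h => h j)
  rwa [integral_past_eq hXY.measurable_ε hXY.indep_ε hXY.identDistrib_ε
    hXY.exists_approximable.1] at h

/-- The centered products are square integrable at almost every argument. -/
lemma WeaklyDependent.ae_memLp_centeredProduct (hXY : WeaklyDependent P X Y ε εs g p α β)
    (j : ℤ) : ∀ᵐ z : I × I, MemLp (centeredProduct P X Y j z.1 z.2) 2 P := by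
  have hm := hXY.measurable_centeredProduct j
  have hm2 : Measurable fun q : Ω × I × I => ‖centeredProduct P X Y j q.2.1 q.2.2 q.1‖ₑ ^ (2 : ℝ) :=
    hm.enorm.pow_const 2
  have hfin : ∫⁻ z : I × I, ∫⁻ ω, ‖centeredProduct P X Y j z.1 z.2 ω‖ₑ ^ (2 : ℝ) ∂P
      ∂(volume.prod volume) ≠ ∞ := by
    rw [lintegral_lintegral_swap (f := fun (z : I × I) ω =>
      ‖centeredProduct P X Y j z.1 z.2 ω‖ₑ ^ (2 : ℝ)) (hm2.comp measurable_swap).aemeasurable]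
    have e : ∫⁻ ω, ∫⁻ z : I × I, ‖centeredProduct P X Y j z.1 z.2 ω‖ₑ ^ (2 : ℝ)
        ∂(volume.prod volume) ∂P = ∫⁻ ω, ‖tensorShift P ε g (past ε j ω)‖ₑ ^ (2 : ℝ) ∂P := by
      refine lintegral_congr_ae ?_
      filter_upwards [hXY.represents_centeredProduct] with ω hω
      rw [Lp.enorm_def, ← eLpNorm_congr_ae (hω j),
        eLpNorm_eq_lintegral_rpow_enorm_toReal two_ne_zero ENNReal.ofNat_ne_top,
        ← ENNReal.rpow_mul]
      simp
    rw [e]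
    have h2 := (eLpNorm_lt_top_iff_lintegral_rpow_enorm_lt_top two_ne_zero
      ENNReal.ofNat_ne_top).1 (hXY.memLp_tensorShift j).2
    simpa using h2.ne
  filter_upwards [ae_lt_top (hm2.lintegral_prod_left' (μ := P)) hfin] with z hz
  refine ⟨(hm.comp (measurable_id.prodMk measurable_const)).aestronglyMeasurable, ?_⟩
  rw [eLpNorm_lt_top_iff_lintegral_rpow_enorm_lt_top two_ne_zero ENNReal.ofNat_ne_top]
  simpa using hz

/-- The centered tensor products as elements of `L²`. -/
noncomputable def centeredShift (P : Measure Ω) (ε : ℤ → Ω → S) (g : (ℕ → S) → L2 × L2) (j : ℤ)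
    (ω : Ω) : Lp ℝ 2 ((volume : Measure I).prod (volume : Measure I)) :=
  tensorShift P ε g (past ε j ω) - meanLp P ε (tensorShift P ε g)

/-- The autocovariances as elements of `L²`. -/
noncomputable def autocovLp (P : Measure Ω) (ε : ℤ → Ω → S) (g : (ℕ → S) → L2 × L2) (ℓ : ℤ) :
    Lp ℝ 2 (((volume : Measure I).prod (volume : Measure I)).prod
      ((volume : Measure I).prod (volume : Measure I))) :=
  ∫ ω, tensor (volume.prod volume) (centeredShift P ε g 0 ω) (centeredShift P ε g ℓ ω) ∂P

/-- A covariance is the expectation of a product of centred factors, here the pointwise value of a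
tensor product, so the Bochner integral is computed pointwise. -/
lemma WeaklyDependent.represents_autocov (hXY : WeaklyDependent P X Y ε εs g p α β) (ℓ : ℤ) :
    Represents ((volume.prod volume).prod (volume.prod volume))
      (fun z : (I × I) × (I × I) => autocov P X Y ℓ z.1.1 z.1.2 z.2.1 z.2.2)
      (autocovLp P ε g ℓ) := by
  obtain ⟨-, M, C, γ, -, -, -, -, -, hζ⟩ := hXY.exists_approximable
  have hc : ∀ j, Measurable fun q : Ω × I × I => centeredProduct P X Y j q.2.1 q.2.2 q.1 -
      ∫ x, centeredProduct P X Y j q.2.1 q.2.2 x ∂P := fun j =>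
    (hXY.measurable_centeredProduct j).sub
      (((hXY.measurable_centeredProduct j).stronglyMeasurable.integral_prod_left'
        (μ := P)).measurable.comp measurable_snd)
  have hm : Measurable (Function.uncurry fun ω (z : (I × I) × (I × I)) =>
      (centeredProduct P X Y 0 z.1.1 z.1.2 ω - ∫ x, centeredProduct P X Y 0 z.1.1 z.1.2 x ∂P) *
      (centeredProduct P X Y ℓ z.2.1 z.2.2 ω - ∫ x, centeredProduct P X Y ℓ z.2.1 z.2.2 x ∂P)) :=
    ((hc 0).comp (measurable_fst.prodMk (measurable_fst.comp measurable_snd))).mul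
      ((hc ℓ).comp (measurable_fst.prodMk (measurable_snd.comp measurable_snd)))
  refine Represents.integral hm (((hζ.bound 0).bilin (hζ.bound ℓ) (r := 1) (tensor _)
    (norm_bilin_le inner_tensor) hζ.M_nonneg).integrable le_rfl) ?_
  filter_upwards [hXY.represents_centeredProduct] with ω hω
  exact ((hω 0).sub (hXY.represents_mean_centeredProduct 0)).tensor
    ((hω ℓ).sub (hXY.represents_mean_centeredProduct ℓ))

lemma WeaklyDependent.summable_norm_autocovLp (hXY : WeaklyDependent P X Y ε εs g p α β) :
    Summable fun ℓ => ‖autocovLp P ε g ℓ‖ := by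
  obtain ⟨-, M, C, γ, -, -, -, -, -, hζ⟩ := hXY.exists_approximable
  let _ : MeasurableSpace (Lp ℝ 2 (((volume : Measure I).prod (volume : Measure I)).prod
    ((volume : Measure I).prod (volume : Measure I)))) := borel _
  have : BorelSpace (Lp ℝ 2 (((volume : Measure I).prod (volume : Measure I)).prod
    ((volume : Measure I).prod (volume : Measure I)))) := ⟨rfl⟩
  exact hζ.summable_norm hXY.measurable_ε hXY.indep_ε (tensor _) (norm_bilin_le inner_tensor)
    fun d => rfl

/-- Summability of the L² norms forces almost everywhere convergence to the L² sum; the exceptional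
sets of the representatives are countably many. -/
lemma WeaklyDependent.ae_hasSum_autocov (hXY : WeaklyDependent P X Y ε εs g p α β) :
    ∀ᵐ z : (I × I) × (I × I) ∂((volume.prod volume).prod (volume.prod volume)),
      HasSum (fun ℓ => autocov P X Y ℓ z.1.1 z.1.2 z.2.1 z.2.2)
        ((∑' ℓ, autocovLp P ε g ℓ :
          Lp ℝ 2 (((volume : Measure I).prod (volume : Measure I)).prod
            ((volume : Measure I).prod (volume : Measure I)))) z) := by
  have hs : ∑' ℓ, ‖autocovLp P ε g ℓ‖ₑ ≠ ∞ := by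
    have := hXY.summable_norm_autocovLp.tsum_ofReal_ne_top
    simpa only [ofReal_norm] using this
  have hr : ∀ᵐ z : (I × I) × (I × I) ∂((volume.prod volume).prod (volume.prod volume)),
      ∀ ℓ, autocov P X Y ℓ z.1.1 z.1.2 z.2.1 z.2.2 = autocovLp P ε g ℓ z :=
    ae_all_iff.2 fun ℓ => hXY.represents_autocov ℓ
  filter_upwards [Lp.hasSum_coeFn_tsum hs, hr] with z h1 h2
  simpa only [h2] using h1

lemma WeaklyDependent.represents_longRunCov (hXY : WeaklyDependent P X Y ε εs g p α β) :
    Represents ((volume.prod volume).prod (volume.prod volume))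
      (fun z : (I × I) × (I × I) => longRunCov P X Y z.1.1 z.1.2 z.2.1 z.2.2)
      (∑' ℓ, autocovLp P ε g ℓ) := by
  filter_upwards [hXY.ae_hasSum_autocov] with z hz
  exact hz.tsum_eq

lemma WeaklyDependent.norm4_sub_estimator_le (hXY : WeaklyDependent P X Y ε εs g p α β)
    {W : ℝ → ℝ} {h : ℕ → ℝ} {T : ℕ} (hT : T ≠ 0) {B : ℝ} {L : ℕ}
    (hw : IsBand (fun d : ℤ => W (d / h T)) B L) {ω : Ω}
    (hX : ∀ j, Represents volume (X j ω) (g (past ε j ω)).1)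
    (hY : ∀ j, Represents volume (Y j ω) (g (past ε j ω)).2) :
    norm4 (fun t s u v => longRunCov P X Y t s u v - estimator X Y W h T ω t s u v) ≤
      ‖(T : ℝ)⁻¹ • quadForm (tensor (volume.prod volume)) (Finset.Icc (1 : ℤ) T)
        (fun d => W (d / h T)) (fun j => centeredShift P ε g j ω)
        (fun j => centeredShift P ε g j ω) - ∑' d, autocovLp P ε g d‖ₑ +
      ENNReal.ofReal (48 * B * ((2 * L + 1) / √T) *
        (1 + controlSum T (fun j => (g (past ε j ω)).1 - meanLp P ε fun e => (g e).1)
          (fun j => (g (past ε j ω)).2 - meanLp P ε fun e => (g e).2)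
          (fun j => centeredShift P ε g j ω)) ^ 2) := by
  rw [norm4_eq_of_represents (hXY.represents_longRunCov.sub
    (represents_estimator (W := W) (h := h) (T := T) hX hY))]
  exact enorm_sub_quadForm_sampleResidual_le hT hw (tensor (volume : Measure I))
    (norm_bilin_le inner_tensor) (tensor _) (norm_bilin_le inner_tensor) _ _ _ _
    (meanLp P ε (tensorShift P ε g)) _

theorem WeaklyDependent.isLittleOP_estimator (hXY : WeaklyDependent P X Y ε εs g p α β)
    [MeasurableSpace (Lp ℝ 2 (((volume : Measure I).prod (volume : Measure I)).prod
      ((volume : Measure I).prod (volume : Measure I))))]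
    [BorelSpace (Lp ℝ 2 (((volume : Measure I).prod (volume : Measure I)).prod
      ((volume : Measure I).prod (volume : Measure I))))]
    {W : ℝ → ℝ} {b : ℝ} (hW : IsWeightFunction W b) {h : ℕ → ℝ} (h_top : Tendsto h atTop atTop)
    (h_rate : Tendsto (fun T : ℕ => h T / (T : ℝ) ^ (1 / 2 : ℝ)) atTop (𝓝 0)) :
    IsLittleOP P (fun T ω => norm4 (fun t s u v =>
      longRunCov P X Y t s u v - estimator X Y W h T ω t s u v)) := by
  obtain ⟨hm, M, C, γ, -, -, -, hx, hy, hζ⟩ := hXY.exists_approximable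
  obtain ⟨B, L, hw, hw1, hL⟩ := hW.exists_band h_top h_rate
  have hε := hXY.measurable_ε
  have hi := hXY.indep_ε
  have hB : 0 ≤ B := hw.exists.choose_spec.nonneg
  set x : ℤ → Ω → L2 := fun j ω => (g (past ε j ω)).1 - meanLp P ε fun e => (g e).1
  set y : ℤ → Ω → L2 := fun j ω => (g (past ε j ω)).2 - meanLp P ε fun e => (g e).2
  set ζ := centeredShift P ε g
  set τ := tensor ((volume : Measure I).prod (volume : Measure I))
  -- Stationarity of the Bernoulli shift: the covariance depends on the lag only.
  have hΓ : ∀ j k, ∫ ω, τ (ζ j ω) (ζ k ω) ∂P = autocovLp P ε g (k - j) := fun j k =>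
    integral_bilin_past_eq hε hi hXY.identDistrib_ε
      (G := fun e => tensorShift P ε g e - meanLp P ε (tensorShift P ε g))
      (hm.sub stronglyMeasurable_const) τ j k
  have hlim := hζ.tendsto_quadForm hε hi hw hw1 hL τ inner_tensor hΓ
  have hc0 : 0 ≤ ∑' d, covBound M C γ d :=
    tsum_nonneg fun d => covBound_nonneg hζ.M_nonneg hζ.C_nonneg γ d
  -- `R` is the error of the form in the truly centred tensors, `s` controls the sample centring,
  -- and `c` is of the order of band width over √T.
  refine isLittleOP_of_le (R := fun T ω => (T : ℝ)⁻¹ • quadForm τ (Finset.Icc (1 : ℤ) T)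
      (fun d => W (d / h T)) (fun j => ζ j ω) (fun j => ζ j ω) - ∑' d, autocovLp P ε g d)
    (s := fun T ω => controlSum T (fun j => x j ω) (fun j => y j ω) (fun j => ζ j ω))
    (c := fun T => 48 * B * ((2 * L T + 1) / √(T : ℝ)))
    (M := 3 * (∑' d, covBound M C γ d) + 3 * M ^ 2) ?_ ?_ hlim ?_ ?_ ?_ ?_
  · filter_upwards [hw, eventually_ne_atTop 0] with T hwT hT
    filter_upwards [hXY.ae_represents] with ω hω
    exact hXY.norm4_sub_estimator_le hT hwT (fun j => (hω j).1) (fun j => (hω j).2)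
  · filter_upwards [hw] with T hwT
    have hq : AEStronglyMeasurable (fun ω => quadForm τ (Finset.Icc (1 : ℤ) T)
        (fun d => W (d / h T)) (fun j => ζ j ω) (fun j => ζ j ω)) P :=
      (hwT.lpBound_quadForm τ (norm_bilin_le inner_tensor) _ hζ.bound hζ.bound hζ.M_nonneg
        hζ.M_nonneg).aesm
    exact (AEStronglyMeasurable.const_smul hq (T : ℝ)⁻¹).sub aestronglyMeasurable_const
  · simpa using hL.const_mul (48 * B)
  · exact Eventually.of_forall fun T => by positivity
  · filter_upwards [eventually_ne_atTop 0] with T hT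
    have hs {E : Type} [NormedAddCommGroup E] [InnerProductSpace ℝ E] [MeasurableSpace E]
        [BorelSpace E] [SecondCountableTopology E] [CompleteSpace E] {a : ℤ → Ω → E}
        (ha : Approximable P ε a M C γ) : LpBound P 2 (fun ω => ∑ j ∈ Finset.Icc (1 : ℤ) T, a j ω)
          (√(T * ∑' d, covBound M C γ d)) := by
      simpa using ha.lpBound_sum hε hi (Finset.Icc (1 : ℤ) T)
    exact LpBound.controlSum hT hζ.M_nonneg hc0 hx.bound hy.bound hζ.bound (hs hx) (hs hy) (hs hζ)
  · exact fun T ω => controlSum_nonneg _ _ _ _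

end Kernels

end FTS

theorem theorem4p1 {Ω S : Type*} [MeasurableSpace Ω] [MeasurableSpace S]
    (P : Measure Ω) [IsProbabilityMeasure P]
    (X Y : ℤ → Ω → unitInterval → ℝ)
    (ε : ℤ → Ω → S) (εs : ℕ → ℤ → Ω → S) (g : (ℕ → S) → FTS.L2 × FTS.L2) (p α β : ℝ)
    (hXY : FTS.WeaklyDependent P X Y ε εs g p α β)
    (W : ℝ → ℝ) (b : ℝ) (hW : FTS.IsWeightFunction W b)
    (h : ℕ → ℝ) (h_top : Tendsto h atTop atTop)
    (h_rate : Tendsto (fun T : ℕ => h T / (T : ℝ) ^ (1 / 2 : ℝ)) atTop (𝓝 0)) :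
    -- the means, covariances and the series that define `D` exist almost everywhere
    (∀ᵐ t : unitInterval, Integrable (fun ω => X 0 ω t) P ∧ Integrable (fun ω => Y 0 ω t) P) ∧
    (∀ ℓ : ℤ, ∀ᵐ z : unitInterval × unitInterval,
      MemLp (FTS.centeredProduct P X Y ℓ z.1 z.2) 2 P) ∧
    (∀ᵐ z : unitInterval × unitInterval × unitInterval × unitInterval,
      Summable (fun ℓ : ℤ => FTS.autocov P X Y ℓ z.1 z.2.1 z.2.2.1 z.2.2.2)) ∧
    -- `D` lies in `L²[0,1]⁴`
    MemLp (FTS.uncurry4 (FTS.longRunCov P X Y)) 2 volume ∧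
    -- consistency
    FTS.IsLittleOP P (fun T ω => FTS.norm4 (fun t s u v =>
      FTS.longRunCov P X Y t s u v - FTS.estimator X Y W h T ω t s u v)) := by
  let _ : MeasurableSpace FTS.L2 := borel _
  have : BorelSpace FTS.L2 := ⟨rfl⟩
  let _ : MeasurableSpace (Lp ℝ 2 ((volume : Measure I).prod (volume : Measure I))) := borel _
  have : BorelSpace (Lp ℝ 2 ((volume : Measure I).prod (volume : Measure I))) := ⟨rfl⟩
  let _ : MeasurableSpace (Lp ℝ 2 (((volume : Measure I).prod (volume : Measure I)).prod
    ((volume : Measure I).prod (volume : Measure I)))) := borel _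
  have : BorelSpace (Lp ℝ 2 (((volume : Measure I).prod (volume : Measure I)).prod
    ((volume : Measure I).prod (volume : Measure I)))) := ⟨rfl⟩
  refine ⟨?_, hXY.ae_memLp_centeredProduct, ?_,
    FTS.memLp_uncurry4_of_represents hXY.represents_longRunCov,
    hXY.isLittleOP_estimator hW h_top h_rate⟩
  · exact (FTS.Represents.integrable_uncurry (hXY.measurable_X 0) hXY.integrable_fst
      (hXY.X_eq 0)).prod_left_ae.and (FTS.Represents.integrable_uncurry (hXY.measurable_Y 0)
        hXY.integrable_snd (hXY.Y_eq 0)).prod_left_ae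
  · filter_upwards [FTS.measurePreserving_assoc.quasiMeasurePreserving.ae
      hXY.ae_hasSum_autocov] with z hz
    exact hz.summable
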